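/- Let $d\ge 1$, let $\mathbb T^d=\mathbb R^d/\mathbb Z^d$, and let $a:\mathbb R^d\to[0,\infty)$ and $\Lambda:\mathbb R^d\times\mathbb R^d\to\mathbb R$ be measurable functions such that * $\int_{\mathbb R^d}a(z)\,dz=1$, and there are $p>1$, $k>0$, $C>0$ with $a(z)\le C e^{-k|z|^p}$ for all $z$; * $\int_{\{z\cdot\alpha>0\}}a(z)\,dz>0$ for every unit vector $\alpha$; * $\Lambda(x+j,y+j')=\Lambda(x,y)$ for all $j,j'\in\mathbb Z^d$, and $0<\Lambda^-\le\Lambda\le\Lambda^+<\infty$ for some constants $\Lambda^\pm$. For $\lambda\in\mathbb R^d$ let $A_\lambda$ be the bounded operator on the complex space $L^2(\mathbb T^d)$ (elements being read as periodic functions on $\mathbb R^d$) $$A_\lambda v(x)=\int_{\mathbb R^d}a(x-y)\Lambda(x,y)e^{\lambda\cdot(y-x)}v(y)\,dy-G(x)v(x),\qquad G(x)=\int_{\mathbb R^d}a(x-y)\Lambda(x,y)\,dy .$$ Let $g_{\min}$ be the essential minimum of $G$ (its minimum, if $G$ is continuous), and let $H(\lambda)=\mathtt s(A_\lambda)$ be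 the supremum of the real parts of the points of the spectrum $\sigma(A_\lambda)$. A real number $\theta$ is called the principal eigenvalue of $A_\lambda$ if it is an eigenvalue with an eigenfunction that is positive almost everywhere and $\mathrm{Re}\,z<\theta$ for every $z\in\sigma(A_\lambda)\setminus\{\theta\}$. Let $\Gamma$ be the set of those $\lambda$ for which $A_\lambda$ has a principal eigenvalue $\theta(\lambda)$ with $\theta(\lambda)>-g_{\min}$. Then: 1. The supremum in the definition of $H(\lambda)$ is attained for all $\lambda$; moreover $H(\lambda)=\theta(\lambda)$ for $\lambda\in\Gamma$, and $H(\lambda)=-g_{\min}$ for $\lambda\in\mathbb R^d\setminus\Gamma$. 2. $H$ is convex on $\mathbb R^d$. 3. $H$ is strictly convex on $\Gamma$: the set $\Gamma$ is open, $H$ is twice continuously differentiable on $\Gamma$ with positive definite Hessian at every $\lambda\in\Gamma$, and $H(t\lambda+(1-t)\mu)<tH(\lambda)+(1-t)H(\mu)$ for all $\lambda\ne\mu$ in $\Gamma$ and $0<t<1$. 4. $H(\lambda)/|\lambda|\to+\infty$ as $|\lambda|\to\infty$. Moreover, there are constants $R_0>0$, $c_a>0$, $c_e>0$ and $C_s\in\mathbb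 R$ (depending on $a$ and $\Lambda$ only) such that every $\lambda$ with $|\lambda|\ge R_0$ belongs to $\Gamma$ and satisfies $\theta(\lambda)\ge c_a e^{c_e|\lambda|}-C_s$. -/

import Mathlib

open MeasureTheory Filter Topology Set
open scoped ENNReal InnerProductSpace

noncomputable section

namespace PeriodicJump

/-- The space `ℝ^d` with its Euclidean norm. -/
abbrev Space (d : ℕ) : Type := EuclideanSpace ℝ (Fin d)

/-- The torus `𝕋^d = ℝ^d / ℤ^d`, with its Lebesgue (Haar) measure of total mass one. -/
abbrev Torus (d : ℕ) : Type := UnitAddTorus (Fin d)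

/-- The complex Hilbert space `L²(𝕋^d)`. -/
abbrev L2 (d : ℕ) : Type := Lp ℂ 2 (volume : Measure (Torus d))

/-- The vector of `ℝ^d` with the given integer coordinates. -/
def latticeVec {d : ℕ} (j : Fin d → ℤ) : Space d := WithLp.toLp 2 fun i => (j i : ℝ)

/-- The quotient map `ℝ^d → 𝕋^d`. -/
def proj {d : ℕ} (x : Space d) : Torus d := fun i => (x i : UnitAddCircle)

/-- The representative in `[0,1)^d` of a point of `𝕋^d`. -/
def rep {d : ℕ} (s : Torus d) : Space d :=
  WithLp.toLp 2 fun i => (AddCircle.equivIco (1 : ℝ) 0 (s i) : ℝ)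

/-- The data of a jump process in a periodic environment: the convolution kernel `a` and the
periodic function `Λ`, with the standing assumptions on them. That `a` is bounded follows from
`tail_a`, that it is integrable from `integral_a`. -/
structure Environment (d : ℕ) where
  /-- the convolution kernel -/
  a : Space d → ℝ
  /-- the periodic environment -/
  Λ : Space d → Space d → ℝ
  measurable_a : Measurable a
  nonneg_a : ∀ z, 0 ≤ a z
  integral_a : ∫ z, a z = 1
  tail_a : ∃ p > (1 : ℝ), ∃ k > (0 : ℝ), ∃ C > (0 : ℝ), ∀ z, a z ≤ C * Real.exp (-k * ‖z‖ ^ p)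
  halfSpace_a : ∀ α : Space d, ‖α‖ = 1 → 0 < ∫ z in {z : Space d | 0 < ⟪z, α⟫_ℝ}, a z
  measurable_Λ : Measurable (Function.uncurry Λ)
  periodic_Λ : ∀ (j j' : Fin d → ℤ) (x y : Space d),
    Λ (x + latticeVec j) (y + latticeVec j') = Λ x y
  bounds_Λ : ∃ Λmin > (0 : ℝ), ∃ Λmax : ℝ, ∀ x y, Λmin ≤ Λ x y ∧ Λ x y ≤ Λmax

namespace Environment

variable {d : ℕ} (P : Environment d)

/-- The total jump rate `G(x) = ∫ a(x-y) Λ(x,y) dy`. -/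
def G (x : Space d) : ℝ := ∫ y, P.a (x - y) * P.Λ x y

/-- `g_min`, the (essential) minimum of `G`. -/
def gMin : ℝ := essInf P.G volume

/-- The jump part `∫ a(x-y) Λ(x,y) e^{l·(y-x)} v(y) dy` of the skewed generator; a function
`v` on the torus is read as a periodic function on `ℝ^d`. -/
def jump (l : Space d) (v : Torus d → ℂ) (x : Space d) : ℂ :=
  ∫ y, ((P.a (x - y) * P.Λ x y * Real.exp ⟪l, y - x⟫_ℝ : ℝ) : ℂ) * v (proj y)

/-- `(A_l v)(x) = ∫ a(x-y) Λ(x,y) e^{l·(y-x)} v(y) dy - (∫ a(x-y) Λ(x,y) dy) v(x)`. -/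
def skewedFun (l : Space d) (v : Torus d → ℂ) (x : Space d) : ℂ :=
  P.jump l v x - (P.G x : ℂ) * v (proj x)

/-! ### The skewed generator is a bounded operator on `L²(𝕋^d)` -/

@[fun_prop]
theorem measurable_proj : Measurable (proj : Space d → Torus d) := by
  refine measurable_pi_lambda _ fun i => ?_
  exact AddCircle.measurable_mk'.comp (by fun_prop)

@[fun_prop]
theorem measurable_rep : Measurable (rep : Torus d → Space d) := by
  refine (WithLp.measurable_toLp 2 (Fin d → ℝ)).comp (measurable_pi_lambda _ fun i => ?_)
  exact measurable_subtype_coe.comp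
    ((AddCircle.measurableEquivIco (1 : ℝ) 0).measurable.comp (measurable_pi_apply i))

theorem proj_rep (s : Torus d) : proj (rep s) = s := by
  funext i
  exact AddCircle.coe_equivIco

theorem proj_sub (x y : Space d) : proj (x - y) = proj x - proj y := by
  funext i
  simp [proj]

/-- The weight `a(z) e^{-l·z}`. -/
def weight (l z : Space d) : ℝ := P.a z * Real.exp (-⟪l, z⟫_ℝ)

theorem weight_nonneg (l z : Space d) : 0 ≤ P.weight l z :=
  mul_nonneg (P.nonneg_a z) (Real.exp_pos _).le

@[fun_prop]
theorem measurable_weight (l : Space d) : Measurable (P.weight l) := by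
  have := P.measurable_a
  unfold weight
  fun_prop

theorem integrable_weight (l : Space d) : Integrable (P.weight l) := by
  obtain ⟨p, hp, k, hk, C, hC, h⟩ := P.tail_a
  set r : ℝ := d + 1
  set M : ℝ := ‖l‖ + r
  have hr : 0 ≤ r := by positivity
  have hM : 0 ≤ M := by positivity
  set t₀ : ℝ := (M / k) ^ (1 / (p - 1))
  have key : ∀ t : ℝ, 0 ≤ t → M * t - k * t ^ p ≤ M * t₀ := by
    intro t ht
    rcases le_total t t₀ with h1 | h1
    · have : 0 ≤ k * t ^ p := by positivity
      nlinarith [mul_le_mul_of_nonneg_left h1 hM]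
    · have h2 : M / k ≤ t ^ (p - 1) := by
        have h3 : t₀ ^ (p - 1) = M / k := by
          rw [← Real.rpow_mul (by positivity), one_div_mul_cancel (by linarith), Real.rpow_one]
        rw [← h3]
        exact Real.rpow_le_rpow (by positivity) h1 (by linarith)
      have h4 : M ≤ k * t ^ (p - 1) := by rw [div_le_iff₀ hk] at h2; linarith
      have h5 : t ^ p = t ^ (p - 1) * t := by
        rcases ht.eq_or_lt with rfl | ht'
        · rw [Real.zero_rpow (by linarith), mul_zero]
        · rw [Real.rpow_sub_one ht'.ne']; field_simp
      have h6 : 0 ≤ M * t₀ := by positivity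
      rw [h5]
      nlinarith [mul_le_mul_of_nonneg_right h4 ht]
  have hint : Integrable fun z : Space d => C * Real.exp (M * t₀) * (1 + ‖z‖) ^ (-r) :=
    (integrable_one_add_norm (by simp [r])).const_mul _
  refine hint.mono' (P.measurable_weight l).aestronglyMeasurable (ae_of_all _ fun z => ?_)
  rw [Real.norm_of_nonneg (P.weight_nonneg l z)]
  have h1 : Real.exp (-⟪l, z⟫_ℝ) ≤ Real.exp (‖l‖ * ‖z‖) :=
    Real.exp_le_exp.2 ((neg_le_abs _).trans (abs_real_inner_le_norm l z))
  have h2 : Real.exp (-(r * ‖z‖)) ≤ (1 + ‖z‖) ^ (-r) := by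
    rw [Real.rpow_neg (by positivity), Real.exp_neg]
    refine inv_anti₀ (by positivity) ?_
    rw [mul_comm r, Real.exp_mul]
    refine Real.rpow_le_rpow (by positivity) ?_ hr
    linarith [Real.add_one_le_exp ‖z‖]
  calc P.weight l z ≤ C * Real.exp (-k * ‖z‖ ^ p) * Real.exp (‖l‖ * ‖z‖) :=
        mul_le_mul (h z) h1 (Real.exp_pos _).le (by positivity)
    _ = C * Real.exp (M * ‖z‖ - k * ‖z‖ ^ p) * Real.exp (-(r * ‖z‖)) := by
        rw [mul_assoc, mul_assoc, ← Real.exp_add, ← Real.exp_add]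
        congr 2
        simp only [M]
        ring
    _ ≤ C * Real.exp (M * t₀) * (1 + ‖z‖) ^ (-r) := by
        have := Real.exp_le_exp.2 (key ‖z‖ (norm_nonneg z))
        gcongr

/-- Tonelli and translation invariance on the torus. -/
theorem lintegral_weight_mul (l : Space d) {φ : Torus d → ℝ≥0∞} (hφ : Measurable φ) :
    ∫⁻ s, ∫⁻ y, ENNReal.ofReal (P.weight l (rep s - y)) * φ (proj y) =
      (∫⁻ z, ENNReal.ofReal (P.weight l z)) * ∫⁻ s, φ s := by
  have hW := (P.measurable_weight l).ennreal_ofReal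
  have h1 : ∀ s : Torus d, ∫⁻ y, ENNReal.ofReal (P.weight l (rep s - y)) * φ (proj y) =
      ∫⁻ z, ENNReal.ofReal (P.weight l z) * φ (s - proj z) := by
    intro s
    rw [← lintegral_sub_left_eq_self _ (rep s)]
    simp only [sub_sub_cancel, proj_sub, proj_rep]
  simp_rw [h1]
  rw [lintegral_lintegral_swap]
  · have h2 : ∀ z : Space d, ∫⁻ s, ENNReal.ofReal (P.weight l z) * φ (s - proj z) =
        ENNReal.ofReal (P.weight l z) * ∫⁻ s, φ s := by
      intro z
      rw [lintegral_const_mul _ (by fun_prop)]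
      congr 1
      exact lintegral_sub_right_eq_self φ (proj z)
    simp_rw [h2]
    rw [lintegral_mul_const _ hW]
  · have := measurable_proj (d := d)
    exact (by fun_prop : Measurable _).aemeasurable

theorem weight_eq (l x y : Space d) :
    P.a (x - y) * P.Λ x y * Real.exp ⟪l, y - x⟫_ℝ = P.weight l (x - y) * P.Λ x y := by
  have : ⟪l, y - x⟫_ℝ = -⟪l, x - y⟫_ℝ := by rw [← inner_neg_right, neg_sub]
  rw [weight, this]
  ring

/-- The integrals of `jump` only depend on the almost everywhere class of the function. -/
theorem ae_jump_congr (l : Space d) {f g : Torus d → ℂ} (hf : Measurable f) (hg : Measurable g)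
    (h : f =ᵐ[volume] g) : ∀ᵐ s : Torus d, ∀ᵐ y : Space d,
      ((P.a (rep s - y) * P.Λ (rep s) y * Real.exp ⟪l, y - rep s⟫_ℝ : ℝ) : ℂ) * f (proj y) =
      ((P.a (rep s - y) * P.Λ (rep s) y * Real.exp ⟪l, y - rep s⟫_ℝ : ℝ) : ℂ) * g (proj y) := by
  have hW := (P.measurable_weight l).ennreal_ofReal
  have hp := measurable_proj (d := d)
  have hr := measurable_rep (d := d)
  set φ : Torus d → ℝ≥0∞ := {s | f s = g s}ᶜ.indicator 1
  have hφ : Measurable φ := measurable_one.indicator (measurableSet_eq_fun hf hg).compl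
  have h0 : ∫⁻ s, φ s = 0 := by
    rw [lintegral_indicator_one (measurableSet_eq_fun hf hg).compl]
    exact h
  have h1 := P.lintegral_weight_mul l hφ
  rw [h0, mul_zero, lintegral_eq_zero_iff
    (Measurable.lintegral_prod_right' (f := fun q : Torus d × Space d =>
      ENNReal.ofReal (P.weight l (rep q.1 - q.2)) * φ (proj q.2)) (by fun_prop))] at h1
  filter_upwards [h1] with s hs
  have hs' : ∫⁻ y, ENNReal.ofReal (P.weight l (rep s - y)) * φ (proj y) = 0 := hs
  rw [lintegral_eq_zero_iff (by fun_prop)] at hs'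
  filter_upwards [hs'] with y hy
  rw [weight_eq]
  by_cases hfg : f (proj y) = g (proj y)
  · rw [hfg]
  · have hφ1 : φ (proj y) = 1 := indicator_of_mem (by simpa using hfg) _
    have hy' : ENNReal.ofReal (P.weight l (rep s - y)) = 0 := by simpa [hφ1] using hy
    have : P.weight l (rep s - y) = 0 :=
      le_antisymm (ENNReal.ofReal_eq_zero.1 hy') (P.weight_nonneg l _)
    simp [this]

/-- The Cauchy-Schwarz inequality with a weight. -/
theorem sq_lintegral_mul_le {X : Type*} [MeasurableSpace X] (μ : Measure X) {f g : X → ℝ≥0∞}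
    (hf : Measurable f) (hg : Measurable g) :
    (∫⁻ x, f x * g x ∂μ) ^ (2 : ℝ) ≤ (∫⁻ x, f x ∂μ) * ∫⁻ x, f x * g x ^ (2 : ℝ) ∂μ := by
  have e : ∀ c : ℝ≥0∞, c ^ (1 / 2 : ℝ) * c ^ (1 / 2 : ℝ) = c := by
    intro c
    rw [← ENNReal.rpow_add_of_nonneg _ _ (by norm_num) (by norm_num)]
    norm_num
  have e2 : ∀ c : ℝ≥0∞, (c ^ (1 / 2 : ℝ)) ^ (2 : ℝ) = c := by
    intro c
    rw [← ENNReal.rpow_mul]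
    norm_num
  have h2 := ENNReal.lintegral_mul_le_Lp_mul_Lq μ Real.HolderConjugate.two_two
    (f := fun x => f x ^ (1 / 2 : ℝ)) (g := fun x => f x ^ (1 / 2 : ℝ) * g x)
    (by fun_prop) (by fun_prop)
  simp only [Pi.mul_apply, ← mul_assoc, e, e2,
    ENNReal.mul_rpow_of_nonneg _ _ (zero_le_two : (0 : ℝ) ≤ 2)] at h2
  have h3 := ENNReal.rpow_le_rpow h2 (zero_le_two : (0 : ℝ) ≤ 2)
  rwa [ENNReal.mul_rpow_of_nonneg _ _ (zero_le_two : (0 : ℝ) ≤ 2), e2, e2] at h3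

/-- Young's inequality. -/
theorem lintegral_sq_le (l : Space d) {φ : Torus d → ℝ≥0∞} (hφ : Measurable φ) :
    ∫⁻ s, (∫⁻ y, ENNReal.ofReal (P.weight l (rep s - y)) * φ (proj y)) ^ (2 : ℝ) ≤
      (∫⁻ z, ENNReal.ofReal (P.weight l z)) ^ (2 : ℝ) * ∫⁻ s, φ s ^ (2 : ℝ) := by
  set I := ∫⁻ z, ENNReal.ofReal (P.weight l z) with hI
  have h1 : ∀ s : Torus d,
      (∫⁻ y, ENNReal.ofReal (P.weight l (rep s - y)) * φ (proj y)) ^ (2 : ℝ) ≤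
      I * ∫⁻ y, ENNReal.ofReal (P.weight l (rep s - y)) * φ (proj y) ^ (2 : ℝ) := by
    intro s
    have h3 := sq_lintegral_mul_le (volume : Measure (Space d))
      (f := fun y => ENNReal.ofReal (P.weight l (rep s - y))) (g := fun y => φ (proj y))
      (by fun_prop) (by fun_prop)
    rwa [lintegral_sub_left_eq_self (fun z => ENNReal.ofReal (P.weight l z)) (rep s)] at h3
  have hφ2 : Measurable fun s => φ s ^ (2 : ℝ) := by fun_prop
  calc _ ≤ ∫⁻ s, I * ∫⁻ y, ENNReal.ofReal (P.weight l (rep s - y)) * φ (proj y) ^ (2 : ℝ) :=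
        lintegral_mono h1
    _ = I * ∫⁻ s, ∫⁻ y, ENNReal.ofReal (P.weight l (rep s - y)) * φ (proj y) ^ (2 : ℝ) := by
        refine lintegral_const_mul _ ?_
        exact Measurable.lintegral_prod_right' (f := fun q : Torus d × Space d =>
          ENNReal.ofReal (P.weight l (rep q.1 - q.2)) * φ (proj q.2) ^ (2 : ℝ)) (by fun_prop)
    _ = _ := by
        rw [P.lintegral_weight_mul l hφ2, ← mul_assoc]
        rw [← hI, ENNReal.rpow_two, sq]

theorem lintegral_weight_ne_top (l : Space d) :
    ∫⁻ z, ENNReal.ofReal (P.weight l z) ≠ ⊤ :=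
  (P.integrable_weight l).lintegral_lt_top.ne

theorem Λ_nonneg (x y : Space d) : 0 ≤ P.Λ x y := by
  obtain ⟨c, hc, C, h⟩ := P.bounds_Λ
  exact hc.le.trans (h x y).1

theorem enorm_integrand (l : Space d) (v : Torus d → ℂ) (x y : Space d) :
    ‖((P.a (x - y) * P.Λ x y * Real.exp ⟪l, y - x⟫_ℝ : ℝ) : ℂ) * v (proj y)‖ₑ =
      ENNReal.ofReal (P.Λ x y) * (ENNReal.ofReal (P.weight l (x - y)) * ‖v (proj y)‖ₑ) := by
  rw [weight_eq, enorm_mul, ← ofReal_norm, Complex.norm_real,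
    Real.norm_of_nonneg (mul_nonneg (P.weight_nonneg _ _) (P.Λ_nonneg x y)),
    ENNReal.ofReal_mul (P.weight_nonneg _ _)]
  ring

theorem measurable_integrand (l : Space d) {v : Torus d → ℂ} (hv : Measurable v) :
    Measurable fun q : Torus d × Space d =>
      ((P.a (rep q.1 - q.2) * P.Λ (rep q.1) q.2 * Real.exp ⟪l, q.2 - rep q.1⟫_ℝ : ℝ) : ℂ) *
        v (proj q.2) := by
  have hp := measurable_proj (d := d)
  have hr := measurable_rep (d := d)
  have ha := P.measurable_a
  have hΛ : Measurable fun q : Torus d × Space d => P.Λ (rep q.1) q.2 :=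
    P.measurable_Λ.comp (g := Function.uncurry P.Λ)
      (f := fun q : Torus d × Space d => (rep q.1, q.2)) (by fun_prop)
  have he : Measurable fun q : Torus d × Space d => Real.exp ⟪l, q.2 - rep q.1⟫_ℝ := by fun_prop
  have ha' : Measurable fun q : Torus d × Space d => P.a (rep q.1 - q.2) := by fun_prop
  exact (Complex.measurable_ofReal.comp ((ha'.mul hΛ).mul he)).mul (by fun_prop)

theorem measurable_jump (l : Space d) {v : Torus d → ℂ} (hv : Measurable v) :
    Measurable fun s => P.jump l v (rep s) :=
  ((P.measurable_integrand l hv).stronglyMeasurable.integral_prod_right').measurable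

/-- The norm bound for the jump part. -/
theorem exists_jump_bound (l : Space d) : ∃ K : ℝ, 0 ≤ K ∧ ∀ v : Torus d → ℂ, Measurable v →
    eLpNorm (fun s => P.jump l v (rep s)) 2 volume ≤ ENNReal.ofReal K * eLpNorm v 2 volume := by
  obtain ⟨c, hc, C, hΛ⟩ := P.bounds_Λ
  have hC : 0 ≤ C := hc.le.trans ((hΛ 0 0).1.trans (hΛ 0 0).2)
  set I := ∫⁻ z, ENNReal.ofReal (P.weight l z) with hI
  have hIt : I ≠ ⊤ := P.lintegral_weight_ne_top l
  refine ⟨C * I.toReal, by positivity, fun v hv => ?_⟩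
  have hp := measurable_proj (d := d)
  have h1 : ∀ s : Torus d, ‖P.jump l v (rep s)‖ₑ ≤ ENNReal.ofReal C *
      ∫⁻ y, ENNReal.ofReal (P.weight l (rep s - y)) * ‖v (proj y)‖ₑ := by
    intro s
    have hw := P.measurable_weight l
    refine (enorm_integral_le_lintegral_enorm _).trans ?_
    rw [← lintegral_const_mul _ (by fun_prop)]
    refine lintegral_mono fun y => ?_
    rw [enorm_integrand]
    gcongr
    exact (hΛ _ _).2
  rw [eLpNorm_eq_lintegral_rpow_enorm_toReal (by norm_num) (by norm_num),
    eLpNorm_eq_lintegral_rpow_enorm_toReal (by norm_num) (by norm_num)]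
  simp only [ENNReal.toReal_ofNat]
  have h2 : ∫⁻ s, ‖P.jump l v (rep s)‖ₑ ^ (2 : ℝ) ≤
      (ENNReal.ofReal C * I) ^ (2 : ℝ) * ∫⁻ s, ‖v s‖ₑ ^ (2 : ℝ) := by
    calc _ ≤ ∫⁻ s, ENNReal.ofReal C ^ (2 : ℝ) *
          (∫⁻ y, ENNReal.ofReal (P.weight l (rep s - y)) * ‖v (proj y)‖ₑ) ^ (2 : ℝ) := by
          refine lintegral_mono fun s => ?_
          rw [← ENNReal.mul_rpow_of_nonneg _ _ zero_le_two]
          exact ENNReal.rpow_le_rpow (h1 s) zero_le_two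
      _ ≤ _ := by
          rw [lintegral_const_mul' _ _ (by simp), ENNReal.mul_rpow_of_nonneg _ _ zero_le_two,
            mul_assoc]
          gcongr
          exact P.lintegral_sq_le l hv.enorm
  calc _ ≤ ((ENNReal.ofReal C * I) ^ (2 : ℝ) * ∫⁻ s, ‖v s‖ₑ ^ (2 : ℝ)) ^ (1 / 2 : ℝ) :=
        ENNReal.rpow_le_rpow h2 (by norm_num)
    _ = _ := by
        rw [ENNReal.mul_rpow_of_nonneg _ _ (by norm_num), ← ENNReal.rpow_mul,
          ENNReal.ofReal_mul hC, ENNReal.ofReal_toReal hIt]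
        norm_num

theorem ae_integrable (l : Space d) {v : Torus d → ℂ} (hv : Measurable v)
    (hv2 : MemLp v 2 volume) : ∀ᵐ s : Torus d, Integrable fun y : Space d =>
      ((P.a (rep s - y) * P.Λ (rep s) y * Real.exp ⟪l, y - rep s⟫_ℝ : ℝ) : ℂ) * v (proj y) := by
  obtain ⟨c, hc, C, hΛ⟩ := P.bounds_Λ
  have hp := measurable_proj (d := d)
  have hr := measurable_rep (d := d)
  have hw := P.measurable_weight l
  have h1 : ∫⁻ s, ‖v s‖ₑ ≠ ⊤ := (hv2.integrable (by norm_num)).2.ne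
  have h2 := P.lintegral_weight_mul l hv.enorm
  have h3 : ∀ᵐ s : Torus d,
      ∫⁻ y, ENNReal.ofReal (P.weight l (rep s - y)) * ‖v (proj y)‖ₑ < ⊤ := by
    refine ae_lt_top (Measurable.lintegral_prod_right' (f := fun q : Torus d × Space d =>
      ENNReal.ofReal (P.weight l (rep q.1 - q.2)) * ‖v (proj q.2)‖ₑ) (by fun_prop)) ?_
    rw [h2]
    exact ENNReal.mul_ne_top (P.lintegral_weight_ne_top l) h1
  filter_upwards [h3] with s hs
  refine ⟨((P.measurable_integrand l hv).comp (measurable_prodMk_left (x := s))).aestronglyMeasurable,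
    ?_⟩
  rw [hasFiniteIntegral_iff_enorm]
  calc _ ≤ ∫⁻ y, ENNReal.ofReal C *
        (ENNReal.ofReal (P.weight l (rep s - y)) * ‖v (proj y)‖ₑ) := by
        refine lintegral_mono fun y => ?_
        rw [enorm_integrand]
        gcongr
        exact (hΛ _ _).2
    _ < ⊤ := by
        rw [lintegral_const_mul _ (by fun_prop)]
        exact ENNReal.mul_lt_top ENNReal.ofReal_lt_top hs

theorem measurable_G : Measurable P.G := by
  have ha := P.measurable_a
  have hΛ := P.measurable_Λ
  have h : Measurable fun q : Space d × Space d => P.a (q.1 - q.2) * P.Λ q.1 q.2 := by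
    have : Measurable fun q : Space d × Space d => P.Λ q.1 q.2 := hΛ
    fun_prop
  exact (h.stronglyMeasurable.integral_prod_right').measurable

theorem exists_G_bound : ∃ K : ℝ, ∀ x, ‖(P.G x : ℂ)‖ ≤ K := by
  obtain ⟨c, hc, C, hΛ⟩ := P.bounds_Λ
  have hC : 0 ≤ C := hc.le.trans ((hΛ 0 0).1.trans (hΛ 0 0).2)
  have hint : Integrable P.a := by
    by_contra h
    have := P.integral_a
    rw [integral_undef h] at this
    exact zero_ne_one this
  refine ⟨C, fun x => ?_⟩
  rw [Complex.norm_real]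
  have h1 : Integrable fun y => P.a (x - y) * C := (hint.comp_sub_left x).mul_const C
  refine (norm_integral_le_of_norm_le h1 (ae_of_all _ fun y => ?_)).trans ?_
  · rw [Real.norm_of_nonneg (mul_nonneg (P.nonneg_a _) (P.Λ_nonneg _ _))]
    exact mul_le_mul_of_nonneg_left (hΛ _ _).2 (P.nonneg_a _)
  · rw [integral_mul_const, integral_sub_left_eq_self P.a volume x, P.integral_a, one_mul]

theorem measurable_coe (v : L2 d) : Measurable (v : Torus d → ℂ) :=
  (Lp.stronglyMeasurable v).measurable

theorem eLpNorm_G_mul_le {K : ℝ} (hK : ∀ x, ‖(P.G x : ℂ)‖ ≤ K) (v : L2 d) :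
    eLpNorm (fun s => (P.G (rep s) : ℂ) * v (proj (rep s))) 2 volume ≤
      ENNReal.ofReal K * eLpNorm v 2 volume := by
  refine eLpNorm_le_mul_eLpNorm_of_ae_le_mul (ae_of_all _ fun s => ?_) 2
  rw [norm_mul, proj_rep]
  exact mul_le_mul_of_nonneg_right (hK _) (norm_nonneg _)

theorem measurable_skewedFun (l : Space d) (v : L2 d) :
    Measurable fun s => P.skewedFun l v (rep s) := by
  have h1 := P.measurable_jump l (measurable_coe v)
  have h2 := P.measurable_G
  have h3 := measurable_coe v
  have h4 : Measurable fun s : Torus d => (P.G (rep s) : ℂ) :=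
    Complex.measurable_ofReal.comp (h2.comp measurable_rep)
  exact h1.sub (h4.mul (by fun_prop))

theorem exists_skewedFun_bound (l : Space d) : ∃ K : ℝ, 0 ≤ K ∧ ∀ v : L2 d,
    eLpNorm (fun s => P.skewedFun l v (rep s)) 2 volume ≤
      ENNReal.ofReal K * eLpNorm v 2 volume := by
  obtain ⟨K₁, hK₁, h₁⟩ := P.exists_jump_bound l
  obtain ⟨K₂, h₂⟩ := P.exists_G_bound
  have hK₂ : 0 ≤ K₂ := (norm_nonneg _).trans (h₂ 0)
  refine ⟨K₁ + K₂, add_nonneg hK₁ hK₂, fun v => ?_⟩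
  have m₁ := P.measurable_jump l (measurable_coe v)
  have m₂ : Measurable fun s : Torus d => (P.G (rep s) : ℂ) * v (proj (rep s)) := by
    have h3 := measurable_coe v
    exact (Complex.measurable_ofReal.comp (P.measurable_G.comp measurable_rep)).mul (by fun_prop)
  refine (eLpNorm_sub_le m₁.aestronglyMeasurable m₂.aestronglyMeasurable (by norm_num)).trans ?_
  rw [ENNReal.ofReal_add hK₁ hK₂, add_mul]
  exact add_le_add (h₁ v (measurable_coe v)) (P.eLpNorm_G_mul_le h₂ v)

theorem memLp_skewedFun (l : Space d) (v : L2 d) :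
    MemLp (fun s => P.skewedFun l v (rep s)) 2 volume := by
  obtain ⟨K, -, h⟩ := P.exists_skewedFun_bound l
  refine ⟨(P.measurable_skewedFun l v).aestronglyMeasurable, (h v).trans_lt ?_⟩
  exact ENNReal.mul_lt_top ENNReal.ofReal_lt_top (Lp.eLpNorm_lt_top v)

theorem skewedFun_add (l : Space d) (v w : L2 d) :
    (fun s => P.skewedFun l (v + w : L2 d) (rep s)) =ᵐ[volume]
      fun s => P.skewedFun l v (rep s) + P.skewedFun l w (rep s) := by
  have hvw := Lp.coeFn_add v w
  filter_upwards [hvw, P.ae_integrable l (measurable_coe v) (Lp.memLp v),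
    P.ae_integrable l (measurable_coe w) (Lp.memLp w),
    P.ae_jump_congr l (measurable_coe _) ((measurable_coe v).add (measurable_coe w)) hvw]
    with s h1 h2 h3 h4
  simp only [skewedFun, jump]
  rw [integral_congr_ae h4, proj_rep, h1]
  simp only [Pi.add_apply, mul_add]
  rw [integral_add h2 h3]
  ring

theorem skewedFun_smul (l : Space d) (c : ℂ) (v : L2 d) :
    (fun s => P.skewedFun l (c • v : L2 d) (rep s)) =ᵐ[volume]
      fun s => c • P.skewedFun l v (rep s) := by
  have hv := Lp.coeFn_smul c v
  filter_upwards [hv,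
    P.ae_jump_congr l (measurable_coe _) ((measurable_coe v).const_smul c) hv] with s h1 h4
  simp only [skewedFun, jump]
  rw [integral_congr_ae h4, proj_rep, h1]
  simp only [Pi.smul_apply, smul_eq_mul, mul_left_comm _ c]
  rw [integral_const_mul]
  ring

/-- The skewed generator `A_l`, a bounded operator on `L²(𝕋^d)`. -/
def skewedGenerator (l : Space d) : L2 d →L[ℂ] L2 d :=
  LinearMap.mkContinuousOfExistsBound
    { toFun := fun v => (P.memLp_skewedFun l v).toLp
      map_add' := fun v w => by
        rw [← MemLp.toLp_add]
        exact MemLp.toLp_congr _ _ (P.skewedFun_add l v w)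
      map_smul' := fun c v => by
        rw [RingHom.id_apply, ← MemLp.toLp_const_smul]
        exact MemLp.toLp_congr _ _ (P.skewedFun_smul l c v) }
    (by
      obtain ⟨K, hK, h⟩ := P.exists_skewedFun_bound l
      refine ⟨K, fun v => ?_⟩
      change ‖(P.memLp_skewedFun l v).toLp‖ ≤ K * ‖v‖
      rw [Lp.norm_toLp, Lp.norm_def, ← ENNReal.toReal_ofReal hK, ← ENNReal.toReal_mul]
      exact ENNReal.toReal_mono
        (ENNReal.mul_ne_top ENNReal.ofReal_ne_top (Lp.eLpNorm_ne_top v)) (h v))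

/-- The skewed generator acts by the integral formula. -/
theorem skewedGenerator_apply (l : Space d) (v : L2 d) :
    P.skewedGenerator l v =ᵐ[volume] fun s => P.skewedFun l v (rep s) :=
  MemLp.coeFn_toLp (P.memLp_skewedFun l v)

/-- The set of the real parts of the points of the spectrum of `A_l`. -/
def spectrumRe (l : Space d) : Set ℝ := Complex.re '' spectrum ℂ (P.skewedGenerator l)

/-- The Hamiltonian `H(l) = s(A_l)`, the largest real part of a point of the spectrum. -/
def H (l : Space d) : ℝ := sSup (P.spectrumRe l)

/-- `t` is the principal eigenvalue of `A_l`: it is an eigenvalue with a positive eigenfunction,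
and every other point of the spectrum has a smaller real part. -/
def IsPrincipalEigenvalue (l : Space d) (t : ℝ) : Prop :=
  (∃ u : L2 d, (∀ᵐ s : Torus d, 0 < (u s).re ∧ (u s).im = 0) ∧
    P.skewedGenerator l u = (t : ℂ) • u) ∧
  ∀ z ∈ spectrum ℂ (P.skewedGenerator l), z ≠ (t : ℂ) → z.re < t

/-- `Γ`: the set of those `l` for which `A_l` has a principal eigenvalue above `-g_min`. -/
def Γ : Set (Space d) := {l | ∃ t : ℝ, P.IsPrincipalEigenvalue l t ∧ -P.gMin < t}

/-- `θ(l)`: the principal eigenvalue of `A_l` if there is one (there is at most one), else `0`. -/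
def θ (l : Space d) : ℝ := sSup {t : ℝ | P.IsPrincipalEigenvalue l t}

end Environment
end PeriodicJump

end

set_option linter.unusedSectionVars false

/-! On the torus `A_λ` is an integral operator minus multiplication by `G`; the kernel is the
lattice periodization of `a(z) e^{-λ·z}` times `Λ`. The decay of `a` beats every exponential, so
this kernel is bounded and the integral operator is Hilbert–Schmidt. Hence to the right of `-g_min`
the Fredholm alternative holds and spectral values are eigenvalues (`JumpData.isUnit_of_injective`).

Up to a real shift `A_λ` is a positive operator, so its resolvent is positive on every real
half-line `[m, ∞)` free of spectrum (`nonneg_of_nonneg_smul_sub`). Consequently a nonzero `v ≥ 0`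
with `A v ≥ m v` forces a real spectral value `≥ m`. Indicators of sets where `G` is near its
infimum give `H ≥ -g_min`, and the constant one gives the exponential growth. If `H > -g_min`, a
Perron–Frobenius argument applies: for an eigenvector `v` with `Re z = H`, `|v|` is a subsolution, a
subsolution at the spectral bound is an eigenfunction (`JumpData.op_eq_of_subsolution`), and
irreducibility makes it bounded below by a positive constant and forces `z` to be real. Thus `Γ = {H
> -g_min}` (`mem_Γ_iff`). Irreducibility does not need `a` to be positive near zero: a set that
cannot be entered is invariant under almost every possible jump, and by Steinhaus the differences of
such jumps fill a neighbourhood of zero.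

Convexity comes from one inequality at points `l` of `Γ` (`exists_subgradient`): `H (l + m) ≥ H l +
b m + c * excess l m`, with `b` linear, `c > 0`, and `excess` the integral of `e^x - 1 - x` at `x =
-m·z`. It is an entropy estimate. The right and left eigenfunctions at `l` define a stationary flow;
a supersolution for `l + m` is compared with the right eigenfunction through the logarithm `f` of
their quotient, and stationarity removes the linear term in `f`. The half-space condition makes
`excess` positive, and quadratically so near zero, which gives strict convexity and the positive
Hessian. Off `Γ`, `H` is at its global minimum, so convexity needs nothing more there.

For smoothness, `z - A_λ` is bordered by the rank one projection to the constants. At `z = H λ` with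
`λ ∈ Γ` the bordered operator is invertible because the eigenvalue is simple, and the mean of its
inverse applied to `1` equals one. This scalar equation is `C²` in `(λ, z)` with nonzero
`z`-derivative, and the implicit function theorem applies (`contDiffAt_H`). -/

noncomputable section

namespace PeriodicJump

/-! ### Kernel and multiplication operators on `L²` of a probability space -/

section KernelOperators

variable {X : Type*} [MeasurableSpace X] (μ : Measure X) [IsProbabilityMeasure μ]

/-- A measurable real kernel bounded by `M`. -/
structure IsBddKernel (k : X → X → ℝ) (M : ℝ) : Prop where
  measurable : Measurable (Function.uncurry k)
  bound : ∀ x y, |k x y| ≤ M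

variable {μ}

theorem IsBddKernel.measurable_right {k : X → X → ℝ} {M : ℝ} (hk : IsBddKernel k M) (x : X) :
    Measurable (k x) :=
  hk.measurable.comp measurable_prodMk_left

theorem IsBddKernel.transpose {k : X → X → ℝ} {M : ℝ} (hk : IsBddKernel k M) :
    IsBddKernel (fun x y => k y x) M :=
  ⟨hk.measurable.comp measurable_swap, fun x y => hk.bound y x⟩

theorem integrable_of_L2 (v : Lp ℂ 2 μ) : Integrable v μ :=
  (Lp.memLp v).integrable (by norm_num)

theorem integral_norm_le_norm (v : Lp ℂ 2 μ) : ∫ x, ‖v x‖ ∂μ ≤ ‖v‖ := by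
  rw [Lp.norm_def, integral_norm_eq_lintegral_enorm (Lp.aestronglyMeasurable v),
    ← eLpNorm_one_eq_lintegral_enorm]
  refine ENNReal.toReal_mono (Lp.eLpNorm_ne_top v) ?_
  exact eLpNorm_le_eLpNorm_of_exponent_le (by norm_num) (Lp.aestronglyMeasurable v)

theorem IsBddKernel.integrable_mul {k : X → X → ℝ} {M : ℝ} (hk : IsBddKernel k M) (x : X)
    {v : X → ℂ} (hv : Integrable v μ) : Integrable (fun y => (k x y : ℂ) * v y) μ := by
  refine hv.bdd_mul (c := M) ?_ (ae_of_all _ fun y => ?_)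
  · exact (Complex.measurable_ofReal.comp (hk.measurable_right x)).aestronglyMeasurable
  · simpa using hk.bound x y

theorem IsBddKernel.norm_integral_le {k : X → X → ℝ} {M : ℝ} (hk : IsBddKernel k M) (x : X)
    {v : X → ℂ} (hv : Integrable v μ) :
    ‖∫ y, (k x y : ℂ) * v y ∂μ‖ ≤ M * ∫ y, ‖v y‖ ∂μ := by
  rw [← integral_const_mul]
  refine norm_integral_le_of_norm_le (hv.norm.const_mul M) (ae_of_all _ fun y => ?_)
  rw [norm_mul, Complex.norm_real]
  exact mul_le_mul_of_nonneg_right (hk.bound x y) (norm_nonneg _)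

theorem IsBddKernel.measurable_integral {k : X → X → ℝ} {M : ℝ} (hk : IsBddKernel k M)
    (v : Lp ℂ 2 μ) : Measurable fun x => ∫ y, (k x y : ℂ) * v y ∂μ := by
  have h2 : Measurable (fun q : X × X => (k q.1 q.2 : ℂ) * v q.2) :=
    (Complex.measurable_ofReal.comp hk.measurable).mul
      ((Lp.stronglyMeasurable v).measurable.comp measurable_snd)
  exact (h2.stronglyMeasurable.integral_prod_right').measurable

theorem IsBddKernel.memLp {k : X → X → ℝ} {M : ℝ} (hk : IsBddKernel k M) (v : Lp ℂ 2 μ) :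
    MemLp (fun x => ∫ y, (k x y : ℂ) * v y ∂μ) 2 μ :=
  MemLp.of_bound (hk.measurable_integral v).aestronglyMeasurable _
    (ae_of_all _ fun x => hk.norm_integral_le x (integrable_of_L2 v))

theorem IsBddKernel.nonneg {k : X → X → ℝ} {M : ℝ} (hk : IsBddKernel k M) [Nonempty X] :
    0 ≤ M :=
  (abs_nonneg _).trans (hk.bound (Classical.arbitrary X) (Classical.arbitrary X))

variable (μ) in
open Classical in
/-- The integral operator on `L²` with a bounded kernel. -/
def kerOp (k : X → X → ℝ) : Lp ℂ 2 μ →L[ℂ] Lp ℂ 2 μ :=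
  if h : ∃ M, IsBddKernel k M then
    LinearMap.mkContinuous
      { toFun := fun v => (h.choose_spec.memLp v).toLp
        map_add' := fun v w => by
          rw [← MemLp.toLp_add]
          refine MemLp.toLp_congr _ _ (ae_of_all _ fun x => ?_)
          simp only [Pi.add_apply]
          rw [← integral_add (h.choose_spec.integrable_mul x (integrable_of_L2 v))
            (h.choose_spec.integrable_mul x (integrable_of_L2 w))]
          refine integral_congr_ae ?_
          filter_upwards [Lp.coeFn_add v w] with y hy
          rw [hy, Pi.add_apply, mul_add]
        map_smul' := fun c v => by
          rw [RingHom.id_apply, ← MemLp.toLp_const_smul]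
          refine MemLp.toLp_congr _ _ (ae_of_all _ fun x => ?_)
          simp only [Pi.smul_apply, smul_eq_mul]
          rw [← integral_const_mul]
          refine integral_congr_ae ?_
          filter_upwards [Lp.coeFn_smul c v] with y hy
          rw [hy, Pi.smul_apply, smul_eq_mul]
          ring } h.choose
      (fun v => by
        change ‖(h.choose_spec.memLp v).toLp‖ ≤ _
        have : Nonempty X := nonempty_of_isProbabilityMeasure μ
        have hM := h.choose_spec.nonneg
        have h1 : ∀ᵐ x ∂μ, ‖(h.choose_spec.memLp v).toLp _ x‖ ≤ h.choose * ‖v‖ := by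
          filter_upwards [(h.choose_spec.memLp v).coeFn_toLp] with x hx
          rw [hx]
          exact (h.choose_spec.norm_integral_le x (integrable_of_L2 v)).trans
            (mul_le_mul_of_nonneg_left (integral_norm_le_norm v) hM)
        simpa [measureUnivNNReal] using Lp.norm_le_of_ae_bound (by positivity) h1)
  else 0

theorem kerOp_apply {k : X → X → ℝ} {M : ℝ} (hk : IsBddKernel k M) (v : Lp ℂ 2 μ) :
    kerOp μ k v =ᵐ[μ] fun x => ∫ y, (k x y : ℂ) * v y ∂μ := by
  have h : ∃ M, IsBddKernel k M := ⟨M, hk⟩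
  rw [kerOp, dif_pos h]
  exact (h.choose_spec.memLp v).coeFn_toLp

theorem norm_kerOp_le {k : X → X → ℝ} {M : ℝ} (hk : IsBddKernel k M) : ‖kerOp μ k‖ ≤ M := by
  have : Nonempty X := nonempty_of_isProbabilityMeasure μ
  refine ContinuousLinearMap.opNorm_le_bound _ hk.nonneg fun v => ?_
  have h1 : ∀ᵐ x ∂μ, ‖kerOp μ k v x‖ ≤ M * ‖v‖ := by
    filter_upwards [kerOp_apply hk v] with x hx
    rw [hx]
    exact (hk.norm_integral_le x (integrable_of_L2 v)).trans
      (mul_le_mul_of_nonneg_left (integral_norm_le_norm v) hk.nonneg)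
  have := hk.nonneg
  simpa [measureUnivNNReal] using Lp.norm_le_of_ae_bound (by positivity) h1

theorem kerOp_add {k k' : X → X → ℝ} {M M' : ℝ} (hk : IsBddKernel k M)
    (hk' : IsBddKernel k' M') :
    kerOp μ (fun x y => k x y + k' x y) = kerOp μ k + kerOp μ k' := by
  have h : IsBddKernel (fun x y => k x y + k' x y) (M + M') :=
    ⟨hk.measurable.add hk'.measurable,
      fun x y => (abs_add_le _ _).trans (add_le_add (hk.bound x y) (hk'.bound x y))⟩
  ext v
  rw [add_apply]
  filter_upwards [kerOp_apply h v, kerOp_apply hk v, kerOp_apply hk' v,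
    Lp.coeFn_add (kerOp μ k v) (kerOp μ k' v)] with x h1 h2 h3 h4
  rw [h4, Pi.add_apply, h1, h2, h3, ← integral_add (hk.integrable_mul x (integrable_of_L2 v))
    (hk'.integrable_mul x (integrable_of_L2 v))]
  refine integral_congr_ae (ae_of_all _ fun y => ?_)
  push_cast
  ring

theorem IsBddKernel.const_mul {k : X → X → ℝ} {M : ℝ} (hk : IsBddKernel k M) (c : ℝ) :
    IsBddKernel (fun x y => c * k x y) (|c| * M) :=
  ⟨hk.measurable.const_mul c, fun x y => by
    rw [abs_mul]; exact mul_le_mul_of_nonneg_left (hk.bound x y) (abs_nonneg c)⟩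

theorem kerOp_const_mul {k : X → X → ℝ} {M : ℝ} (hk : IsBddKernel k M) (c : ℝ) :
    kerOp μ (fun x y => c * k x y) = c • kerOp μ k := by
  ext v
  rw [smul_apply]
  filter_upwards [kerOp_apply (hk.const_mul c) v, kerOp_apply hk v,
    Lp.coeFn_smul c (kerOp μ k v)] with x h1 h2 h4
  rw [h4, Pi.smul_apply, h1, h2, Complex.real_smul, ← integral_const_mul]
  refine integral_congr_ae (ae_of_all _ fun y => ?_)
  push_cast
  ring

/-! ### Multiplication operators -/

theorem memLp_mul_bdd {g : X → ℂ} {C : ℝ} (hg : Measurable g) (hC : ∀ x, ‖g x‖ ≤ C)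
    (v : Lp ℂ 2 μ) : MemLp (fun x => g x * v x) 2 μ :=
  MemLp.of_le_mul (c := C) (Lp.memLp v)
    (hg.aestronglyMeasurable.mul (Lp.aestronglyMeasurable v))
    (ae_of_all _ fun x => by
      rw [norm_mul]; exact mul_le_mul_of_nonneg_right (hC x) (norm_nonneg _))

variable (μ) in
open Classical in
/-- The multiplication operator on `L²` by a bounded function. -/
def mulOp (g : X → ℂ) : Lp ℂ 2 μ →L[ℂ] Lp ℂ 2 μ :=
  if h : Measurable g ∧ ∃ C, ∀ x, ‖g x‖ ≤ C then
    LinearMap.mkContinuous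
      { toFun := fun v => (memLp_mul_bdd h.1 h.2.choose_spec v).toLp
        map_add' := fun v w => by
          rw [← MemLp.toLp_add]
          refine MemLp.toLp_congr _ _ ?_
          filter_upwards [Lp.coeFn_add v w] with y hy
          rw [hy, Pi.add_apply, mul_add, Pi.add_apply]
        map_smul' := fun c v => by
          rw [RingHom.id_apply, ← MemLp.toLp_const_smul]
          refine MemLp.toLp_congr _ _ ?_
          filter_upwards [Lp.coeFn_smul c v] with y hy
          rw [hy, Pi.smul_apply, Pi.smul_apply, smul_eq_mul, smul_eq_mul]
          ring } h.2.choose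
      (fun v => by
        refine Lp.norm_le_mul_norm_of_ae_le_mul ?_
        filter_upwards [(memLp_mul_bdd h.1 h.2.choose_spec v).coeFn_toLp] with x hx
        change ‖(memLp_mul_bdd h.1 h.2.choose_spec v).toLp _ x‖ ≤ _
        rw [hx, norm_mul]
        exact mul_le_mul_of_nonneg_right (h.2.choose_spec x) (norm_nonneg _))
  else 0

theorem mulOp_apply {g : X → ℂ} {C : ℝ} (hg : Measurable g) (hC : ∀ x, ‖g x‖ ≤ C)
    (v : Lp ℂ 2 μ) : mulOp μ g v =ᵐ[μ] fun x => g x * v x := by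
  have h : Measurable g ∧ ∃ C, ∀ x, ‖g x‖ ≤ C := ⟨hg, C, hC⟩
  rw [mulOp, dif_pos h]
  exact (memLp_mul_bdd h.1 h.2.choose_spec v).coeFn_toLp

theorem isUnit_mulOp {g : X → ℂ} {C δ : ℝ} (hg : Measurable g) (hC : ∀ x, ‖g x‖ ≤ C)
    (hδ : 0 < δ) (hgδ : ∀ x, δ ≤ ‖g x‖) : IsUnit (mulOp μ g) := by
  have h1 : Measurable fun x => (g x)⁻¹ := hg.inv
  have h2 : ∀ x, ‖(g x)⁻¹‖ ≤ δ⁻¹ := fun x => by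
    rw [norm_inv]; exact inv_anti₀ hδ (hgδ x)
  have h3 : ∀ x, g x ≠ 0 := fun x => norm_pos_iff.1 (hδ.trans_le (hgδ x))
  refine ⟨⟨mulOp μ g, mulOp μ fun x => (g x)⁻¹, ?_, ?_⟩, rfl⟩
  · ext v
    rw [mul_apply_eq_comp, one_apply_eq_self]
    filter_upwards [mulOp_apply hg hC (mulOp μ (fun x => (g x)⁻¹) v), mulOp_apply h1 h2 v]
      with x hx hx'
    rw [hx, hx', mul_inv_cancel_left₀ (h3 x)]
  · ext v
    rw [mul_apply_eq_comp, one_apply_eq_self]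
    filter_upwards [mulOp_apply h1 h2 (mulOp μ g v), mulOp_apply hg hC v]
      with x hx hx'
    rw [hx, hx', inv_mul_cancel_left₀ (h3 x)]

/-! ### Compactness and the Fredholm alternative -/

-- The Hilbert–Schmidt criterion. Outside a finite set `F` of basis vectors the sum of `‖K (b i)‖ ^
-- 2` is small, so by Cauchy–Schwarz and Bessel truncating the expansion of `v` to `F` changes `K v`
-- by at most `ε / 2 * ‖v‖`. Thus `K` is a norm limit of finite rank operators.
open Classical in
theorem isCompactOperator_of_sum_sq_le {ι E : Type*} [NormedAddCommGroup E]
    [InnerProductSpace ℂ E] [CompleteSpace E] (b : HilbertBasis ι ℂ E) (K : E →L[ℂ] E) {B : ℝ}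
    (hB : ∀ F : Finset ι, ∑ i ∈ F, ‖K (b i)‖ ^ 2 ≤ B) : IsCompactOperator K := by
  have hs : Summable fun i => ‖K (b i)‖ ^ 2 :=
    summable_of_sum_le (fun i => by positivity) hB
  have hclosed : IsClosed {T : E →L[ℂ] E | IsCompactOperator T} :=
    isClosed_setOfPred_isCompactOperator
  refine hclosed.closure_subset (Metric.mem_closure_iff.2 fun ε hε => ?_)
  obtain ⟨F, hF⟩ := (summable_iff_vanishing_norm.1 hs) ((ε / 2) ^ 2) (by positivity)
  set KF : E →L[ℂ] E := ∑ i ∈ F, (innerSL ℂ (b i)).smulRight (K (b i)) with hKF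
  refine ⟨KF, ?_, ?_⟩
  · have h0 : ∀ i, (innerSL ℂ (b i)).smulRight (K (b i)) ∈ compactOperator (RingHom.id ℂ) E E := by
      intro i
      have h1 : IsCompactOperator (ContinuousLinearMap.toSpanSingleton ℂ (K (b i))) :=
        isCompactOperator_id.clm_comp
          (ContinuousLinearMap.toSpanSingleton ℂ (K (b i)))
      exact h1.comp_clm (innerSL ℂ (b i))
    exact Submodule.sum_mem _ fun i _ => h0 i
  · rw [dist_eq_norm]
    refine lt_of_le_of_lt (ContinuousLinearMap.opNorm_le_bound _ (by positivity : 0 ≤ ε / 2)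
      fun v => ?_) (by linarith)
    have h1 : HasSum (fun i => ⟪b i, v⟫_ℂ • K (b i)) (K v) := by
      have := (b.hasSum_repr v).mapL K
      simpa [b.repr_apply_apply] using this
    have h2 : HasSum (fun i => if i ∈ F then 0 else ⟪b i, v⟫_ℂ • K (b i)) ((K - KF) v) := by
      have h3 : HasSum (fun i => if i ∈ F then ⟪b i, v⟫_ℂ • K (b i) else 0) (KF v) := by
        have := hasSum_sum_of_ne_finset_zero (L := SummationFilter.unconditional ι) (s := F)
          (f := fun i => if i ∈ F then ⟪b i, v⟫_ℂ • K (b i) else 0) (fun i hi => if_neg hi)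
        convert this using 1
        rw [hKF, sum_apply]
        exact Finset.sum_congr rfl fun i hi => by simp [hi]
      convert h1.sub h3 using 2 with i
      · split_ifs <;> simp
      · rfl
    refine le_of_tendsto h2.norm (Eventually.of_forall fun G => ?_)
    set G' := G.filter (· ∉ F)
    have hG' : Disjoint G' F :=
      Finset.disjoint_left.2 fun i hi => (Finset.mem_filter.1 hi).2
    have e1 : ∑ i ∈ G, (if i ∈ F then 0 else ⟪b i, v⟫_ℂ • K (b i)) =
        ∑ i ∈ G', ⟪b i, v⟫_ℂ • K (b i) := by
      rw [Finset.sum_filter]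
      exact Finset.sum_congr rfl fun i _ => by by_cases h : i ∈ F <;> simp [h]
    rw [e1]
    refine (norm_sum_le _ _).trans (abs_le_of_sq_le_sq' ?_ (by positivity)).2
    simp only [norm_smul]
    refine (Finset.sum_mul_sq_le_sq_mul_sq _ _ _).trans ?_
    have h4 := b.orthonormal.sum_inner_products_le v (s := G')
    have h5 := (le_abs_self _).trans (hF G' hG').le
    rw [mul_pow, mul_comm]
    exact mul_le_mul h5 h4 (by positivity) (by positivity)

theorem memLp_kernel {k : X → X → ℝ} {M : ℝ} (hk : IsBddKernel k M) (x : X) :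
    MemLp (fun y => (k x y : ℂ)) 2 μ :=
  MemLp.of_bound (Complex.measurable_ofReal.comp (hk.measurable_right x)).aestronglyMeasurable M
    (ae_of_all _ fun y => by simpa using hk.bound x y)

theorem integral_kernel_eq_inner {k : X → X → ℝ} {M : ℝ} (hk : IsBddKernel k M) (x : X)
    (v : Lp ℂ 2 μ) : ∫ y, (k x y : ℂ) * v y ∂μ = ⟪(memLp_kernel (μ := μ) hk x).toLp, v⟫_ℂ := by
  rw [L2.inner_def]
  refine integral_congr_ae ?_
  filter_upwards [(memLp_kernel (μ := μ) hk x).coeFn_toLp] with y hy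
  rw [hy, RCLike.inner_apply, Complex.conj_ofReal, mul_comm]

theorem norm_sq_eq_integral (v : Lp ℂ 2 μ) : ‖v‖ ^ 2 = ∫ x, ‖v x‖ ^ 2 ∂μ := by
  have h := L2.inner_def (𝕜 := ℂ) v v
  rw [inner_self_eq_norm_sq_to_K] at h
  have h2 : ∀ x, ⟪v x, v x⟫_ℂ = ((‖v x‖ ^ 2 : ℝ) : ℂ) := fun x => by
    rw [inner_self_eq_norm_sq_to_K]; simp
  simp_rw [h2] at h
  rw [integral_complex_ofReal] at h
  exact Complex.ofReal_injective (by simpa using h)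

/-- At almost every point `x` the numbers `(K b_i)(x)` are inner products with the row `k x`. Bessel
bounds the sum of their squares by the squared norm of the row, at most `M ^ 2`, and integration
gives the Hilbert–Schmidt bound. -/
theorem isCompactOperator_kerOp {k : X → X → ℝ} {M : ℝ} (hk : IsBddKernel k M) :
    IsCompactOperator (kerOp μ k) := by
  have : Nonempty X := nonempty_of_isProbabilityMeasure μ
  obtain ⟨w, b, -⟩ := exists_hilbertBasis ℂ (Lp ℂ 2 μ)
  refine isCompactOperator_of_sum_sq_le b _ (B := M ^ 2) fun F => ?_
  have hint : ∀ v : Lp ℂ 2 μ, Integrable (fun x => ‖v x‖ ^ 2) μ := fun v =>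
    (Lp.memLp v).integrable_norm_pow (by norm_num)
  simp_rw [norm_sq_eq_integral]
  rw [← integral_finsetSum _ fun i _ => hint _]
  have hle : ∀ᵐ x ∂μ, ∑ i ∈ F, ‖kerOp μ k (b i) x‖ ^ 2 ≤ M ^ 2 := by
    have h1 : ∀ᵐ x ∂μ, ∀ i ∈ F, kerOp μ k (b i) x = ∫ y, (k x y : ℂ) * b i y ∂μ :=
      (ae_ball_iff F.countable_toSet).2 fun i _ => kerOp_apply hk (b i)
    filter_upwards [h1] with x hx
    have h2 := b.orthonormal.sum_inner_products_le (memLp_kernel (μ := μ) hk x).toLp (s := F)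
    have h3 : ‖(memLp_kernel (μ := μ) hk x).toLp‖ ≤ M := by
      have h4 : ∀ᵐ y ∂μ, ‖(memLp_kernel (μ := μ) hk x).toLp _ y‖ ≤ M := by
        filter_upwards [(memLp_kernel (μ := μ) hk x).coeFn_toLp] with y hy
        rw [hy]
        simpa using hk.bound x y
      simpa [measureUnivNNReal] using Lp.norm_le_of_ae_bound hk.nonneg h4
    calc _ = ∑ i ∈ F, ‖⟪b i, (memLp_kernel (μ := μ) hk x).toLp⟫_ℂ‖ ^ 2 := by
          refine Finset.sum_congr rfl fun i hi => ?_
          rw [hx i hi, integral_kernel_eq_inner hk, norm_inner_symm]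
      _ ≤ _ := h2
      _ ≤ M ^ 2 := by gcongr
  calc _ ≤ ∫ _, M ^ 2 ∂μ :=
        integral_mono_ae (integrable_finsetSum _ fun i _ => hint _) (integrable_const _) hle
    _ = M ^ 2 := by simp

/-- The Fredholm alternative for a multiplication operator minus a kernel operator. -/
theorem isUnit_mulOp_sub_kerOp {k : X → X → ℝ} {M : ℝ} (hk : IsBddKernel k M) {g : X → ℂ}
    {C δ : ℝ} (hg : Measurable g) (hC : ∀ x, ‖g x‖ ≤ C) (hδ : 0 < δ) (hgδ : ∀ x, δ ≤ ‖g x‖)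
    (hinj : ∀ v : Lp ℂ 2 μ, mulOp μ g v = kerOp μ k v → v = 0) :
    IsUnit (mulOp μ g - kerOp μ k) := by
  obtain ⟨U, hU⟩ := isUnit_mulOp (μ := μ) hg hC hδ hgδ
  have hc : IsCompactOperator ((↑U⁻¹ : Lp ℂ 2 μ →L[ℂ] Lp ℂ 2 μ) * kerOp μ k) :=
    (isCompactOperator_kerOp hk).clm_comp (↑U⁻¹ : Lp ℂ 2 μ →L[ℂ] Lp ℂ 2 μ)
  -- With the invertible factor `g` taken out, what remains is the identity minus the compact
  -- operator `g⁻¹ K`, to which the alternative for compact operators applies at the value one.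
  have hfac : mulOp μ g - kerOp μ k =
      ↑U * (algebraMap ℂ _ (1 : ℂ) - (↑U⁻¹ : Lp ℂ 2 μ →L[ℂ] Lp ℂ 2 μ) * kerOp μ k) := by
    rw [map_one, mul_sub, mul_one, ← mul_assoc, Units.mul_inv, one_mul, hU]
  rcases hc.hasEigenvalue_or_mem_resolventSet one_ne_zero with h | h
  · exfalso
    obtain ⟨v, hv⟩ := h.exists_hasEigenvector
    refine hv.2 (hinj v ?_)
    have h1 : (↑U⁻¹ : Lp ℂ 2 μ →L[ℂ] Lp ℂ 2 μ) (kerOp μ k v) = v := by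
      simpa using hv.apply_eq_smul
    rw [← hU]
    conv_lhs => rw [← h1]
    rw [← mul_apply_eq_comp, Units.mul_inv, one_apply_eq_self]
  · rw [hfac]
    exact U.isUnit.mul h

end KernelOperators
end PeriodicJump
end

noncomputable section

namespace PeriodicJump

/-! ### Positivity of resolvents -/

section ResolventPositivity

variable {E : Type*} [NormedAddCommGroup E] [NormedSpace ℂ E] [CompleteSpace E] [PartialOrder E]
  [IsOrderedAddMonoid E] [OrderClosedTopology E]

/-- Neumann series: `v` is the sum of `B ^ n (v - B v)`, whose terms are nonnegative, and the
positive cone is closed. -/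
theorem nonneg_of_nonneg_sub_map {B : E →L[ℂ] E} (hB : ∀ v, 0 ≤ v → 0 ≤ B v) (hB1 : ‖B‖ < 1)
    {v : E} (hv : 0 ≤ v - B v) : 0 ≤ v := by
  have hpow : ∀ n : ℕ, 0 ≤ (B ^ n) (v - B v) := by
    intro n
    induction n with
    | zero => simpa using hv
    | succ n ih => rw [pow_succ', mul_apply_eq_comp]; exact hB _ ih
  have hsum : ∀ n : ℕ, ∑ i ∈ Finset.range n, (B ^ i) (v - B v) = v - (B ^ n) v := by
    intro n
    induction n with
    | zero => simp
    | succ n ih =>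
      rw [Finset.sum_range_succ, ih, map_sub, ← mul_apply_eq_comp, ← pow_succ]
      abel
  have h0 : Tendsto (fun n : ℕ => (B ^ n) v) atTop (𝓝 0) := by
    have h1 := (tendsto_pow_atTop_nhds_zero_of_norm_lt_one hB1)
    have h2 := ((ContinuousLinearMap.apply ℂ E v).continuous.tendsto 0).comp h1
    rwa [map_zero] at h2
  have h2 : Tendsto (fun n : ℕ => v - (B ^ n) v) atTop (𝓝 v) := by
    simpa using tendsto_const_nhds.sub h0
  exact ge_of_tendsto' h2 fun n => hsum n ▸ Finset.sum_nonneg fun i _ => hpow i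

/-- The resolvent of a positive operator is positive on a half-line in the resolvent set. -/
theorem nonneg_of_nonneg_smul_sub (hsmul : ∀ r : ℝ, 0 ≤ r → ∀ v : E, 0 ≤ v → 0 ≤ (r : ℂ) • v)
    {T : E →L[ℂ] E} (hT : ∀ v, 0 ≤ v → 0 ≤ T v) {m : ℝ}
    (hm : ∀ t : ℝ, m ≤ t → (t : ℂ) ∉ spectrum ℂ T) {v : E} (hv : 0 ≤ (m : ℂ) • v - T v) :
    0 ≤ v := by
  -- `S` is the set of `t` at which the resolvent is positive. It contains a point beyond `‖T‖`, it
  -- is closed along the resolvent set because the resolvent is continuous there, and it can be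
  -- continued to the left; so it contains all of `[m, L]`.
  set S : Set ℝ := {t | ∀ v : E, 0 ≤ (t : ℂ) • v - T v → 0 ≤ v}
  set L : ℝ := max m (‖T‖ + 1)
  have hres : ∀ t : ℝ, m ≤ t → (t : ℂ) ∈ resolventSet ℂ T := fun t ht => by
    simpa [spectrum] using hm t ht
  have hinv1 : ∀ t : ℝ, m ≤ t → ∀ w : E, resolvent T (t : ℂ) ((t : ℂ) • w - T w) = w := by
    intro t ht w
    have h : (algebraMap ℂ (E →L[ℂ] E) t - T) w = (t : ℂ) • w - T w := by
      simp [Algebra.algebraMap_eq_smul_one]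
    rw [← h, ← mul_apply_eq_comp, resolvent, Ring.inverse_mul_cancel _ (hres t ht),
      one_apply_eq_self]
  have hinv2 : ∀ t : ℝ, m ≤ t → ∀ w : E,
      (t : ℂ) • resolvent T (t : ℂ) w - T (resolvent T (t : ℂ) w) = w := by
    intro t ht w
    have h : ∀ u, (algebraMap ℂ (E →L[ℂ] E) t - T) u = (t : ℂ) • u - T u := by
      intro u; simp [Algebra.algebraMap_eq_smul_one]
    rw [← h, ← mul_apply_eq_comp, resolvent, Ring.mul_inverse_cancel _ (hres t ht),
      one_apply_eq_self]
  have hL : L ∈ S := by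
    intro v hv
    have hLT : ‖T‖ < L := (lt_add_one _).trans_le (le_max_right _ _)
    have hL0 : 0 < L := (norm_nonneg T).trans_lt hLT
    have hi : ((L⁻¹ : ℝ) : ℂ) * (L : ℂ) = 1 := by
      rw [← Complex.ofReal_mul, inv_mul_cancel₀ hL0.ne', Complex.ofReal_one]
    refine nonneg_of_nonneg_sub_map (B := ((L⁻¹ : ℝ) : ℂ) • T)
      (fun w hw => hsmul _ (by positivity) _ (hT w hw)) ?_ ?_
    · rw [norm_smul, Complex.norm_real, Real.norm_of_nonneg (by positivity), inv_mul_lt_one₀ hL0]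
      exact hLT
    · have := hsmul L⁻¹ (by positivity) _ hv
      rwa [smul_sub, smul_smul, hi, one_smul] at this
  have hclosed : IsClosed (S ∩ Icc m L) := by
    refine IsSeqClosed.isClosed fun t t₀ ht hlim => ?_
    have ht₀ : t₀ ∈ Icc m L := isClosed_Icc.isSeqClosed (fun n => (ht n).2) hlim
    refine ⟨fun v hv => ?_, ht₀⟩
    have hc : ContinuousAt (resolvent T) (t₀ : ℂ) :=
      (spectrum.hasDerivAt_resolvent_const_left (hres t₀ ht₀.1)).continuousAt
    have h1 : Tendsto (fun n => resolvent T (t n : ℂ) ((t₀ : ℂ) • v - T v)) atTop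
        (𝓝 (resolvent T (t₀ : ℂ) ((t₀ : ℂ) • v - T v))) := by
      have h2 : Tendsto (fun n => resolvent T (t n : ℂ)) atTop (𝓝 (resolvent T (t₀ : ℂ))) :=
        hc.tendsto.comp ((Complex.continuous_ofReal.tendsto t₀).comp hlim)
      exact ((ContinuousLinearMap.apply ℂ E ((t₀ : ℂ) • v - T v)).continuous.tendsto _).comp h2
    rw [hinv1 t₀ ht₀.1] at h1
    refine ge_of_tendsto' h1 fun n => (ht n).1 _ ?_
    rw [hinv2 _ (ht n).2.1]
    exact hv
  have hsub : Icc m L ⊆ S := by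
    refine hclosed.Icc_subset_of_forall_exists_lt hL fun t ht y hy => ?_
    -- Moving left by `ε`: `(t - ε) - T = (t - T)(1 - εR)`. Positivity at `t` handles the first
    -- factor, and the Neumann series handles the second as soon as `ε * ‖R‖ < 1`.
    set R := resolvent T (t : ℂ)
    have hRpos : ∀ w, 0 ≤ w → 0 ≤ R w := fun w hw => ht.1 _ (by rwa [hinv2 t ht.2.1.le])
    obtain ⟨ε, hε0, hε1, hε2⟩ : ∃ ε > 0, ε ≤ t - y ∧ ε * ‖R‖ < 1 := by
      refine ⟨min (t - y) (‖R‖ + 1)⁻¹, lt_min (sub_pos.2 hy) (by positivity), min_le_left _ _, ?_⟩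
      calc _ ≤ (‖R‖ + 1)⁻¹ * ‖R‖ := by gcongr; exact min_le_right _ _
        _ < 1 := by rw [inv_mul_lt_one₀ (by positivity)]; linarith
    refine ⟨t - ε, fun v hv => ?_, by simp only [mem_Ico]; constructor <;> linarith⟩
    refine nonneg_of_nonneg_sub_map (B := (ε : ℂ) • R)
      (fun w hw => hsmul _ hε0.le _ (hRpos w hw)) ?_ ?_
    · rwa [norm_smul, Complex.norm_real, Real.norm_of_nonneg hε0.le]
    · refine ht.1 _ ?_
      have h := hinv2 t ht.2.1.le v
      have e : (t : ℂ) • (v - ((ε : ℂ) • R) v) - T (v - ((ε : ℂ) • R) v) =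
          ((t - ε : ℝ) : ℂ) • v - T v := by
        calc _ = (t : ℂ) • v - T v - (ε : ℂ) • ((t : ℂ) • R v - T (R v)) := by
              rw [smul_apply, map_sub, map_smul]; module
          _ = _ := by rw [h]; push_cast; module
      rw [e]; exact hv
  exact hsub ⟨le_rfl, le_max_left _ _⟩ v hv

end ResolventPositivity
end PeriodicJump
end

noncomputable section

namespace PeriodicJump

/-! ### Abstract jump generators: the spectral bound and eigenvectors -/

open scoped ComplexOrder

/-- A jump generator `v ↦ ∫ k(x,y) v(y) dy - g(x) v(x)` on a probability space, with a bounded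
irreducible kernel. -/
structure JumpData {X : Type*} [MeasurableSpace X] (μ : Measure X) where
  /-- the kernel -/
  k : X → X → ℝ
  /-- the killing rate -/
  g : X → ℝ
  /-- the upper bound of the kernel -/
  M : ℝ
  /-- the lower bound of the masses of rows and columns -/
  m : ℝ
  /-- the essential infimum of the killing rate -/
  g₀ : ℝ
  /-- the upper bound of the killing rate -/
  Cg : ℝ
  bdd : IsBddKernel k M
  nonneg : ∀ x y, 0 ≤ k x y
  m_pos : 0 < m
  row : ∀ x, m ≤ ∫ y, k x y ∂μ
  col : ∀ y, m ≤ ∫ x, k x y ∂μ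
  -- No set of intermediate measure is unreachable from its complement.
  irred : ∀ E, MeasurableSet E → ∫⁻ x in Eᶜ, ∫⁻ y in E, ENNReal.ofReal (k x y) ∂μ ∂μ = 0 →
    μ E = 0 ∨ μ Eᶜ = 0
  measurable_g : Measurable g
  g_le : ∀ x, |g x| ≤ Cg
  -- Required at every point, so that `z + g` stays away from zero everywhere once `z.re > -g₀`.
  g₀_le : ∀ x, g₀ ≤ g x
  g₀_inf : ∀ ε > 0, μ {x | g x < g₀ + ε} ≠ 0

section LpFacts

variable {X : Type*} [MeasurableSpace X] {μ : Measure X} [IsProbabilityMeasure μ]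

theorem Lp_nonneg_iff (v : Lp ℂ 2 μ) :
    0 ≤ v ↔ ∀ᵐ x ∂μ, 0 ≤ (v x).re ∧ v x = ((v x).re : ℂ) := by
  rw [← Lp.coeFn_nonneg]
  refine eventually_congr (ae_of_all _ fun x => ?_)
  rw [Pi.zero_apply, Complex.nonneg_iff]
  refine and_congr_right fun _ => ⟨fun h => Complex.ext (by simp) (by simp [← h]), fun h => ?_⟩
  rw [h]; simp

theorem measurable_re_coe (v : Lp ℂ 2 μ) : Measurable fun x => (v x).re :=
  Complex.measurable_re.comp (Lp.stronglyMeasurable v).measurable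

theorem integrable_re_coe (v : Lp ℂ 2 μ) : Integrable (fun x => (v x).re) μ :=
  (integrable_of_L2 v).re

theorem ofReal_smul_nonneg (r : ℝ) (hr : 0 ≤ r) (v : Lp ℂ 2 μ) (hv : 0 ≤ v) :
    0 ≤ (r : ℂ) • v := by
  rw [Lp_nonneg_iff] at hv ⊢
  filter_upwards [hv, Lp.coeFn_smul (r : ℂ) v] with x hx h
  rw [h, Pi.smul_apply, smul_eq_mul, hx.2]
  simp only [← Complex.ofReal_mul, Complex.ofReal_re, and_true]
  exact mul_nonneg hr hx.1

theorem IsBddKernel.integrable_mul_real {k : X → X → ℝ} {M : ℝ} (hk : IsBddKernel k M) (x : X)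
    {f : X → ℝ} (hf : Integrable f μ) : Integrable (fun y => k x y * f y) μ :=
  hf.bdd_mul (c := M) (hk.measurable_right x).aestronglyMeasurable (ae_of_all _ fun y => by
    simpa using hk.bound x y)

theorem integral_mul_of_nonneg {k : X → X → ℝ} (x : X) {v : Lp ℂ 2 μ} (hv : 0 ≤ v) :
    ∫ y, (k x y : ℂ) * v y ∂μ = ((∫ y, k x y * (v y).re ∂μ : ℝ) : ℂ) := by
  rw [← integral_complex_ofReal]
  refine integral_congr_ae ?_
  filter_upwards [(Lp_nonneg_iff v).1 hv] with y hy
  rw [Complex.ofReal_mul, ← hy.2]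

/-- A bounded real function as an element of `L²`. -/
def bddL2 (f : X → ℝ) (hf : MemLp f 2 μ) : Lp ℂ 2 μ :=
  (hf.ofReal (K := ℂ)).toLp

theorem bddL2_apply {f : X → ℝ} (hf : MemLp f 2 μ) :
    bddL2 f hf =ᵐ[μ] fun x => (f x : ℂ) :=
  (hf.ofReal (K := ℂ)).coeFn_toLp

theorem bddL2_nonneg {f : X → ℝ} (hf : MemLp f 2 μ) (h0 : ∀ᵐ x ∂μ, 0 ≤ f x) :
    0 ≤ bddL2 f hf := by
  rw [Lp_nonneg_iff]
  filter_upwards [bddL2_apply hf, h0] with x hx h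
  rw [hx]
  exact ⟨h, by simp⟩

end LpFacts

namespace JumpData

variable {X : Type*} [MeasurableSpace X] {μ : Measure X} [IsProbabilityMeasure μ]
  (D : JumpData μ)

/-- The generator. -/
def op : Lp ℂ 2 μ →L[ℂ] Lp ℂ 2 μ := kerOp μ D.k - mulOp μ fun x => (D.g x : ℂ)

theorem measurable_gC : Measurable fun x => (D.g x : ℂ) :=
  Complex.measurable_ofReal.comp D.measurable_g

theorem norm_gC_le (x : X) : ‖(D.g x : ℂ)‖ ≤ D.Cg := by
  simpa using D.g_le x

theorem op_apply (v : Lp ℂ 2 μ) :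
    D.op v =ᵐ[μ] fun x => ∫ y, (D.k x y : ℂ) * v y ∂μ - D.g x * v x := by
  filter_upwards [kerOp_apply D.bdd v, mulOp_apply D.measurable_gC D.norm_gC_le v,
    Lp.coeFn_sub (kerOp μ D.k v) (mulOp μ (fun x => (D.g x : ℂ)) v)] with x h1 h2 h3
  rw [op, sub_apply, h3, Pi.sub_apply, h1, h2]

theorem integral_nonneg' {f : X → ℝ} (hf : ∀ᵐ x ∂μ, 0 ≤ f x) (x : X) :
    0 ≤ ∫ y, D.k x y * f y ∂μ :=
  integral_nonneg_of_ae (by filter_upwards [hf] with y hy using mul_nonneg (D.nonneg x y) hy)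

/-- Since `g ≤ Cg`, the shift by `Cg` turns the killing term into a nonnegative multiplication. This
makes the generator accessible to the positivity result for resolvents. -/
theorem add_op_nonneg {v : Lp ℂ 2 μ} (hv : 0 ≤ v) : 0 ≤ (D.op + (D.Cg : ℂ) • 1) v := by
  have hv' := (Lp_nonneg_iff v).1 hv
  rw [Lp_nonneg_iff]
  filter_upwards [hv', D.op_apply v, Lp.coeFn_add (D.op v) ((D.Cg : ℂ) • v),
    Lp.coeFn_smul (D.Cg : ℂ) v] with x h1 h2 h3 h4
  have e : (D.op + (D.Cg : ℂ) • 1) v = D.op v + (D.Cg : ℂ) • v := by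
    rw [add_apply, smul_apply, one_apply_eq_self]
  have e2 : ((D.op + (D.Cg : ℂ) • 1) v : Lp ℂ 2 μ) x =
      ((∫ y, D.k x y * (v y).re ∂μ + (D.Cg - D.g x) * (v x).re : ℝ) : ℂ) := by
    rw [e, h3, Pi.add_apply, h4, Pi.smul_apply, h2, integral_mul_of_nonneg x hv, h1.2,
      smul_eq_mul]
    push_cast
    simp only [Complex.ofReal_re]
    ring
  rw [e2]
  refine ⟨?_, by simp⟩
  rw [Complex.ofReal_re]
  have h5 := D.integral_nonneg' (hv'.mono fun _ h => h.1) x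
  have h6 := (abs_le.1 (D.g_le x)).2
  have := h1.1
  have : 0 ≤ (D.Cg - D.g x) * (v x).re := mul_nonneg (by linarith) h1.1
  linarith

theorem nonneg_of_nonneg_resolvent {m' : ℝ} (hm : ∀ t : ℝ, m' ≤ t → (t : ℂ) ∉ spectrum ℂ D.op)
    {v : Lp ℂ 2 μ} (hv : 0 ≤ (m' : ℂ) • v - D.op v) : 0 ≤ v := by
  refine nonneg_of_nonneg_smul_sub (T := D.op + (D.Cg : ℂ) • 1) (m := m' + D.Cg)
    ofReal_smul_nonneg (fun w hw => D.add_op_nonneg hw) (fun t ht h => ?_) ?_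
  · refine hm (t - D.Cg) (by linarith) ?_
    rw [spectrum.mem_iff] at h ⊢
    convert h using 2
    rw [Algebra.algebraMap_eq_smul_one, Algebra.algebraMap_eq_smul_one]
    push_cast
    module
  · have e : ((m' + D.Cg : ℝ) : ℂ) • v - (D.op + (D.Cg : ℂ) • 1) v = (m' : ℂ) • v - D.op v := by
      rw [add_apply, smul_apply, one_apply_eq_self]
      push_cast
      module
    rwa [e]

/-- If `[m', ∞)` were free of spectrum, the resolvent at `m'` would be positive; applied to `op v -
m' v = (m' - op)(-v)` it would give `-v ≥ 0`, hence `v = 0`. -/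
theorem exists_spectrum_ge {m' : ℝ} {v : Lp ℂ 2 μ} (hv : 0 ≤ v) (hv0 : v ≠ 0)
    (h : 0 ≤ D.op v - (m' : ℂ) • v) : ∃ t : ℝ, m' ≤ t ∧ (t : ℂ) ∈ spectrum ℂ D.op := by
  by_contra! hcon
  have h1 : 0 ≤ -v := by
    refine D.nonneg_of_nonneg_resolvent hcon ?_
    have e : (m' : ℂ) • -v - D.op (-v) = D.op v - (m' : ℂ) • v := by
      rw [map_neg]
      module
    rwa [e]
  exact hv0 (le_antisymm (neg_nonneg.1 h1) hv)

theorem exists_spectrum_of_lt {m' : ℝ} (hm : m' < -D.g₀) :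
    ∃ t : ℝ, m' ≤ t ∧ (t : ℂ) ∈ spectrum ℂ D.op := by
  -- The threshold is just `-m'`, written to match `g₀_inf`. On `E` the killing rate is below `-m'`
  -- and the jump part is nonnegative, so the indicator of `E` is a subsolution at level `m'`.
  set E : Set X := {x | D.g x < D.g₀ + (-D.g₀ - m')}
  have hE : MeasurableSet E := measurableSet_lt D.measurable_g measurable_const
  have hE0 : μ E ≠ 0 := D.g₀_inf _ (by linarith)
  have hmem : MemLp (E.indicator fun _ => (1 : ℝ)) 2 μ :=
    memLp_indicator_const 2 hE 1 (Or.inr (measure_ne_top _ _))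
  have hnn : ∀ x, 0 ≤ E.indicator (fun _ => (1 : ℝ)) x := fun x =>
    indicator_nonneg (fun _ _ => zero_le_one) x
  have hpos := bddL2_nonneg hmem (ae_of_all _ hnn)
  refine D.exists_spectrum_ge hpos ?_ ?_
  · intro h0
    have h1 := bddL2_apply hmem
    rw [h0] at h1
    refine hE0 (measure_mono_null (fun x hx => ?_) (ae_iff.1 ((Lp.coeFn_zero ℂ 2 μ).symm.trans h1)))
    simp only [mem_ofPred_eq, indicator_of_mem hx]
    simp
  · rw [Lp_nonneg_iff]
    set v := bddL2 _ hmem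
    have hv' := (Lp_nonneg_iff v).1 hpos
    filter_upwards [bddL2_apply hmem, D.op_apply v, Lp.coeFn_sub (D.op v) ((m' : ℂ) • v),
      Lp.coeFn_smul (m' : ℂ) v] with x h1 h2 h3 h4
    have e2 : (D.op v - (m' : ℂ) • v : Lp ℂ 2 μ) x =
        ((∫ y, D.k x y * (v y).re ∂μ + (-m' - D.g x) * E.indicator (fun _ => (1 : ℝ)) x : ℝ) : ℂ) := by
      rw [h3, Pi.sub_apply, h4, Pi.smul_apply, h2, integral_mul_of_nonneg x hpos, h1, smul_eq_mul]
      push_cast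
      ring
    rw [e2]
    refine ⟨?_, by simp⟩
    rw [Complex.ofReal_re]
    have h5 := D.integral_nonneg' (hv'.mono fun _ h => h.1) x
    refine add_nonneg h5 ?_
    by_cases hx : x ∈ E
    · have : D.g x < D.g₀ + (-D.g₀ - m') := hx
      rw [indicator_of_mem hx]
      linarith
    · simp [indicator_of_notMem hx]

/-- The spectral bound of the generator. -/
def s : ℝ := sSup (Complex.re '' spectrum ℂ D.op)

/-- The spectrum is compact, and the indicator test functions show that it is nonempty. -/
theorem isGreatest_s : IsGreatest (Complex.re '' spectrum ℂ D.op) D.s := by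
  have hne : (Complex.re '' spectrum ℂ D.op).Nonempty := by
    obtain ⟨t, -, ht⟩ := D.exists_spectrum_of_lt (m' := -D.g₀ - 1) (by linarith)
    exact ⟨_, mem_image_of_mem _ ht⟩
  exact ((spectrum.isCompact D.op).image Complex.continuous_re).isGreatest_sSup hne

theorem re_le_s {z : ℂ} (hz : z ∈ spectrum ℂ D.op) : z.re ≤ D.s :=
  D.isGreatest_s.2 (mem_image_of_mem _ hz)

theorem notMem_spectrum_of_lt {t : ℝ} (ht : D.s < t) : (t : ℂ) ∉ spectrum ℂ D.op := fun h =>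
  absurd (D.re_le_s h) (by simpa using ht)

theorem le_s_of_nonneg_sub {m' : ℝ} {v : Lp ℂ 2 μ} (hv : 0 ≤ v) (hv0 : v ≠ 0)
    (h : 0 ≤ D.op v - (m' : ℂ) • v) : m' ≤ D.s := by
  obtain ⟨t, ht, hts⟩ := D.exists_spectrum_ge hv hv0 h
  exact ht.trans (by simpa using D.re_le_s hts)

theorem neg_g₀_le_s : -D.g₀ ≤ D.s := by
  refine le_of_forall_lt fun m' hm => ?_
  -- The midpoint between `m'` and `-g₀` yields the strict inequality.
  obtain ⟨t, ht, hts⟩ := D.exists_spectrum_of_lt (m' := (m' + -D.g₀) / 2) (by linarith)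
  have h1 : t ≤ D.s := by simpa using D.re_le_s hts
  linarith

theorem mulOp_add_const (z : ℂ) :
    mulOp μ (fun x => z + D.g x) = z • 1 + mulOp μ fun x => (D.g x : ℂ) := by
  ext v
  filter_upwards [mulOp_apply (C := ‖z‖ + D.Cg) (D.measurable_gC.const_add z)
      (fun x => (norm_add_le _ _).trans (add_le_add le_rfl (D.norm_gC_le x))) v,
    mulOp_apply D.measurable_gC D.norm_gC_le v, Lp.coeFn_smul z v,
    Lp.coeFn_add (z • v) (mulOp μ (fun x => (D.g x : ℂ)) v)] with x h1 h2 h3 h4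
  rw [h1, add_apply, smul_apply, one_apply_eq_self, h4, Pi.add_apply, h2, h3, Pi.smul_apply,
    smul_eq_mul]
  ring

/-- The Fredholm alternative to the right of the essential spectrum. -/
theorem isUnit_of_injective {k : X → X → ℝ} {M : ℝ} (hk : IsBddKernel k M) {z : ℂ}
    (hz : -D.g₀ < z.re)
    (hinj : ∀ v : Lp ℂ 2 μ, kerOp μ k v - mulOp μ (fun x => (D.g x : ℂ)) v = z • v → v = 0) :
    IsUnit (z • 1 + mulOp μ (fun x => (D.g x : ℂ)) - kerOp μ k) := by
  rw [← D.mulOp_add_const]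
  refine isUnit_mulOp_sub_kerOp (C := ‖z‖ + D.Cg) (δ := z.re + D.g₀) hk
    (D.measurable_gC.const_add z)
    (fun x => (norm_add_le _ _).trans (add_le_add le_rfl (D.norm_gC_le x)))
    (by linarith) (fun x => ?_) fun v hv => hinj v ?_
  · refine le_trans ?_ (Complex.re_le_norm _)
    simpa using D.g₀_le x
  · rw [← hv, D.mulOp_add_const, add_apply, smul_apply, one_apply_eq_self]
    abel

/-- Multiplication by `z + g` is invertible for `Re z > -g₀` and the kernel operator is compact, so
noninvertibility can only come from a kernel. -/
theorem exists_eigenvector {z : ℂ} (hz : z ∈ spectrum ℂ D.op) (hre : -D.g₀ < z.re) :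
    ∃ v : Lp ℂ 2 μ, v ≠ 0 ∧ D.op v = z • v := by
  by_contra! hcon
  have h := D.isUnit_of_injective D.bdd hre fun v hv => by
    by_contra h0
    exact hcon v h0 hv
  refine hz ?_
  rw [spectrum.mem_resolventSet_iff]
  convert h using 1
  rw [op, Algebra.algebraMap_eq_smul_one]
  abel

end JumpData
end PeriodicJump
end

noncomputable section

namespace PeriodicJump

/-! ### Perron–Frobenius theory above the essential spectrum -/

open scoped ComplexOrder

namespace JumpData

variable {X : Type*} [MeasurableSpace X] {μ : Measure X} [IsProbabilityMeasure μ]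
  (D : JumpData μ)

theorem integrable_k_mul (x : X) {f : X → ℝ} (hf : Integrable f μ) :
    Integrable (fun y => D.k x y * f y) μ :=
  D.bdd.integrable_mul_real x hf

theorem integrable_k (x : X) : Integrable (D.k x) μ := by
  simpa using D.integrable_k_mul x (integrable_const (1 : ℝ))

theorem M_nonneg : 0 ≤ D.M := by
  have : Nonempty X := nonempty_of_isProbabilityMeasure μ
  exact D.bdd.nonneg

theorem k_le (x y : X) : D.k x y ≤ D.M := (le_abs_self _).trans (D.bdd.bound x y)

/-- A nonzero supersolution is positive almost everywhere. -/
theorem ae_pos_of_integral_le {f : X → ℝ} (hfm : Measurable f) (hfi : Integrable f μ)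
    (h0 : ∀ᵐ x ∂μ, 0 ≤ f x) (hne : ¬ f =ᵐ[μ] 0) {c : ℝ}
    (h : ∀ᵐ x ∂μ, ∫ y, D.k x y * f y ∂μ ≤ c * f x) : ∀ᵐ x ∂μ, 0 < f x := by
  set E : Set X := {x | 0 < f x}
  have hE : MeasurableSet E := measurableSet_lt measurable_const hfm
  -- At a zero of `f` the supersolution inequality forces `∫ k f = 0`, so the kernel does not lead
  -- from the zero set of `f` to its support, and irreducibility applies.
  have hzero : ∫⁻ x in Eᶜ, ∫⁻ y in E, ENNReal.ofReal (D.k x y) ∂μ ∂μ = 0 := by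
    refine lintegral_eq_zero_of_ae_eq_zero ?_
    rw [Filter.EventuallyEq, ae_restrict_iff' hE.compl]
    filter_upwards [h, h0] with x hx hx0 hxE
    have hfx : f x = 0 := le_antisymm (not_lt.1 hxE) hx0
    rw [hfx, mul_zero] at hx
    have h1 : 0 ≤ᵐ[μ] fun y => D.k x y * f y := by
      filter_upwards [h0] with y hy using mul_nonneg (D.nonneg x y) hy
    have h2 := (integral_eq_zero_iff_of_nonneg_ae h1 (D.integrable_k_mul x hfi)).1
      (le_antisymm hx (integral_nonneg_of_ae h1))
    refine lintegral_eq_zero_of_ae_eq_zero ?_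
    rw [Filter.EventuallyEq, ae_restrict_iff' hE]
    filter_upwards [h2] with y hy hyE
    have hfy : f y ≠ 0 := ne_of_gt hyE
    have : D.k x y = 0 := (mul_eq_zero.1 hy).resolve_right hfy
    simp [this]
  rcases D.irred E hE hzero with h1 | h1
  · refine absurd ?_ hne
    have h2 : ∀ᵐ x ∂μ, x ∉ E := measure_eq_zero_iff_ae_notMem.1 h1
    filter_upwards [h2, h0] with x hx hx0
    exact le_antisymm (not_lt.1 hx) hx0
  · have h2 : ∀ᵐ x ∂μ, x ∉ Eᶜ := measure_eq_zero_iff_ae_notMem.1 h1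
    filter_upwards [h2] with x hx
    simpa [E] using hx

/-- A nonzero supersolution is bounded below by a positive constant. -/
theorem exists_pos_le_of_integral_le {f : X → ℝ} (hfm : Measurable f) (hfi : Integrable f μ)
    (h0 : ∀ᵐ x ∂μ, 0 ≤ f x) (hne : ¬ f =ᵐ[μ] 0) {c : ℝ} (hc : 0 < c)
    (h : ∀ᵐ x ∂μ, ∫ y, D.k x y * f y ∂μ ≤ c * f x) : ∃ δ > 0, ∀ᵐ x ∂μ, δ ≤ f x := by
  have hpos := D.ae_pos_of_integral_le hfm hfi h0 hne h
  have hM := D.M_nonneg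
  -- The level set `{f < δ}` is chosen so small that it carries at most half of the row mass `m`;
  -- the other half gives `∫ k f ≥ δ m / 2` at every point. The `+ 1` only keeps the denominator
  -- positive.
  obtain ⟨δ, hδ, hsmall⟩ : ∃ δ > 0, μ.real {x | f x < δ} ≤ D.m / (2 * (D.M + 1)) := by
    have hanti : Antitone fun n : ℕ => {x | f x < 1 / ((n : ℝ) + 1)} := fun a b hab x hx =>
      lt_of_lt_of_le (show f x < 1 / ((b : ℝ) + 1) from hx)
        (one_div_le_one_div_of_le (by positivity) (by gcongr))
    have hlim := tendsto_measure_iInter_atTop (μ := μ)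
      (s := fun n : ℕ => {x | f x < 1 / ((n : ℝ) + 1)})
      (fun n => (measurableSet_lt hfm measurable_const).nullMeasurableSet) hanti
      ⟨0, measure_ne_top _ _⟩
    have hnull : μ (⋂ n : ℕ, {x | f x < 1 / ((n : ℝ) + 1)}) = 0 := by
      refine measure_mono_null (fun x hx => ?_) (ae_iff.1 hpos)
      simp only [mem_ofPred_eq, not_lt]
      refine ge_of_tendsto' tendsto_one_div_add_atTop_nhds_zero_nat fun n => ?_
      exact (mem_iInter.1 hx n).le
    rw [hnull] at hlim
    have hpos' : (0 : ℝ≥0∞) < ENNReal.ofReal (D.m / (2 * (D.M + 1))) :=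
      ENNReal.ofReal_pos.2 (div_pos D.m_pos (by positivity))
    obtain ⟨n, hn⟩ := (hlim.eventually (gt_mem_nhds hpos')).exists
    exact ⟨1 / ((n : ℝ) + 1), by positivity,
      ENNReal.toReal_le_of_le_ofReal (div_pos D.m_pos (by positivity)).le hn.le⟩
  set F : Set X := {x | f x < δ}
  have hF : MeasurableSet F := measurableSet_lt hfm measurable_const
  have hlow : ∀ x, δ * (D.m / 2) ≤ ∫ y, D.k x y * f y ∂μ := by
    intro x
    have hi₁ : Integrable (fun y => D.M * F.indicator (1 : X → ℝ) y) μ :=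
      ((integrable_const (1 : ℝ)).indicator hF).const_mul D.M
    have hi : Integrable (fun y => δ * (D.k x y - D.M * F.indicator 1 y)) μ :=
      ((D.integrable_k x).sub hi₁).const_mul δ
    have h1 : ∫ y, δ * (D.k x y - D.M * F.indicator 1 y) ∂μ =
        δ * (∫ y, D.k x y ∂μ - D.M * μ.real F) := by
      rw [integral_const_mul, integral_sub (D.integrable_k x) hi₁, integral_const_mul,
        integral_indicator_one hF]
    have h2 : D.M * μ.real F ≤ D.m / 2 := by
      calc _ ≤ D.M * (D.m / (2 * (D.M + 1))) := by gcongr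
        _ ≤ (D.M + 1) * (D.m / (2 * (D.M + 1))) := by
          have := div_pos D.m_pos (by positivity : 0 < 2 * (D.M + 1))
          nlinarith
        _ = D.m / 2 := by field_simp
    calc δ * (D.m / 2) ≤ δ * (∫ y, D.k x y ∂μ - D.M * μ.real F) := by
          have := D.row x
          gcongr
          linarith
      _ = _ := h1.symm
      _ ≤ _ := by
        refine integral_mono_ae hi (D.integrable_k_mul x hfi) ?_
        filter_upwards [h0] with y hy
        by_cases hyF : y ∈ F
        · simp only [indicator_of_mem hyF, Pi.one_apply]
          have h3 := D.k_le x y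
          have h4 : 0 ≤ D.k x y * f y := mul_nonneg (D.nonneg x y) hy
          nlinarith
        · simp only [indicator_of_notMem hyF]
          have h3 : δ ≤ f y := not_lt.1 hyF
          have := D.nonneg x y
          nlinarith
  refine ⟨δ * (D.m / 2) / c, div_pos (mul_pos hδ (half_pos D.m_pos)) hc, ?_⟩
  filter_upwards [h] with x hx
  rw [div_le_iff₀ hc, mul_comm]
  linarith [hlow x]

/-- A bounded multiple of `v` that is dominated by the jump part and a bounded function. -/
theorem exists_le_of_mul_le {v : Lp ℂ 2 μ} (hv : 0 ≤ v) {c b : ℝ} (hc : -D.g₀ < c)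
    (h : ∀ᵐ x ∂μ, (c + D.g x) * (v x).re ≤ ∫ y, D.k x y * (v y).re ∂μ + b) :
    ∃ C > 0, ∀ᵐ x ∂μ, (v x).re ≤ C := by
  have hM := D.M_nonneg
  have hv' := (Lp_nonneg_iff v).1 hv
  set B : ℝ := D.M * ‖v‖ + |b|
  have hB : 0 ≤ B := by positivity
  have hcg : 0 < c + D.g₀ := by linarith
  refine ⟨B / (c + D.g₀) + 1, by positivity, ?_⟩
  filter_upwards [h, hv'] with x hx hx0
  -- A bounded kernel maps `L²` into bounded functions; dividing by `c + g ≥ c + g₀ > 0` then bounds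
  -- `v` itself.
  have h1 : ∫ y, D.k x y * (v y).re ∂μ ≤ D.M * ‖v‖ := by
    calc _ ≤ ∫ y, D.M * ‖v y‖ ∂μ := by
          refine integral_mono_ae (D.integrable_k_mul x (integrable_re_coe v))
            ((integrable_of_L2 v).norm.const_mul _) ?_
          filter_upwards [hv'] with y hy
          exact mul_le_mul (D.k_le x y) (Complex.re_le_norm _) hy.1 hM
      _ ≤ _ := by
        rw [integral_const_mul]
        exact mul_le_mul_of_nonneg_left (integral_norm_le_norm v) hM
  have h2 : (v x).re ≤ B / (c + D.g₀) := by
    rw [le_div_iff₀ hcg]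
    have := D.g₀_le x
    have := le_abs_self b
    have := hx0.1
    nlinarith
  linarith

theorem op_apply_of_nonneg {v : Lp ℂ 2 μ} (hv : 0 ≤ v) :
    ∀ᵐ x ∂μ, D.op v x = ((∫ y, D.k x y * (v y).re ∂μ - D.g x * (v x).re : ℝ) : ℂ) := by
  filter_upwards [D.op_apply v, (Lp_nonneg_iff v).1 hv] with x h1 h2
  rw [h1, integral_mul_of_nonneg x hv, Complex.ofReal_sub, Complex.ofReal_mul, ← h2.2]

theorem smul_sub_apply {v : Lp ℂ 2 μ} (hv : 0 ≤ v) (t : ℝ) :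
    ∀ᵐ x ∂μ, ((t : ℂ) • v - D.op v : Lp ℂ 2 μ) x =
      (((t + D.g x) * (v x).re - ∫ y, D.k x y * (v y).re ∂μ : ℝ) : ℂ) := by
  filter_upwards [D.op_apply_of_nonneg hv, (Lp_nonneg_iff v).1 hv,
    Lp.coeFn_sub ((t : ℂ) • v) (D.op v), Lp.coeFn_smul (t : ℂ) v] with x h1 h2 h3 h4
  rw [h3, Pi.sub_apply, h4, Pi.smul_apply, h1, smul_eq_mul]
  nth_rw 1 [h2.2]
  push_cast
  ring

theorem smul_sub_nonneg_iff {v : Lp ℂ 2 μ} (hv : 0 ≤ v) (t : ℝ) :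
    0 ≤ (t : ℂ) • v - D.op v ↔
      ∀ᵐ x ∂μ, ∫ y, D.k x y * (v y).re ∂μ ≤ (t + D.g x) * (v x).re := by
  rw [Lp_nonneg_iff]
  constructor
  · intro h
    filter_upwards [h, D.smul_sub_apply hv t] with x h1 h2
    rw [h2] at h1
    simpa using h1.1
  · intro h
    filter_upwards [h, D.smul_sub_apply hv t] with x h1 h2
    rw [h2]
    exact ⟨by simpa using h1, by simp⟩

theorem sub_smul_nonneg_iff {v : Lp ℂ 2 μ} (hv : 0 ≤ v) (t : ℝ) :
    0 ≤ D.op v - (t : ℂ) • v ↔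
      ∀ᵐ x ∂μ, (t + D.g x) * (v x).re ≤ ∫ y, D.k x y * (v y).re ∂μ := by
  rw [← neg_sub, neg_nonneg, ← neg_nonneg, Lp_nonneg_iff]
  have hneg := Lp.coeFn_neg ((t : ℂ) • v - D.op v)
  constructor
  · intro h
    filter_upwards [h, D.smul_sub_apply hv t, hneg] with x h1 h2 h3
    rw [h3, Pi.neg_apply, h2] at h1
    simpa using h1.1
  · intro h
    filter_upwards [h, D.smul_sub_apply hv t, hneg] with x h1 h2 h3
    rw [h3, Pi.neg_apply, h2]
    exact ⟨by simpa using h1, by simp⟩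

theorem op_eq_smul_iff {v : Lp ℂ 2 μ} (hv : 0 ≤ v) (t : ℝ) :
    D.op v = (t : ℂ) • v ↔
      ∀ᵐ x ∂μ, ∫ y, D.k x y * (v y).re ∂μ = (t + D.g x) * (v x).re := by
  rw [← sub_eq_zero, ← neg_eq_zero, neg_sub]
  constructor
  · intro h
    filter_upwards [(D.smul_sub_nonneg_iff hv t).1 (by rw [h]),
      (D.sub_smul_nonneg_iff hv t).1 (by rw [← neg_sub, h, neg_zero])] with x h1 h2
    exact le_antisymm h1 h2
  · intro h
    refine le_antisymm ?_ ((D.smul_sub_nonneg_iff hv t).2 (h.mono fun _ h => h.le))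
    rw [← neg_nonneg, neg_sub]
    exact (D.sub_smul_nonneg_iff hv t).2 (h.mono fun _ h => h.ge)

theorem g_add_le (t : ℝ) (x : X) : t + D.g x ≤ |t| + |D.Cg| + 1 := by
  have := (abs_le.1 (D.g_le x)).2
  have := le_abs_self t
  have := le_abs_self D.Cg
  linarith

theorem re_ae_ne_zero {v : Lp ℂ 2 μ} (hv : 0 ≤ v) (hv0 : v ≠ 0) :
    ¬ (fun x => (v x).re) =ᵐ[μ] 0 := fun h => by
  refine hv0 (Lp.ext ?_)
  filter_upwards [h, (Lp_nonneg_iff v).1 hv, Lp.coeFn_zero ℂ 2 μ] with x h1 h2 h3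
  rw [h2.2, h3]
  simpa using h1

theorem exists_pos_le_of_smul_sub_nonneg {f : Lp ℂ 2 μ} (hf : 0 ≤ f) (hf0 : f ≠ 0) {t : ℝ}
    (h : 0 ≤ (t : ℂ) • f - D.op f) : ∃ δ > 0, ∀ᵐ x ∂μ, δ ≤ (f x).re := by
  have hf' := (Lp_nonneg_iff f).1 hf
  refine D.exists_pos_le_of_integral_le (measurable_re_coe f) (integrable_re_coe f)
    (hf'.mono fun _ h => h.1) (re_ae_ne_zero hf hf0)
    (by positivity : 0 < |t| + |D.Cg| + 1) ?_
  filter_upwards [(D.smul_sub_nonneg_iff hf t).1 h, hf'] with x h1 h2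
  exact h1.trans (mul_le_mul_of_nonneg_right (D.g_add_le t x) h2.1)

theorem exists_resolvent {t : ℝ} (ht : D.s < t) (w : Lp ℂ 2 μ) :
    ∃ v : Lp ℂ 2 μ, (t : ℂ) • v - D.op v = w := by
  have h := D.notMem_spectrum_of_lt ht
  rw [spectrum.mem_iff, not_not] at h
  obtain ⟨v, hv⟩ := ((ContinuousLinearMap.isUnit_iff_bijective).1 h).2 w
  rw [sub_apply, Algebra.algebraMap_eq_smul_one, smul_apply, one_apply_eq_self] at hv
  exact ⟨v, hv⟩

theorem nonneg_of_resolvent {t : ℝ} (ht : D.s < t) {v : Lp ℂ 2 μ}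
    (hv : 0 ≤ (t : ℂ) • v - D.op v) : 0 ≤ v :=
  D.nonneg_of_nonneg_resolvent (fun _ h => D.notMem_spectrum_of_lt (ht.trans_le h)) hv

/-- A subsolution at the spectral bound is an eigenfunction. -/
theorem op_eq_of_subsolution (hs : -D.g₀ < D.s) {v : Lp ℂ 2 μ} (hv : 0 ≤ v)
    (h : 0 ≤ D.op v - (D.s : ℂ) • v) : D.op v = (D.s : ℂ) • v := by
  by_contra hne
  set w := D.op v - (D.s : ℂ) • v with hw
  have hw0 : w ≠ 0 := fun h0 => hne (sub_eq_zero.1 h0)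
  have hv0 : v ≠ 0 := fun h0 => hw0 (by rw [hw, h0]; simp)
  -- The defect `w ≥ 0` need not be bounded below. Applying the positive resolvent at `s + 1`
  -- replaces `v` by `v₁` and `w` by `f`; the operators commute, so `f` is the defect of `v₁`.
  obtain ⟨v₁, hv₁⟩ := D.exists_resolvent (lt_add_one D.s) v
  have hv₁0 : 0 ≤ v₁ := D.nonneg_of_resolvent (lt_add_one D.s) (by rwa [hv₁])
  set f := D.op v₁ - (D.s : ℂ) • v₁ with hf
  have hfw : ((D.s + 1 : ℝ) : ℂ) • f - D.op f = w := by
    rw [hw, ← hv₁, hf]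
    simp only [map_sub, map_smul]
    module
  have hf0 : 0 ≤ f := D.nonneg_of_resolvent (lt_add_one D.s) (by rwa [hfw])
  have hfne : f ≠ 0 := fun h0 => hw0 (by rw [← hfw, h0]; simp)
  obtain ⟨δ, hδ, hδf⟩ := D.exists_pos_le_of_smul_sub_nonneg hf0 hfne (hfw ▸ h)
  obtain ⟨C, -, hC⟩ := D.exists_le_of_mul_le (b := 0) hv hs (by
    simpa using (D.sub_smul_nonneg_iff hv _).1 h)
  obtain ⟨C₁, hC₁, hCv⟩ := D.exists_le_of_mul_le (b := C) (c := D.s + 1) hv₁0 (by linarith) (by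
    filter_upwards [D.smul_sub_apply hv₁0 (D.s + 1), hC] with x h1 h2
    rw [hv₁] at h1
    rw [h1, Complex.ofReal_re] at h2
    linarith)
  have hv₁ne : v₁ ≠ 0 := fun h0 => hv0 (by rw [← hv₁, h0]; simp)
  -- Now the defect `f` of `v₁` is at least `δ`, by irreducibility, and `v₁ ≤ C₁`. So `v₁` is a
  -- subsolution at the level `s + δ / C₁`, which contradicts the maximality of `s`.
  have hkey : 0 ≤ D.op v₁ - ((D.s + δ / C₁ : ℝ) : ℂ) • v₁ := by
    have h1 : 0 ≤ f - ((δ / C₁ : ℝ) : ℂ) • v₁ := by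
      rw [Lp_nonneg_iff]
      filter_upwards [hδf, hCv, (Lp_nonneg_iff f).1 hf0, (Lp_nonneg_iff v₁).1 hv₁0,
        Lp.coeFn_sub f (((δ / C₁ : ℝ) : ℂ) • v₁), Lp.coeFn_smul ((δ / C₁ : ℝ) : ℂ) v₁]
        with x h1 h2 h3 h4 h5 h6
      rw [h5, Pi.sub_apply, h6, Pi.smul_apply, smul_eq_mul, h3.2, h4.2]
      rw [← Complex.ofReal_mul, ← Complex.ofReal_sub, Complex.ofReal_re]
      refine ⟨?_, rfl⟩
      have : δ / C₁ * (v₁ x).re ≤ δ := by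
        rw [div_mul_eq_mul_div, div_le_iff₀ hC₁]
        gcongr
      linarith
    have e : D.op v₁ - ((D.s + δ / C₁ : ℝ) : ℂ) • v₁ = f - ((δ / C₁ : ℝ) : ℂ) • v₁ := by
      rw [hf]; push_cast; module
    rwa [e]
  have := D.le_s_of_nonneg_sub hv₁0 hv₁ne hkey
  have : 0 < δ / C₁ := by positivity
  linarith

/-- The absolute value of an element of `L²`. -/
def absL2 (v : Lp ℂ 2 μ) : Lp ℂ 2 μ := bddL2 (fun x => ‖v x‖) (Lp.memLp v).norm

theorem absL2_apply (v : Lp ℂ 2 μ) : absL2 v =ᵐ[μ] fun x => (‖v x‖ : ℂ) :=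
  bddL2_apply _

theorem absL2_nonneg (v : Lp ℂ 2 μ) : 0 ≤ absL2 v :=
  bddL2_nonneg _ (ae_of_all _ fun _ => norm_nonneg _)

theorem absL2_ne_zero {v : Lp ℂ 2 μ} (hv : v ≠ 0) : absL2 v ≠ 0 := fun h => by
  refine hv (Lp.ext ?_)
  have h1 := absL2_apply v
  rw [h] at h1
  filter_upwards [h1, Lp.coeFn_zero ℂ 2 μ] with x h2 h3
  rw [h3] at h2 ⊢
  simpa using h2.symm

theorem integral_absL2 (v : Lp ℂ 2 μ) (x : X) :
    ∫ y, D.k x y * (absL2 v y).re ∂μ = ∫ y, D.k x y * ‖v y‖ ∂μ := by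
  refine integral_congr_ae ?_
  filter_upwards [absL2_apply v] with y hy
  rw [hy, Complex.ofReal_re]

theorem norm_integral_le_integral_norm (v : Lp ℂ 2 μ) (x : X) :
    ‖∫ y, (D.k x y : ℂ) * v y ∂μ‖ ≤ ∫ y, D.k x y * ‖v y‖ ∂μ := by
  refine norm_integral_le_of_norm_le (D.integrable_k_mul x (integrable_of_L2 v).norm)
    (ae_of_all _ fun y => ?_)
  rw [norm_mul, Complex.norm_real, Real.norm_of_nonneg (D.nonneg x y)]

theorem ae_norm_eq_of_eigenvector {v : Lp ℂ 2 μ} {z : ℂ} (hv : D.op v = z • v) :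
    ∀ᵐ x ∂μ, ‖z + D.g x‖ * ‖v x‖ ≤ ∫ y, D.k x y * ‖v y‖ ∂μ := by
  filter_upwards [D.op_apply v, Lp.coeFn_smul z v] with x h1 h2
  rw [hv, h2, Pi.smul_apply, smul_eq_mul] at h1
  have h3 : (z + D.g x) * v x = ∫ y, (D.k x y : ℂ) * v y ∂μ := by linear_combination h1
  rw [← norm_mul, h3]
  exact D.norm_integral_le_integral_norm v x

/-- A Kato inequality: `(s + g)|v| ≤ |z + g||v| = |∫ k v| ≤ ∫ k |v|`, so `|v|` is a subsolution at
the spectral bound and hence an eigenfunction. -/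
theorem op_absL2 (hs : -D.g₀ < D.s) {v : Lp ℂ 2 μ} {z : ℂ} (hv : D.op v = z • v)
    (hz : z.re = D.s) : D.op (absL2 v) = (D.s : ℂ) • absL2 v := by
  refine D.op_eq_of_subsolution hs (absL2_nonneg v) ?_
  rw [D.sub_smul_nonneg_iff (absL2_nonneg v)]
  filter_upwards [D.ae_norm_eq_of_eigenvector hv, absL2_apply v] with x h1 h2
  rw [D.integral_absL2, h2, Complex.ofReal_re]
  refine le_trans (mul_le_mul_of_nonneg_right ?_ (norm_nonneg _)) h1
  rw [← hz]
  simpa using Complex.re_le_norm (z + D.g x)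

/-- Measurable functions bounded between two positive constants. -/
structure IsPosBdd (u : X → ℝ) : Prop where
  measurable : Measurable u
  exists_bounds : ∃ δ > 0, ∃ C, ∀ x, δ ≤ u x ∧ u x ≤ C

theorem exists_isPosBdd {v : Lp ℂ 2 μ} {δ C : ℝ} (hδ : 0 < δ)
    (h1 : ∀ᵐ x ∂μ, δ ≤ (v x).re) (h2 : ∀ᵐ x ∂μ, (v x).re ≤ C) :
    ∃ u, IsPosBdd u ∧ (fun x => (v x).re) =ᵐ[μ] u := by
  refine ⟨fun x => max δ (min C (v x).re),
    ⟨measurable_const.max (measurable_const.min (measurable_re_coe v)),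
      δ, hδ, max δ C, fun x => ⟨le_max_left _ _, max_le_max le_rfl (min_le_left _ _)⟩⟩, ?_⟩
  filter_upwards [h1, h2] with x h3 h4
  rw [min_eq_right h4, max_eq_right h3]

/-- Above the essential spectrum, the spectral bound has a positive eigenfunction and is the
only spectral value of maximal real part. -/
theorem exists_eigenfunction (hs : -D.g₀ < D.s) :
    (∃ u, IsPosBdd u ∧ ∀ᵐ x ∂μ, ∫ y, D.k x y * u y ∂μ = (D.s + D.g x) * u x) ∧
      ∀ z ∈ spectrum ℂ D.op, z.re = D.s → z = D.s := by
  have key : ∀ z ∈ spectrum ℂ D.op, z.re = D.s →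
      ∃ a : Lp ℂ 2 μ, 0 ≤ a ∧ D.op a = (D.s : ℂ) • a ∧ (∃ δ > 0, ∀ᵐ x ∂μ, δ ≤ (a x).re) ∧
        z = D.s := by
    intro z hz hzs
    obtain ⟨v, hv0, hv⟩ := D.exists_eigenvector hz (hzs ▸ hs)
    have h1 := D.op_absL2 hs hv hzs
    obtain ⟨δ, hδ, hδa⟩ := D.exists_pos_le_of_smul_sub_nonneg (t := D.s) (absL2_nonneg v)
      (absL2_ne_zero hv0) (by rw [h1, sub_self])
    refine ⟨absL2 v, absL2_nonneg v, h1, ⟨δ, hδ, hδa⟩, ?_⟩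
    have h2 := (D.op_eq_smul_iff (absL2_nonneg v) _).1 h1
    -- One point with `|v x| > 0` suffices: there the equation for `|v|` gives `|z + g x| ≤ s + g x
    -- = Re (z + g x)`, so `z` is real.
    obtain ⟨x, hx⟩ :=
      (((hδa.and h2).and (absL2_apply v)).and (D.ae_norm_eq_of_eigenvector hv)).exists
    obtain ⟨⟨⟨hx1, hx2⟩, hx3⟩, hx4⟩ := hx
    rw [D.integral_absL2, hx3, Complex.ofReal_re] at hx2
    rw [hx3, Complex.ofReal_re] at hx1
    rw [hx2] at hx4
    have h5 : ‖z + D.g x‖ ≤ D.s + D.g x :=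
      le_of_mul_le_mul_right hx4 (hδ.trans_le hx1)
    have h6 : (z + D.g x).re = D.s + D.g x := by simp [hzs]
    have h7 : (z + D.g x).im = 0 := by
      have h8 := Complex.sq_norm (z + D.g x)
      rw [Complex.normSq_apply, h6] at h8
      have h9 : 0 ≤ ‖z + D.g x‖ := norm_nonneg _
      nlinarith [sq_nonneg (z + D.g x).im]
    refine Complex.ext (by simpa using hzs) (by simpa using h7)
  refine ⟨?_, fun z hz h => (key z hz h).choose_spec.2.2.2⟩
  obtain ⟨z, hz, hzs⟩ := D.isGreatest_s.1
  obtain ⟨a, ha0, hop, ⟨δ, hδ, hδa⟩, -⟩ := key z hz hzs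
  have h2 := (D.op_eq_smul_iff ha0 _).1 hop
  obtain ⟨C, -, hC⟩ := D.exists_le_of_mul_le (b := 0) ha0 hs (by
    filter_upwards [h2] with x hx
    linarith)
  obtain ⟨u, hu, hau⟩ := exists_isPosBdd hδ hδa hC
  refine ⟨u, hu, ?_⟩
  filter_upwards [h2, hau] with x hx hx'
  rw [← hx', ← hx]
  refine integral_congr_ae ?_
  filter_upwards [hau] with y hy
  rw [← hy]

/-- Strict supersolutions above the spectral bound. -/
theorem exists_supersolution {t : ℝ} (ht : D.s < t) :
    ∃ w, IsPosBdd w ∧ ∀ᵐ x ∂μ, ∫ y, D.k x y * w y ∂μ ≤ (t + D.g x) * w x := by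
  have h1mem : MemLp (fun _ : X => (1 : ℝ)) 2 μ := memLp_const 1
  have h1 : 0 ≤ bddL2 _ h1mem := bddL2_nonneg h1mem (ae_of_all _ fun _ => zero_le_one)
  -- The supersolution is the resolvent applied to the constant one. The source term gives `(t + g)
  -- v ≥ 1`, which bounds `v` from below.
  obtain ⟨v, hv⟩ := D.exists_resolvent ht (bddL2 _ h1mem)
  have hv0 : 0 ≤ v := D.nonneg_of_resolvent ht (by rwa [hv])
  have hv' := (Lp_nonneg_iff v).1 hv0
  have heq : ∀ᵐ x ∂μ, (t + D.g x) * (v x).re = ∫ y, D.k x y * (v y).re ∂μ + 1 := by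
    filter_upwards [D.smul_sub_apply hv0 t, bddL2_apply h1mem] with x h2 h3
    rw [hv, h3] at h2
    have h4 := Complex.ofReal_injective h2
    linarith
  obtain ⟨C, -, hC⟩ := D.exists_le_of_mul_le (b := 1) (c := t) hv0
    (D.neg_g₀_le_s.trans_lt ht) (heq.mono fun _ h => h.le)
  set B : ℝ := |t| + |D.Cg| + 1
  have hB : 0 < B := by positivity
  have hlow : ∀ᵐ x ∂μ, 1 / B ≤ (v x).re := by
    filter_upwards [heq, hv'] with x h2 h3
    rw [div_le_iff₀ hB, mul_comm]
    have h4 := D.integral_nonneg' (hv'.mono fun _ h => h.1) x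
    have h5 := mul_le_mul_of_nonneg_right (D.g_add_le t x) h3.1
    linarith
  obtain ⟨w, hw, hvw⟩ := exists_isPosBdd (by positivity) hlow hC
  refine ⟨w, hw, ?_⟩
  filter_upwards [heq, hvw] with x hx hx'
  rw [← hx', hx]
  have : ∫ y, D.k x y * w y ∂μ = ∫ y, D.k x y * (v y).re ∂μ := by
    refine integral_congr_ae ?_
    filter_upwards [hvw] with y hy
    rw [← hy]
  linarith

end JumpData
end PeriodicJump
end

noncomputable section

namespace PeriodicJump

/-! ### Duality, simplicity of the eigenvalue and the bordered operator -/

open scoped ComplexOrder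

section Duality

variable {X : Type*} [MeasurableSpace X] {μ : Measure X} [IsProbabilityMeasure μ]

theorem IsBddKernel.integral_mul_integral {k : X → X → ℝ} {M : ℝ} (hk : IsBddKernel k M)
    {f h : X → ℂ} (hf : Integrable f μ) (hh : Integrable h μ) :
    ∫ x, f x * ∫ y, (k x y : ℂ) * h y ∂μ ∂μ = ∫ y, h y * ∫ x, (k x y : ℂ) * f x ∂μ ∂μ := by
  have hint : Integrable (Function.uncurry fun x y => (k x y : ℂ) * (f x * h y)) (μ.prod μ) := by
    refine (hf.mul_prod hh).bdd_mul (c := M)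
      (Complex.measurable_ofReal.comp hk.measurable).aestronglyMeasurable (ae_of_all _ fun q => ?_)
    simpa using hk.bound q.1 q.2
  have h1 := integral_integral_swap hint
  calc _ = ∫ x, ∫ y, (k x y : ℂ) * (f x * h y) ∂μ ∂μ := by
        refine integral_congr_ae (ae_of_all _ fun x => ?_)
        simp only [← integral_const_mul]
        exact integral_congr_ae (ae_of_all _ fun y => by ring)
    _ = _ := h1
    _ = _ := by
        refine integral_congr_ae (ae_of_all _ fun x => ?_)
        simp only [← integral_const_mul]
        exact integral_congr_ae (ae_of_all _ fun y => by ring)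

theorem IsBddKernel.integral_mul_integral_real {k : X → X → ℝ} {M : ℝ} (hk : IsBddKernel k M)
    {f h : X → ℝ} (hf : Integrable f μ) (hh : Integrable h μ) :
    ∫ x, f x * ∫ y, k x y * h y ∂μ ∂μ = ∫ y, h y * ∫ x, k x y * f x ∂μ ∂μ := by
  have h1 := hk.integral_mul_integral (μ := μ) hf.ofReal hh.ofReal
  simp only [← Complex.ofReal_mul, integral_complex_ofReal, Complex.coe_algebraMap] at h1
  exact_mod_cast h1

theorem kerOp_transpose {k : X → X → ℝ} {M : ℝ} (hk : IsBddKernel k M) :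
    kerOp μ (fun x y => k y x) = ContinuousLinearMap.adjoint (kerOp μ k) := by
  rw [ContinuousLinearMap.eq_adjoint_iff]
  intro v w
  rw [L2.inner_def, L2.inner_def]
  have hv : Integrable (fun x => (starRingEnd ℂ) (v x)) μ :=
    (integrable_of_L2 v).mono
      (Complex.continuous_conj.comp_aestronglyMeasurable (Lp.aestronglyMeasurable v))
      (ae_of_all _ fun x => by simp)
  calc _ = ∫ x, w x * ∫ y, (k y x : ℂ) * (starRingEnd ℂ) (v y) ∂μ ∂μ := by
        refine integral_congr_ae ?_
        filter_upwards [kerOp_apply hk.transpose v] with x hx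
        rw [RCLike.inner_apply, hx, ← integral_conj]
        simp
    _ = ∫ y, (starRingEnd ℂ) (v y) * ∫ x, (k y x : ℂ) * w x ∂μ ∂μ :=
        (hk.transpose.integral_mul_integral (integrable_of_L2 w) hv)
    _ = _ := by
        refine integral_congr_ae ?_
        filter_upwards [kerOp_apply hk w] with x hx
        rw [RCLike.inner_apply, hx, mul_comm]

theorem mulOp_adjoint {g : X → ℝ} {C : ℝ} (hg : Measurable fun x => (g x : ℂ))
    (hC : ∀ x, ‖(g x : ℂ)‖ ≤ C) :
    mulOp μ (fun x => (g x : ℂ)) = ContinuousLinearMap.adjoint (mulOp μ fun x => (g x : ℂ)) := by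
  rw [ContinuousLinearMap.eq_adjoint_iff]
  intro v w
  rw [L2.inner_def, L2.inner_def]
  refine integral_congr_ae ?_
  filter_upwards [mulOp_apply hg hC v, mulOp_apply hg hC w] with x h1 h2
  rw [RCLike.inner_apply, RCLike.inner_apply, h1, h2, map_mul, Complex.conj_ofReal]
  ring

/-- The constant function one. -/
def oneL2 (μ : Measure X) [IsProbabilityMeasure μ] : Lp ℂ 2 μ :=
  bddL2 (fun _ => (1 : ℝ)) (memLp_const 1)

theorem oneL2_apply : oneL2 μ =ᵐ[μ] fun _ => (1 : ℂ) := by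
  filter_upwards [bddL2_apply (μ := μ) (f := fun _ => (1 : ℝ)) (memLp_const 1)] with x hx
  rw [oneL2, hx, Complex.ofReal_one]

theorem oneL2_nonneg : 0 ≤ oneL2 μ := bddL2_nonneg _ (ae_of_all _ fun _ => zero_le_one)

theorem oneL2_ne_zero : oneL2 μ ≠ 0 := fun h => by
  have h1 := oneL2_apply (μ := μ)
  rw [h] at h1
  obtain ⟨x, hx1, hx2⟩ := ((Lp.coeFn_zero ℂ 2 μ).and h1).exists
  rw [hx1] at hx2
  simp at hx2

theorem inner_oneL2 (v : Lp ℂ 2 μ) : ⟪oneL2 μ, v⟫_ℂ = ∫ x, v x ∂μ := by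
  rw [L2.inner_def]
  refine integral_congr_ae ?_
  filter_upwards [oneL2_apply (μ := μ)] with x hx
  rw [hx, RCLike.inner_apply, map_one, mul_one]

theorem isBddKernel_one : IsBddKernel (fun _ _ : X => (1 : ℝ)) 1 :=
  ⟨measurable_const, fun _ _ => by simp⟩

theorem kerOp_one (v : Lp ℂ 2 μ) : kerOp μ (fun _ _ => (1 : ℝ)) v = (∫ x, v x ∂μ) • oneL2 μ := by
  ext
  filter_upwards [kerOp_apply isBddKernel_one v, oneL2_apply (μ := μ),
    Lp.coeFn_smul (∫ x, v x ∂μ) (oneL2 μ)] with x h1 h2 h3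
  rw [h1, h3, Pi.smul_apply, h2]
  simp

end Duality

namespace JumpData

variable {X : Type*} [MeasurableSpace X] {μ : Measure X} [IsProbabilityMeasure μ]
  (D : JumpData μ)

/-- The generator with the transposed kernel. -/
def transpose : JumpData μ where
  k x y := D.k y x
  g := D.g
  M := D.M
  m := D.m
  g₀ := D.g₀
  Cg := D.Cg
  bdd := D.bdd.transpose
  nonneg x y := D.nonneg y x
  m_pos := D.m_pos
  row := D.col
  col := D.row
  irred E hE h := by
    rw [lintegral_lintegral_swap] at h
    · rw [← compl_compl E] at h
      simpa [or_comm] using D.irred Eᶜ hE.compl (by simpa using h)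
    · exact (D.bdd.measurable.comp measurable_swap).ennreal_ofReal.aemeasurable
  measurable_g := D.measurable_g
  g_le := D.g_le
  g₀_le := D.g₀_le
  g₀_inf := D.g₀_inf

theorem transpose_op : D.transpose.op = star D.op := by
  rw [op, op, star_sub, ContinuousLinearMap.star_eq_adjoint, ContinuousLinearMap.star_eq_adjoint,
    ← mulOp_adjoint D.measurable_gC D.norm_gC_le, ← kerOp_transpose D.bdd]
  rfl

theorem transpose_s : D.transpose.s = D.s := by
  rw [s, s, transpose_op, spectrum.map_star]
  congr 1
  ext r
  constructor
  · rintro ⟨z, hz, rfl⟩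
    exact ⟨star z, hz, by simp⟩
  · rintro ⟨z, hz, rfl⟩
    exact ⟨star z, by simpa using hz, by simp⟩

/-- The transposed data satisfy the same axioms, and their generator is the adjoint. Its spectrum is
the complex conjugate one, so the spectral bound is unchanged and the right eigenfunction of the
transpose serves. -/
theorem exists_left_eigenfunction (hs : -D.g₀ < D.s) :
    ∃ u, IsPosBdd u ∧ ∀ᵐ y ∂μ, ∫ x, D.k x y * u x ∂μ = (D.s + D.g y) * u y := by
  obtain ⟨⟨u, hu, h⟩, -⟩ := D.transpose.exists_eigenfunction (by rw [transpose_s]; exact hs)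
  rw [transpose_s] at h
  exact ⟨u, hu, h⟩

theorem IsPosBdd.integrable {u : X → ℝ} (hu : IsPosBdd u) : Integrable u μ := by
  obtain ⟨δ, hδ, C, h⟩ := hu.exists_bounds
  refine Integrable.of_bound hu.measurable.aestronglyMeasurable C (ae_of_all _ fun x => ?_)
  rw [Real.norm_of_nonneg (hδ.le.trans (h x).1)]
  exact (h x).2

theorem IsPosBdd.memLp {u : X → ℝ} (hu : IsPosBdd u) : MemLp u 2 μ := by
  obtain ⟨δ, hδ, C, h⟩ := hu.exists_bounds
  refine MemLp.of_bound hu.measurable.aestronglyMeasurable C (ae_of_all _ fun x => ?_)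
  rw [Real.norm_of_nonneg (hδ.le.trans (h x).1)]
  exact (h x).2

theorem IsPosBdd.pos {u : X → ℝ} (hu : IsPosBdd u) (x : X) : 0 < u x := by
  obtain ⟨δ, hδ, C, h⟩ := hu.exists_bounds
  exact hδ.trans_le (h x).1

theorem IsPosBdd.integral_pos {u : X → ℝ} (hu : IsPosBdd u) : 0 < ∫ x, u x ∂μ := by
  obtain ⟨δ, hδ, C, h⟩ := hu.exists_bounds
  have := integral_mono (integrable_const δ) (hu.integrable (μ := μ)) fun x => (h x).1
  simp at this
  linarith

/-- An eigenfunction of the kernel equation, as an eigenvector of the operator. -/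
theorem op_bddL2 {u : X → ℝ} (hu : MemLp u 2 μ) (h0 : ∀ᵐ x ∂μ, 0 ≤ u x) {t : ℝ}
    (h : ∀ᵐ x ∂μ, ∫ y, D.k x y * u y ∂μ = (t + D.g x) * u x) :
    D.op (bddL2 u hu) = (t : ℂ) • bddL2 u hu := by
  rw [D.op_eq_smul_iff (bddL2_nonneg hu h0)]
  filter_upwards [h, bddL2_apply hu] with x hx hx'
  rw [hx', Complex.ofReal_re, ← hx]
  refine integral_congr_ae ?_
  filter_upwards [bddL2_apply hu] with y hy
  rw [hy, Complex.ofReal_re]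

/-- The eigenvalue `s` is simple. -/
theorem real_eigenfunction_eq_zero (hs : -D.g₀ < D.s) {f : X → ℝ} (hfm : Measurable f)
    (hf : MemLp f 2 μ) (h : ∀ᵐ x ∂μ, ∫ y, D.k x y * f y ∂μ = (D.s + D.g x) * f x)
    (h0 : ∫ x, f x ∂μ = 0) : f =ᵐ[μ] 0 := by
  have hfi : Integrable f μ := hf.integrable (by norm_num)
  have hfabs : MemLp (fun x => |f x|) 2 μ := hf.norm
  have hnn : 0 ≤ bddL2 _ hfabs := bddL2_nonneg hfabs (ae_of_all _ fun x => abs_nonneg _)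
  have hval : ∀ x, ∫ y, D.k x y * (bddL2 _ hfabs y).re ∂μ = ∫ y, D.k x y * |f y| ∂μ := fun x => by
    refine integral_congr_ae ?_
    filter_upwards [bddL2_apply hfabs] with y hy
    rw [hy, Complex.ofReal_re]
  -- As in the Kato argument, `|f|` is a subsolution at `s`, hence an eigenfunction.
  have habs : ∀ᵐ x ∂μ, ∫ y, D.k x y * |f y| ∂μ = (D.s + D.g x) * |f x| := by
    have h1 := D.op_eq_of_subsolution hs hnn (by
      rw [D.sub_smul_nonneg_iff hnn]
      filter_upwards [h, bddL2_apply hfabs] with x hx hx'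
      rw [hval, hx', Complex.ofReal_re]
      have h2 : 0 ≤ D.s + D.g x := by linarith [D.g₀_le x]
      rw [← abs_of_nonneg h2, ← abs_mul, ← hx]
      refine (abs_integral_le_integral_abs).trans_eq ?_
      refine integral_congr_ae (ae_of_all _ fun y => ?_)
      simp only [abs_mul, abs_of_nonneg (D.nonneg x y)])
    filter_upwards [(D.op_eq_smul_iff hnn _).1 h1, bddL2_apply hfabs] with x hx hx'
    rwa [hval, hx', Complex.ofReal_re] at hx
  -- `|f| + f` is a nonnegative eigenfunction, so it either vanishes or is positive almost
  -- everywhere. Thus `f` has a constant sign, and its zero mean makes it vanish.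
  by_cases hp : (fun x => |f x| + f x) =ᵐ[μ] 0
  · have h1 : 0 ≤ᵐ[μ] fun x => -f x := by
      filter_upwards [hp] with x hx
      have h2 : |f x| + f x = 0 := hx
      have := abs_nonneg (f x)
      simp only [Pi.zero_apply]
      linarith
    have h2 := (integral_eq_zero_iff_of_nonneg_ae h1 hfi.neg).1 (by rw [integral_neg, h0, neg_zero])
    filter_upwards [h2] with x hx
    simpa using hx
  · have h1 := D.ae_pos_of_integral_le (f := fun x => |f x| + f x) (c := |D.s| + |D.Cg| + 1) (hfm.abs.add hfm)
      (hfi.abs.add hfi) (ae_of_all _ fun x => by linarith [neg_abs_le (f x)]) hp (by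
        filter_upwards [h, habs] with x h1 h2
        have h3 : ∫ y, D.k x y * (|f y| + f y) ∂μ = (D.s + D.g x) * (|f x| + f x) := by
          simp only [mul_add]
          rw [integral_add (D.integrable_k_mul x hfi.abs) (D.integrable_k_mul x hfi), h1, h2]
        rw [h3]
        exact mul_le_mul_of_nonneg_right (D.g_add_le _ x) (by linarith [neg_abs_le (f x)]))
    have h2 : 0 ≤ᵐ[μ] f := by
      filter_upwards [h1] with x hx
      by_contra hneg
      rw [abs_of_neg (not_le.1 hneg)] at hx
      linarith
    exact (integral_eq_zero_iff_of_nonneg_ae h2 hfi).1 h0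

theorem eigenvector_eq_zero (hs : -D.g₀ < D.s) {v : Lp ℂ 2 μ}
    (hv : D.op v = (D.s : ℂ) • v) (h0 : ∫ x, v x ∂μ = 0) : v = 0 := by
  have hvi := integrable_of_L2 v
  have heq : ∀ᵐ x ∂μ, ∫ y, (D.k x y : ℂ) * v y ∂μ = ((D.s + D.g x : ℝ) : ℂ) * v x := by
    filter_upwards [D.op_apply v, Lp.coeFn_smul (D.s : ℂ) v] with x h1 h2
    rw [hv, h2, Pi.smul_apply, smul_eq_mul] at h1
    push_cast
    linear_combination -h1
  have hre : (fun x => (v x).re) =ᵐ[μ] 0 := by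
    refine D.real_eigenfunction_eq_zero hs (measurable_re_coe v) (Lp.memLp v).re ?_ ?_
    · filter_upwards [heq] with x hx
      have h1 := integral_re (D.bdd.integrable_mul x hvi)
      simp only [RCLike.re_eq_complex_re, Complex.re_ofReal_mul] at h1
      rw [h1, hx, Complex.re_ofReal_mul]
    · have h1 := integral_re hvi
      simp only [RCLike.re_eq_complex_re] at h1
      rw [h1, h0, Complex.zero_re]
  have him : (fun x => (v x).im) =ᵐ[μ] 0 := by
    refine D.real_eigenfunction_eq_zero hs
      (Complex.measurable_im.comp (Lp.stronglyMeasurable v).measurable) (Lp.memLp v).im ?_ ?_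
    · filter_upwards [heq] with x hx
      have h1 := integral_im (D.bdd.integrable_mul x hvi)
      simp only [RCLike.im_eq_complex_im, Complex.im_ofReal_mul] at h1
      rw [h1, hx, Complex.im_ofReal_mul]
    · have h1 := integral_im hvi
      simp only [RCLike.im_eq_complex_im] at h1
      rw [h1, h0, Complex.zero_im]
  refine Lp.ext ?_
  filter_upwards [hre, him, Lp.coeFn_zero ℂ 2 μ] with x h1 h2 h3
  rw [h3]
  exact Complex.ext h1 h2

theorem integral_left_eigenfunction_mul {u : X → ℝ} (hu : IsPosBdd u)
    (h : ∀ᵐ y ∂μ, ∫ x, D.k x y * u x ∂μ = (D.s + D.g y) * u y) (v : Lp ℂ 2 μ) :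
    ∫ x, (u x : ℂ) * ((D.s : ℂ) • v - D.op v : Lp ℂ 2 μ) x ∂μ = 0 := by
  have hvi := integrable_of_L2 v
  have h1 := D.bdd.integral_mul_integral (μ := μ) hu.integrable.ofReal hvi
  have hub : ∃ C, ∀ x, ‖(u x : ℂ)‖ ≤ C := by
    obtain ⟨δ, hδ, C, hb⟩ := hu.exists_bounds
    refine ⟨C, fun x => ?_⟩
    rw [Complex.norm_real, Real.norm_of_nonneg (hu.pos x).le]
    exact (hb x).2
  obtain ⟨C, hC⟩ := hub
  have hum : AEStronglyMeasurable (fun x => (u x : ℂ)) μ :=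
    (Complex.measurable_ofReal.comp hu.measurable).aestronglyMeasurable
  have hi1 : Integrable (fun x => (u x : ℂ) * (((D.s + D.g x : ℝ) : ℂ) * v x)) μ := by
    refine (hvi.bdd_mul (c := |D.s| + D.Cg) ?_ (ae_of_all _ fun x => ?_)).bdd_mul hum
      (ae_of_all _ hC)
    · exact (Complex.measurable_ofReal.comp (D.measurable_g.const_add _)).aestronglyMeasurable
    · rw [Complex.norm_real]
      exact (norm_add_le _ _).trans (add_le_add le_rfl (D.g_le x))
  have hi2 : Integrable (fun x => (u x : ℂ) * ∫ y, (D.k x y : ℂ) * v y ∂μ) μ := by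
    refine ((D.bdd.memLp v).integrable (by norm_num)).bdd_mul hum (ae_of_all _ hC)
  calc _ = ∫ x, ((u x : ℂ) * (((D.s + D.g x : ℝ) : ℂ) * v x) -
        (u x : ℂ) * ∫ y, (D.k x y : ℂ) * v y ∂μ) ∂μ := by
        refine integral_congr_ae ?_
        filter_upwards [D.op_apply v, Lp.coeFn_sub ((D.s : ℂ) • v) (D.op v),
          Lp.coeFn_smul (D.s : ℂ) v] with x h2 h3 h4
        rw [h3, Pi.sub_apply, h4, Pi.smul_apply, h2, smul_eq_mul]
        push_cast
        ring
    _ = 0 := by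
        rw [integral_sub hi1 hi2, sub_eq_zero]
        refine Eq.trans ?_ h1.symm
        refine integral_congr_ae ?_
        filter_upwards [h] with x hx
        have h2 : ∫ y, (D.k y x : ℂ) * (u y : ℂ) ∂μ = (((D.s + D.g x) * u x : ℝ) : ℂ) := by
          rw [← hx, ← integral_complex_ofReal]
          simp
        change _ = v x * ∫ y, (D.k y x : ℂ) * (u y : ℂ) ∂μ
        rw [h2]
        push_cast
        ring

/-- The generator minus a scalar, perturbed by the rank one projection to the constants. -/
def bordered (z : ℂ) : Lp ℂ 2 μ →L[ℂ] Lp ℂ 2 μ := z • 1 - D.op + kerOp μ fun _ _ => (1 : ℝ)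

theorem bordered_apply (z : ℂ) (v : Lp ℂ 2 μ) :
    D.bordered z v = (z • v - D.op v) + (∫ x, v x ∂μ) • oneL2 μ := by
  rw [bordered, add_apply, kerOp_one, sub_apply, smul_apply, one_apply_eq_self]

/-- Pairing the bordered operator with the left eigenfunction. -/
theorem integral_left_mul_bordered {u : X → ℝ} (hu : IsPosBdd u)
    (h : ∀ᵐ y ∂μ, ∫ x, D.k x y * u x ∂μ = (D.s + D.g y) * u y) (v : Lp ℂ 2 μ) :
    ∫ x, (u x : ℂ) * (D.bordered D.s v : Lp ℂ 2 μ) x ∂μ =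
      (∫ x, v x ∂μ) * ((∫ x, u x ∂μ : ℝ) : ℂ) := by
  have hub : ∃ C, ∀ x, ‖(u x : ℂ)‖ ≤ C := by
    obtain ⟨δ, hδ, C, hb⟩ := hu.exists_bounds
    refine ⟨C, fun x => ?_⟩
    rw [Complex.norm_real, Real.norm_of_nonneg (hu.pos x).le]
    exact (hb x).2
  obtain ⟨C, hC⟩ := hub
  have hum : AEStronglyMeasurable (fun x => (u x : ℂ)) μ :=
    (Complex.measurable_ofReal.comp hu.measurable).aestronglyMeasurable
  have hui : Integrable (fun x => (u x : ℂ)) μ := hu.integrable.ofReal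
  have hi1 : Integrable (fun x => (u x : ℂ) * ((D.s : ℂ) • v - D.op v : Lp ℂ 2 μ) x) μ :=
    (integrable_of_L2 _).bdd_mul hum (ae_of_all _ hC)
  calc _ = ∫ x, ((u x : ℂ) * ((D.s : ℂ) • v - D.op v : Lp ℂ 2 μ) x + (∫ x, v x ∂μ) * u x) ∂μ := by
        refine integral_congr_ae ?_
        filter_upwards [Lp.coeFn_add ((D.s : ℂ) • v - D.op v) ((∫ x, v x ∂μ) • oneL2 μ),
          Lp.coeFn_smul (∫ x, v x ∂μ) (oneL2 μ), oneL2_apply (μ := μ)] with x h1 h2 h3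
        rw [bordered_apply, h1, Pi.add_apply, h2, Pi.smul_apply, h3, smul_eq_mul]
        ring
    _ = _ := by
        rw [integral_add hi1 (hui.const_mul _), D.integral_left_eigenfunction_mul hu h,
          integral_const_mul, integral_complex_ofReal, zero_add]

/-- By the Fredholm alternative injectivity is enough. Pairing an element of the kernel with the
left eigenfunction shows that it has mean zero; it is then an eigenvector at `s` of mean zero, and
simplicity excludes it unless it is zero. -/
theorem isUnit_bordered (hs : -D.g₀ < D.s) : IsUnit (D.bordered D.s) := by
  -- The rank one term is absorbed into the kernel, which becomes `k - 1`. It may be negative, which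
  -- the Fredholm alternative allows.
  have hk : IsBddKernel (fun x y => D.k x y + (-1) * (1 : ℝ)) (D.M + |(-1 : ℝ)| * 1) := by
    refine ⟨D.bdd.measurable.add_const _, fun x y => (abs_add_le _ _).trans ?_⟩
    refine add_le_add (D.bdd.bound x y) (by simp)
  have hop : kerOp μ (fun x y => D.k x y + (-1) * (1 : ℝ)) =
      kerOp μ D.k - kerOp μ fun _ _ => (1 : ℝ) := by
    rw [kerOp_add D.bdd (isBddKernel_one.const_mul (-1)), kerOp_const_mul isBddKernel_one]
    module
  have e : ((D.s : ℝ) : ℂ) • (1 : Lp ℂ 2 μ →L[ℂ] Lp ℂ 2 μ) + mulOp μ (fun x => (D.g x : ℂ)) -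
      kerOp μ (fun x y => D.k x y + (-1) * (1 : ℝ)) = D.bordered D.s := by
    rw [hop, bordered, op]
    abel
  rw [← e]
  refine D.isUnit_of_injective hk (by simpa using hs) fun v hv => ?_
  obtain ⟨u, hu, hul⟩ := D.exists_left_eigenfunction hs
  have hb : D.bordered D.s v = 0 := by
    rw [← e, sub_apply, add_apply, smul_apply, one_apply_eq_self, ← hv]
    abel
  have h1 := D.integral_left_mul_bordered hu hul v
  rw [hb] at h1
  have h2 : ∫ x, (u x : ℂ) * (0 : Lp ℂ 2 μ) x ∂μ = 0 := by
    refine integral_eq_zero_of_ae ?_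
    filter_upwards [Lp.coeFn_zero ℂ 2 μ] with x hx
    rw [hx]; simp
  rw [h2] at h1
  have h3 : ∫ x, v x ∂μ = 0 := by
    refine (mul_eq_zero.1 h1.symm).resolve_right ?_
    exact_mod_cast (hu.integral_pos (μ := μ)).ne'
  refine D.eigenvector_eq_zero hs ?_ h3
  rw [bordered_apply, h3, zero_smul, add_zero, sub_eq_zero] at hb
  exact hb.symm

/-- When the bordered operator is invertible, its inverse maps `1` to the normalized positive
eigenfunction. -/
theorem inverse_bordered_one (hs : -D.g₀ < D.s) :
    ∃ (u : X → ℝ) (hu : IsPosBdd u), ∫ x, u x ∂μ = 1 ∧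
      Ring.inverse (D.bordered D.s) (oneL2 μ) = bddL2 u hu.memLp := by
  obtain ⟨⟨u, hu, hue⟩, -⟩ := D.exists_eigenfunction hs
  have hI := hu.integral_pos (μ := μ)
  set c : ℝ := (∫ x, u x ∂μ)⁻¹
  have hc : 0 < c := inv_pos.2 hI
  have hcu : IsPosBdd fun x => c * u x := by
    refine ⟨hu.measurable.const_mul c, ?_⟩
    obtain ⟨δ, hδ, C, hb⟩ := hu.exists_bounds
    exact ⟨c * δ, by positivity, c * C, fun x =>
      ⟨mul_le_mul_of_nonneg_left (hb x).1 hc.le, mul_le_mul_of_nonneg_left (hb x).2 hc.le⟩⟩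
  have hint : ∫ x, c * u x ∂μ = 1 := by
    rw [integral_const_mul, inv_mul_cancel₀ hI.ne']
  refine ⟨_, hcu, hint, ?_⟩
  have hop : D.op (bddL2 _ hcu.memLp) = (D.s : ℂ) • bddL2 _ hcu.memLp := by
    refine D.op_bddL2 _ (ae_of_all _ fun x => (hcu.pos x).le) ?_
    filter_upwards [hue] with x hx
    have : ∫ y, D.k x y * (c * u y) ∂μ = c * ∫ y, D.k x y * u y ∂μ := by
      rw [← integral_const_mul]
      exact integral_congr_ae (ae_of_all _ fun y => by ring)
    rw [this, hx]
    ring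
  have hb : D.bordered D.s (bddL2 _ hcu.memLp) = oneL2 μ := by
    have h1 : ∫ x, bddL2 _ (hcu.memLp (μ := μ)) x ∂μ = 1 := by
      rw [integral_congr_ae (bddL2_apply hcu.memLp), integral_complex_ofReal, hint,
        Complex.ofReal_one]
    rw [bordered_apply, hop, sub_self, zero_add, h1, one_smul]
  rw [← hb, ← mul_apply_eq_comp, Ring.inverse_mul_cancel _ (D.isUnit_bordered hs),
    one_apply_eq_self]

/-- The scalar equation satisfied by `s`: the mean of the normalized eigenfunction is one. -/
theorem re_inner_inverse_bordered (hs : -D.g₀ < D.s) :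
    (⟪oneL2 μ, Ring.inverse (D.bordered D.s) (oneL2 μ)⟫_ℂ).re = 1 := by
  obtain ⟨u, hu, hint, h⟩ := D.inverse_bordered_one hs
  rw [h, inner_oneL2, integral_congr_ae (bddL2_apply hu.memLp), integral_complex_ofReal, hint]
  simp

/-- Up to sign this is the derivative of the scalar equation in the spectral parameter. With `u` the
normalized right and `u'` the left eigenfunction, pairing with `u'` evaluates it as `∫ u' u / ∫ u'`.
-/
theorem re_inner_inverse_sq_bordered_pos (hs : -D.g₀ < D.s) :
    0 < (⟪oneL2 μ, Ring.inverse (D.bordered D.s)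
      (Ring.inverse (D.bordered D.s) (oneL2 μ))⟫_ℂ).re := by
  obtain ⟨u, hu, hint, h⟩ := D.inverse_bordered_one hs
  obtain ⟨u', hu', hul⟩ := D.exists_left_eigenfunction hs
  have h1 := D.integral_left_mul_bordered hu' hul
    (Ring.inverse (D.bordered D.s) (Ring.inverse (D.bordered D.s) (oneL2 μ)))
  rw [← mul_apply_eq_comp, Ring.mul_inverse_cancel _ (D.isUnit_bordered hs), one_apply_eq_self,
    ← inner_oneL2] at h1
  have h2 : ∫ x, (u' x : ℂ) * (Ring.inverse (D.bordered D.s) (oneL2 μ) : Lp ℂ 2 μ) x ∂μ =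
      ((∫ x, u' x * u x ∂μ : ℝ) : ℂ) := by
    rw [← integral_complex_ofReal]
    refine integral_congr_ae ?_
    filter_upwards [bddL2_apply (μ := μ) hu.memLp] with x hx
    rw [h, hx, Complex.ofReal_mul]
  rw [h2] at h1
  have h3 := congrArg Complex.re h1
  rw [Complex.ofReal_re, Complex.re_mul_ofReal] at h3
  have h4 : 0 < ∫ x, u' x * u x ∂μ := by
    have : IsPosBdd fun x => u' x * u x := by
      refine ⟨hu'.measurable.mul hu.measurable, ?_⟩
      obtain ⟨δ, hδ, C, hb⟩ := hu.exists_bounds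
      obtain ⟨δ', hδ', C', hb'⟩ := hu'.exists_bounds
      exact ⟨δ' * δ, by positivity, C' * C, fun x =>
        ⟨mul_le_mul (hb' x).1 (hb x).1 hδ.le (hu'.pos x).le,
          mul_le_mul (hb' x).2 (hb x).2 (hu.pos x).le ((hu'.pos x).le.trans (hb' x).2)⟩⟩
    exact this.integral_pos
  rw [h3] at h4
  exact pos_of_mul_pos_left h4 (hu'.integral_pos (μ := μ)).le

end JumpData
end PeriodicJump
end

noncomputable section

namespace PeriodicJump

/-! ### Unfolding `ℝ^d` over the torus and lattice sums -/

section Unfolding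

variable {d : ℕ}

instance isProbabilityMeasure_unitAddCircle :
    IsProbabilityMeasure (volume : Measure UnitAddCircle) :=
  ⟨UnitAddCircle.measure_univ⟩

instance isProbabilityMeasure_torus : IsProbabilityMeasure (volume : Measure (Torus d)) := by
  rw [volume_pi]
  infer_instance

theorem map_equivIco_volume :
    MeasurePreserving (fun s : UnitAddCircle => (AddCircle.equivIco (1 : ℝ) 0 s : ℝ))
      volume (volume.restrict (Ico 0 1)) := by
  have hm : Measurable (fun s : UnitAddCircle => (AddCircle.equivIco (1 : ℝ) 0 s : ℝ)) :=
    measurable_subtype_coe.comp (AddCircle.measurableEquivIco (1 : ℝ) 0).measurable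
  refine ⟨hm, ?_⟩
  have h1 := (AddCircle.measurePreserving_mk (1 : ℝ) 0).map_eq
  rw [zero_add] at h1
  rw [← h1, Measure.map_map hm AddCircle.measurable_mk',
    Measure.restrict_congr_set (Ico_ae_eq_Ioc (μ := volume) (a := (0 : ℝ)) (b := 1)).symm]
  have h2 : (fun s : UnitAddCircle => (AddCircle.equivIco (1 : ℝ) 0 s : ℝ)) ∘
      ((↑) : ℝ → UnitAddCircle) =ᵐ[volume.restrict (Ico (0 : ℝ) 1)] id := by
    rw [Filter.EventuallyEq, ae_restrict_iff' measurableSet_Ico]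
    refine ae_of_all _ fun x hx => ?_
    have hx' : x ∈ Ico (0 : ℝ) (0 + 1) := by simpa using hx
    simp [AddCircle.equivIco_coe_eq hx']
  rw [Measure.map_congr h2, Measure.map_id]

/-- The cell `j + [0,1)^d`. -/
def cell (j : Fin d → ℤ) : Set (Space d) := {x | ∀ i, x i ∈ Ico (j i : ℝ) (j i + 1)}

theorem measurableSet_cell (j : Fin d → ℤ) : MeasurableSet (cell j) := by
  rw [cell, ofPred_forall]
  exact MeasurableSet.iInter fun i => measurableSet_Ico.preimage (by fun_prop)

theorem measurePreserving_rep :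
    MeasurePreserving (rep : Torus d → Space d) volume (volume.restrict (cell 0)) := by
  have h1 : MeasurePreserving
      (fun (s : Torus d) (i : Fin d) => (AddCircle.equivIco (1 : ℝ) 0 (s i) : ℝ)) volume
      (volume.restrict (univ.pi fun _ => Ico (0 : ℝ) 1)) := by
    rw [volume_pi, volume_pi, Measure.restrict_pi_pi]
    exact measurePreserving_pi _ _ fun _ => map_equivIco_volume
  have h2 : MeasurePreserving (WithLp.toLp 2 : (Fin d → ℝ) → Space d)
      (volume.restrict (univ.pi fun _ => Ico (0 : ℝ) 1)) (volume.restrict (cell 0)) := by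
    have h3 := (PiLp.volume_preserving_toLp (Fin d)).restrict_preimage (measurableSet_cell (0 : Fin d → ℤ))
    have e : (WithLp.toLp 2 : (Fin d → ℝ) → Space d) ⁻¹' cell 0 = univ.pi fun _ => Ico (0 : ℝ) 1 := by
      ext x
      simp [cell]
    rw [e] at h3
    exact h3
  exact h2.comp h1

theorem measurePreserving_rep_add (j : Fin d → ℤ) :
    MeasurePreserving (fun t : Torus d => rep t + latticeVec j) volume
      (volume.restrict (cell j)) := by
  have h1 : MeasurePreserving (fun x : Space d => x + latticeVec j) volume volume :=
    measurePreserving_add_right _ _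
  have h2 := h1.restrict_preimage (measurableSet_cell j)
  have h3 : (fun x : Space d => x + latticeVec j) ⁻¹' cell j = cell 0 := by
    ext x
    simp only [cell, latticeVec, mem_preimage, mem_ofPred_eq, PiLp.add_apply, mem_Ico,
      Pi.zero_apply, Int.cast_zero, zero_add]
    refine forall_congr' fun i => ?_
    constructor <;> rintro ⟨h, h'⟩ <;> constructor <;> linarith
  rw [h3] at h2
  exact h2.comp measurePreserving_rep

theorem pairwise_disjoint_cell : Pairwise (Function.onFun Disjoint (cell (d := d))) := by
  intro j j' hjj
  rw [Function.onFun, Set.disjoint_left]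
  intro x hx hx'
  refine hjj (funext fun i => ?_)
  have h1 := Int.floor_eq_iff.2 (hx i)
  have h2 := Int.floor_eq_iff.2 (hx' i)
  exact h1.symm.trans h2

theorem iUnion_cell : ⋃ j, cell (d := d) j = univ :=
  eq_univ_of_forall fun x => mem_iUnion.2 ⟨fun i => ⌊x i⌋, fun _ =>
    ⟨Int.floor_le _, Int.lt_floor_add_one _⟩⟩

/-- The unfolding of the torus. -/
def unfold (q : Torus d × (Fin d → ℤ)) : Space d := rep q.1 + latticeVec q.2

theorem measurable_unfold : Measurable (unfold (d := d)) :=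
  measurable_from_prod_countable_left fun j =>
    (Environment.measurable_rep.add_const (latticeVec j) : Measurable fun t : Torus d => rep t + latticeVec j)

/-- The cells `j + [0,1)^d` tile `ℝ^d`, and on the copy of the torus with index `j` the map is a
measure preserving bijection to the cell `j` up to null sets. -/
theorem measurePreserving_unfold :
    MeasurePreserving (unfold (d := d)) ((volume : Measure (Torus d)).prod Measure.count) volume := by
  refine ⟨measurable_unfold, ?_⟩
  rw [Measure.count, Measure.prod_sum_right, Measure.map_sum measurable_unfold.aemeasurable]
  have h1 : ∀ j : Fin d → ℤ, ((volume : Measure (Torus d)).prod (Measure.dirac j)).map unfold =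
      volume.restrict (cell j) := by
    intro j
    rw [Measure.prod_dirac, Measure.map_map measurable_unfold (by fun_prop)]
    exact (measurePreserving_rep_add j).map_eq
  simp_rw [h1]
  rw [← Measure.restrict_iUnion pairwise_disjoint_cell measurableSet_cell, iUnion_cell,
    Measure.restrict_univ]

theorem lintegral_unfold {f : Space d → ℝ≥0∞} (hf : Measurable f) :
    ∫⁻ y, f y = ∫⁻ t : Torus d, ∑' j, f (rep t + latticeVec j) := by
  rw [← measurePreserving_unfold.lintegral_comp hf,
    lintegral_prod (fun q => f (unfold q)) (hf.comp measurable_unfold).aemeasurable]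
  simp_rw [lintegral_count]
  rfl

theorem integral_unfold {E : Type*} [NormedAddCommGroup E] [NormedSpace ℝ E] [CompleteSpace E]
    {f : Space d → E} (hf : Integrable f) :
    ∫ y, f y = ∫ t : Torus d, ∑' j, f (rep t + latticeVec j) := by
  have h1 : Integrable (fun q => f (unfold q)) ((volume : Measure (Torus d)).prod Measure.count) :=
    measurePreserving_unfold.integrable_comp_of_integrable hf
  have h2 : ∫ y, f y = ∫ q, f (unfold q) ∂((volume : Measure (Torus d)).prod Measure.count) := by
    rw [← measurePreserving_unfold.map_eq] at hf ⊢
    exact integral_map measurable_unfold.aemeasurable hf.aestronglyMeasurable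
  rw [h2, integral_prod _ h1]
  refine integral_congr_ae ?_
  filter_upwards [h1.prod_right_ae] with t ht
  rw [integral_countable ht]
  simp [unfold, measureReal_def]

theorem norm_rep_le (t : Torus d) : ‖rep t‖ ≤ Real.sqrt d := by
  rw [EuclideanSpace.norm_eq]
  refine Real.sqrt_le_sqrt ?_
  calc _ ≤ ∑ _i : Fin d, (1 : ℝ) := Finset.sum_le_sum fun i _ => by
        have h := (AddCircle.equivIco (1 : ℝ) 0 (t i)).2
        have h1 : (rep t) i = (AddCircle.equivIco (1 : ℝ) 0 (t i) : ℝ) := rfl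
        rw [h1, Real.norm_eq_abs, sq_abs]
        have h2 := h.1
        have h3 := h.2
        nlinarith
    _ = d := by simp

theorem integrable_exp_neg_norm : Integrable fun y : Space d => Real.exp (-‖y‖) := by
  set n : ℕ := d + 1
  have hint : Integrable fun z : Space d => n.factorial * Real.exp 1 * (1 + ‖z‖) ^ (-(n : ℝ)) :=
    (integrable_one_add_norm (by simp [n])).const_mul _
  refine hint.mono' (by fun_prop) (ae_of_all _ fun z => ?_)
  rw [Real.norm_of_nonneg (Real.exp_pos _).le, Real.rpow_neg (by positivity), Real.rpow_natCast]
  have h1 := Real.pow_div_factorial_le_exp (1 + ‖z‖) (by positivity) n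
  rw [div_le_iff₀ (by positivity), Real.exp_add] at h1
  rw [Real.exp_neg, ← div_eq_mul_inv, le_div_iff₀ (by positivity), inv_mul_le_iff₀ (Real.exp_pos _)]
  linarith

/-- The lattice sums of `exp (-‖·‖)` are uniformly bounded. -/
theorem exists_tsum_exp_bound : ∃ B : ℝ, 0 ≤ B ∧ ∀ z : Space d,
    ∑' j : Fin d → ℤ, ENNReal.ofReal (Real.exp (-‖z - latticeVec j‖)) ≤ ENNReal.ofReal B := by
  set S := Real.exp (Real.sqrt d)
  set I := ∫⁻ y : Space d, ENNReal.ofReal (Real.exp (-‖y‖))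
  have hI : I ≠ ⊤ := integrable_exp_neg_norm.lintegral_lt_top.ne
  refine ⟨S * I.toReal, by positivity, fun z => ?_⟩
  rw [ENNReal.ofReal_mul (Real.exp_pos _).le, ENNReal.ofReal_toReal hI]
  -- The lattice sum is compared with the integral over `ℝ^d`: within a cell the norm varies by at
  -- most `√d`, which costs the factor `S`, and averaging over the cell unfolds to the integral `I`.
  have h1 : ∫⁻ y : Space d, ENNReal.ofReal (Real.exp (-‖z - y‖)) = I :=
    lintegral_sub_left_eq_self (fun y : Space d => ENNReal.ofReal (Real.exp (-‖y‖))) z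
  rw [lintegral_unfold (by fun_prop)] at h1
  rw [← h1, ← lintegral_const_mul' _ _ ENNReal.ofReal_ne_top]
  calc _ = ∫⁻ _t : Torus d,
        ∑' j : Fin d → ℤ, ENNReal.ofReal (Real.exp (-‖z - latticeVec j‖)) := by
        rw [lintegral_const, measure_univ, mul_one]
    _ ≤ _ := by
      refine lintegral_mono fun t => ?_
      rw [← ENNReal.tsum_mul_left]
      refine ENNReal.tsum_le_tsum fun j => ?_
      rw [← ENNReal.ofReal_mul (Real.exp_pos _).le, ← Real.exp_add]
      refine ENNReal.ofReal_le_ofReal (Real.exp_le_exp.2 ?_)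
      have h2 : ‖z - (rep t + latticeVec j)‖ ≤ ‖z - latticeVec j‖ + ‖rep t‖ := by
        rw [show z - (rep t + latticeVec j) = (z - latticeVec j) - rep t by abel]
        exact norm_sub_le _ _
      linarith [norm_rep_le t]

/-- Measurable functions on `ℝ^d` that decay exponentially. -/
structure HasExpDecay (ω : Space d → ℝ) (C : ℝ) : Prop where
  measurable : Measurable ω
  bound : ∀ z, |ω z| ≤ C * Real.exp (-‖z‖)

/-- The periodization of a function on `ℝ^d`, as a kernel on the torus. -/
def periodize (ω : Space d → ℝ) (s t : Torus d) : ℝ := ∑' j, ω (rep s - (rep t + latticeVec j))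

variable (d) in
/-- A uniform bound of the lattice sums of `exp (-‖·‖)`. -/
def latticeBound : ℝ := (exists_tsum_exp_bound (d := d)).choose

theorem latticeBound_nonneg : 0 ≤ latticeBound d := exists_tsum_exp_bound.choose_spec.1

theorem hasSum_exp_bound (z : Space d) :
    (Summable fun j : Fin d → ℤ => Real.exp (-‖z - latticeVec j‖)) ∧
      ∑' j : Fin d → ℤ, Real.exp (-‖z - latticeVec j‖) ≤ latticeBound d := by
  have h := (exists_tsum_exp_bound (d := d)).choose_spec.2 z
  have hs : Summable fun j : Fin d → ℤ => Real.exp (-‖z - latticeVec j‖) := by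
    have h1 := ENNReal.summable_toReal (h.trans_lt ENNReal.ofReal_lt_top).ne
    simpa [ENNReal.toReal_ofReal (Real.exp_pos _).le] using h1
  refine ⟨hs, ?_⟩
  rw [← ENNReal.ofReal_tsum_of_nonneg (fun _ => (Real.exp_pos _).le) hs] at h
  exact (ENNReal.ofReal_le_ofReal_iff latticeBound_nonneg).1 h

theorem HasExpDecay.summable {ω : Space d → ℝ} {C : ℝ} (h : HasExpDecay ω C) (s t : Torus d) :
    Summable fun j => ω (rep s - (rep t + latticeVec j)) := by
  refine Summable.of_norm_bounded ((hasSum_exp_bound (rep s - rep t)).1.mul_left C) fun j => ?_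
  rw [sub_sub]
  exact h.bound _

theorem HasExpDecay.isBddKernel {ω : Space d → ℝ} {C : ℝ} (h : HasExpDecay ω C) :
    IsBddKernel (periodize ω) (C * latticeBound d) := by
  constructor
  · have hr := Environment.measurable_rep (d := d)
    have hω := h.measurable
    refine Measurable.tsum fun j => ?_
    fun_prop
  · intro s t
    have h1 := hasSum_exp_bound (rep s - rep t)
    have hC : 0 ≤ C := by
      have := (abs_nonneg _).trans (h.bound 0)
      simpa using this
    rw [← Real.norm_eq_abs]
    refine (tsum_of_norm_bounded (h1.1.mul_left C).hasSum fun j => ?_).trans ?_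
    · rw [sub_sub]; exact h.bound _
    · rw [tsum_mul_left]
      exact mul_le_mul_of_nonneg_left h1.2 hC

end Unfolding
end PeriodicJump
end

noncomputable section

namespace PeriodicJump

/-! ### Periodized kernels -/

section Periodization

variable {d : ℕ}

theorem latticeVec_neg (j : Fin d → ℤ) : latticeVec (-j) = -latticeVec j := by
  ext i; simp [latticeVec]

theorem proj_rep_add (t : Torus d) (j : Fin d → ℤ) : proj (rep t + latticeVec j) = t := by
  funext i
  have h : ((rep t i : ℝ) : UnitAddCircle) = t i := congrFun (Environment.proj_rep t) i
  have h2 : ((latticeVec j i : ℝ) : UnitAddCircle) = 0 := by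
    rw [AddCircle.coe_eq_zero_iff]
    exact ⟨j i, by simp [latticeVec]⟩
  simp only [proj, PiLp.add_apply, AddCircle.coe_add, h, h2, add_zero]

theorem exists_rep_proj_add (y : Space d) : ∃ j : Fin d → ℤ, y = rep (proj y) + latticeVec j := by
  have h1 : y ∈ ⋃ j, cell (d := d) j := by rw [iUnion_cell]; trivial
  obtain ⟨j, hj⟩ := mem_iUnion.1 h1
  refine ⟨j, ?_⟩
  ext i
  have h2 : (y i : UnitAddCircle) = ((y i - j i : ℝ) : UnitAddCircle) := by
    rw [AddCircle.coe_sub, eq_comm, sub_eq_self, AddCircle.coe_eq_zero_iff]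
    exact ⟨j i, by simp⟩
  have h3 : y i - j i ∈ Ico (0 : ℝ) (0 + 1) := by
    obtain ⟨h, h'⟩ := hj i
    constructor <;> linarith
  have h4 : rep (proj y) i = (AddCircle.equivIco (1 : ℝ) 0 (y i : UnitAddCircle) : ℝ) := rfl
  have h5 : rep (proj y) i = y i - j i := by
    rw [h4, h2, AddCircle.equivIco_coe_eq h3]
  simp [latticeVec, h5]

variable {ω : Space d → ℝ} {C : ℝ}

/-- The lattice sum and the integral over the torus recombine into an integral over `ℝ^d`, so the
periodized kernel acts by averaging over the translates `s - proj z`. The identity holds at every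
`s`, not only almost everywhere. -/
theorem lintegral_periodize (h : HasExpDecay ω C) (h0 : ∀ z, 0 ≤ ω z) {φ : Torus d → ℝ≥0∞}
    (hφ : Measurable φ) (s : Torus d) :
    ∫⁻ t, ENNReal.ofReal (periodize ω s t) * φ t =
      ∫⁻ z, ENNReal.ofReal (ω z) * φ (s - proj z) := by
  have hω := h.measurable
  have hp := Environment.measurable_proj (d := d)
  have h1 : ∫⁻ z, ENNReal.ofReal (ω z) * φ (s - proj z) =
      ∫⁻ y, ENNReal.ofReal (ω (rep s - y)) * φ (proj y) := by
    rw [← lintegral_sub_left_eq_self _ (rep s)]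
    simp only [Environment.proj_sub, Environment.proj_rep, sub_sub_cancel]
  rw [h1, lintegral_unfold (by fun_prop)]
  refine lintegral_congr fun t => ?_
  simp only [proj_rep_add]
  rw [ENNReal.tsum_mul_right, periodize,
    ENNReal.ofReal_tsum_of_nonneg (fun _ => h0 _) (h.summable s t)]

theorem HasExpDecay.abs (h : HasExpDecay ω C) : HasExpDecay (fun z => |ω z|) C :=
  ⟨h.measurable.abs, fun z => by rw [abs_abs]; exact h.bound z⟩

theorem HasExpDecay.neg_comp (h : HasExpDecay ω C) : HasExpDecay (fun z => ω (-z)) C :=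
  ⟨h.measurable.comp measurable_neg, fun z => by simpa using h.bound (-z)⟩

theorem HasExpDecay.integrable (h : HasExpDecay ω C) : Integrable ω :=
  (integrable_exp_neg_norm.const_mul C).mono' h.measurable.aestronglyMeasurable
    (ae_of_all _ h.bound)

variable {E : Type*} [NormedAddCommGroup E] [NormedSpace ℝ E] {v : Torus d → E}

theorem HasExpDecay.integrable_smul (h : HasExpDecay ω C) (hv : StronglyMeasurable v)
    (hi : Integrable v) (s : Torus d) : Integrable fun z => ω z • v (s - proj z) := by
  have hp := Environment.measurable_proj (d := d)
  refine ⟨(h.measurable.stronglyMeasurable.smul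
    (hv.comp_measurable (by fun_prop))).aestronglyMeasurable, ?_⟩
  rw [hasFiniteIntegral_iff_enorm]
  have h1 : ∀ z, ‖ω z • v (s - proj z)‖ₑ = ENNReal.ofReal |ω z| * ‖v (s - proj z)‖ₑ := by
    intro z
    rw [enorm_smul, Real.enorm_eq_ofReal_abs]
  simp_rw [h1]
  rw [← lintegral_periodize h.abs (fun _ => abs_nonneg _) hv.enorm]
  calc _ ≤ ∫⁻ t, ENNReal.ofReal (C * latticeBound d) * ‖v t‖ₑ := by
        refine lintegral_mono fun t => ?_
        gcongr
        exact (le_abs_self _).trans (h.abs.isBddKernel.bound s t)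
    _ < ⊤ := by
        rw [lintegral_const_mul' _ _ ENNReal.ofReal_ne_top]
        exact ENNReal.mul_lt_top ENNReal.ofReal_lt_top hi.2

theorem integral_periodize [CompleteSpace E] (h : HasExpDecay ω C) (hv : StronglyMeasurable v)
    (hi : Integrable v) (s : Torus d) :
    ∫ t, periodize ω s t • v t = ∫ z, ω z • v (s - proj z) := by
  have h1 : ∫ z, ω z • v (s - proj z) = ∫ y, ω (rep s - y) • v (proj y) := by
    rw [← integral_sub_left_eq_self _ volume (rep s)]
    simp only [Environment.proj_sub, Environment.proj_rep, sub_sub_cancel]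
  have h2 : Integrable fun y => ω (rep s - y) • v (proj y) := by
    have := (h.integrable_smul hv hi s).comp_sub_left (rep s)
    simpa only [Environment.proj_sub, Environment.proj_rep, sub_sub_cancel] using this
  rw [h1, integral_unfold h2]
  refine integral_congr_ae (ae_of_all _ fun t => ?_)
  simp only [proj_rep_add]
  rw [periodize, (h.summable s t).tsum_smul_const]

theorem integral_periodize_one (h : HasExpDecay ω C) (s : Torus d) :
    ∫ t, periodize ω s t = ∫ z, ω z := by
  have := integral_periodize h (v := fun _ => (1 : ℝ)) stronglyMeasurable_const
    (integrable_const _) s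
  simpa using this

theorem periodize_neg (ω : Space d → ℝ) (s t : Torus d) :
    periodize (fun z => ω (-z)) t s = periodize ω s t := by
  rw [periodize, periodize, ← (Equiv.neg (Fin d → ℤ)).tsum_eq]
  refine tsum_congr fun j => ?_
  rw [Equiv.neg_apply, latticeVec_neg]
  congr 1
  abel

theorem integral_periodize_left (h : HasExpDecay ω C) (t : Torus d) :
    ∫ s, periodize ω s t = ∫ z, ω z := by
  simp_rw [← periodize_neg ω]
  rw [integral_periodize_one h.neg_comp, integral_neg_eq_self]

theorem periodize_nonneg (h0 : ∀ z, 0 ≤ ω z) (s t : Torus d) : 0 ≤ periodize ω s t :=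
  tsum_nonneg fun _ => h0 _

end Periodization

/-! ### The kernels of the skewed generators -/

namespace Environment

variable {d : ℕ} (P : Environment d)

theorem exists_tail_bound (R : ℝ) : ∃ C, 0 ≤ C ∧ ∀ z, P.a z ≤ C * Real.exp (-(R * ‖z‖)) := by
  obtain ⟨p, hp, k, hk, C, hC, h⟩ := P.tail_a
  set M : ℝ := |R|
  have hM : 0 ≤ M := abs_nonneg _
  -- Beyond `t₀`, the solution of `k t ^ (p - 1) = M`, the term `k t ^ p` dominates `M t`.
  set t₀ : ℝ := (M / k) ^ (1 / (p - 1))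
  have ht₀ : 0 ≤ t₀ := by positivity
  have key : ∀ t : ℝ, 0 ≤ t → M * t - k * t ^ p ≤ M * t₀ := by
    intro t ht
    rcases le_total t t₀ with h1 | h1
    · have : 0 ≤ k * t ^ p := by positivity
      nlinarith [mul_le_mul_of_nonneg_left h1 hM]
    · have h2 : M / k ≤ t ^ (p - 1) := by
        have h3 : t₀ ^ (p - 1) = M / k := by
          rw [← Real.rpow_mul (by positivity), one_div_mul_cancel (by linarith), Real.rpow_one]
        rw [← h3]
        exact Real.rpow_le_rpow (by positivity) h1 (by linarith)
      have h4 : M ≤ k * t ^ (p - 1) := by rw [div_le_iff₀ hk] at h2; linarith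
      have h5 : t ^ p = t ^ (p - 1) * t := by
        rcases ht.eq_or_lt with rfl | ht'
        · rw [Real.zero_rpow (by linarith), mul_zero]
        · rw [Real.rpow_sub_one ht'.ne']; field_simp
      have h6 : 0 ≤ M * t₀ := by positivity
      rw [h5]
      nlinarith [mul_le_mul_of_nonneg_right h4 ht]
  refine ⟨C * Real.exp (M * t₀), by positivity, fun z => (h z).trans ?_⟩
  rw [mul_assoc, ← Real.exp_add]
  have h1 := key ‖z‖ (norm_nonneg z)
  have h2 : R * ‖z‖ ≤ M * ‖z‖ := mul_le_mul_of_nonneg_right (le_abs_self R) (norm_nonneg z)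
  gcongr
  linarith

/-- The lower bound of `Λ`. -/
def Λmin : ℝ := P.bounds_Λ.choose

/-- The upper bound of `Λ`. -/
def Λmax : ℝ := P.bounds_Λ.choose_spec.2.choose

theorem Λmin_pos : 0 < P.Λmin := P.bounds_Λ.choose_spec.1

theorem Λmin_le (x y : Space d) : P.Λmin ≤ P.Λ x y :=
  (P.bounds_Λ.choose_spec.2.choose_spec x y).1

theorem le_Λmax (x y : Space d) : P.Λ x y ≤ P.Λmax :=
  (P.bounds_Λ.choose_spec.2.choose_spec x y).2

/-- The environment, as a function on the torus. -/
def torusΛ (s t : Torus d) : ℝ := P.Λ (rep s) (rep t)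

theorem torusΛ_nonneg (s t : Torus d) : 0 ≤ P.torusΛ s t := P.Λ_nonneg _ _

theorem abs_torusΛ_le (s t : Torus d) : |P.torusΛ s t| ≤ P.Λmax := by
  rw [abs_of_nonneg (P.torusΛ_nonneg s t)]
  exact P.le_Λmax _ _

@[fun_prop]
theorem measurable_torusΛ : Measurable (Function.uncurry P.torusΛ) :=
  P.measurable_Λ.comp (g := Function.uncurry P.Λ)
    (f := fun q : Torus d × Torus d => (rep q.1, rep q.2)) (by fun_prop)

theorem Λ_eq_torusΛ (x y : Space d) : P.Λ x y = P.torusΛ (proj x) (proj y) := by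
  obtain ⟨j, hj⟩ := exists_rep_proj_add x
  obtain ⟨j', hj'⟩ := exists_rep_proj_add y
  have h := P.periodic_Λ j j' (rep (proj x)) (rep (proj y))
  rw [← hj, ← hj'] at h
  exact h

/-- The periodized kernel of the jump operator with convolution kernel `ω`. -/
def kern (ω : Space d → ℝ) (s t : Torus d) : ℝ := periodize ω s t * P.torusΛ s t

variable {ω : Space d → ℝ} {C : ℝ}

theorem isBddKernel_kern (h : HasExpDecay ω C) :
    IsBddKernel (P.kern ω) (C * latticeBound d * P.Λmax) := by
  refine ⟨h.isBddKernel.measurable.mul P.measurable_torusΛ, fun s t => ?_⟩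
  rw [kern, abs_mul]
  have h1 := h.isBddKernel.bound s t
  exact mul_le_mul h1 (P.abs_torusΛ_le s t) (abs_nonneg _) ((abs_nonneg _).trans h1)

section Formula

variable {E : Type*} [NormedAddCommGroup E] [NormedSpace ℝ E] {v : Torus d → E}

theorem stronglyMeasurable_torusΛ_smul (hv : StronglyMeasurable v) (s : Torus d) :
    StronglyMeasurable fun t => P.torusΛ s t • v t :=
  (P.measurable_torusΛ.comp measurable_prodMk_left).stronglyMeasurable.smul hv

theorem integrable_torusΛ_smul (hi : Integrable v) (s : Torus d) :
    Integrable fun t => P.torusΛ s t • v t := by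
  refine hi.bdd_smul (P.Λmax)
    (P.measurable_torusΛ.comp measurable_prodMk_left).aestronglyMeasurable
    (ae_of_all _ (P.abs_torusΛ_le s))

theorem integral_kern [CompleteSpace E] (h : HasExpDecay ω C) (hv : StronglyMeasurable v)
    (hi : Integrable v) (s : Torus d) : ∫ t, P.kern ω s t • v t =
      ∫ z, (ω z * P.torusΛ s (s - proj z)) • v (s - proj z) := by
  simp_rw [kern, mul_smul]
  exact integral_periodize h (P.stronglyMeasurable_torusΛ_smul hv s)
    (P.integrable_torusΛ_smul hi s) s

end Formula

theorem lintegral_kern (h : HasExpDecay ω C) (h0 : ∀ z, 0 ≤ ω z) {φ : Torus d → ℝ≥0∞}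
    (hφ : Measurable φ) (s : Torus d) :
    ∫⁻ t, ENNReal.ofReal (P.kern ω s t) * φ t =
      ∫⁻ z, ENNReal.ofReal (ω z * P.torusΛ s (s - proj z)) * φ (s - proj z) := by
  have h1 := lintegral_periodize h h0 (φ := fun t => ENNReal.ofReal (P.torusΛ s t) * φ t)
    ((P.measurable_torusΛ.comp measurable_prodMk_left).ennreal_ofReal.mul hφ) s
  simp_rw [kern, ENNReal.ofReal_mul (periodize_nonneg h0 _ _), ENNReal.ofReal_mul (h0 _), mul_assoc]
  exact h1

theorem kern_nonneg (h0 : ∀ z, 0 ≤ ω z) (s t : Torus d) : 0 ≤ P.kern ω s t :=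
  mul_nonneg (periodize_nonneg h0 s t) (P.Λ_nonneg _ _)

theorem le_integral_kern (h : HasExpDecay ω C) (h0 : ∀ z, 0 ≤ ω z) (s : Torus d) :
    P.Λmin * ∫ z, ω z ≤ ∫ t, P.kern ω s t := by
  rw [← integral_periodize_one h s, ← integral_const_mul]
  refine integral_mono ?_ ?_ fun t => ?_
  · exact (Integrable.of_bound (h.isBddKernel.measurable_right s).aestronglyMeasurable _
      (ae_of_all _ (h.isBddKernel.bound s))).const_mul _
  · exact Integrable.of_bound ((P.isBddKernel_kern h).measurable_right s).aestronglyMeasurable _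
      (ae_of_all _ ((P.isBddKernel_kern h).bound s))
  · rw [kern, mul_comm]
    exact mul_le_mul_of_nonneg_left (P.Λmin_le _ _) (periodize_nonneg h0 s t)

theorem le_integral_kern_left (h : HasExpDecay ω C) (h0 : ∀ z, 0 ≤ ω z) (t : Torus d) :
    P.Λmin * ∫ z, ω z ≤ ∫ s, P.kern ω s t := by
  rw [← integral_periodize_left h t, ← integral_const_mul]
  refine integral_mono ?_ ?_ fun s => ?_
  · exact (Integrable.of_bound (h.isBddKernel.transpose.measurable_right t).aestronglyMeasurable _
      (ae_of_all _ (h.isBddKernel.transpose.bound t))).const_mul _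
  · exact Integrable.of_bound
      ((P.isBddKernel_kern h).transpose.measurable_right t).aestronglyMeasurable _
      (ae_of_all _ ((P.isBddKernel_kern h).transpose.bound t))
  · dsimp only
    rw [kern, mul_comm]
    exact mul_le_mul_of_nonneg_left (P.Λmin_le _ _) (periodize_nonneg h0 s t)

/-- Functions on `ℝ^d` that grow at most exponentially. -/
structure IsTempered (m : Space d → ℝ) : Prop where
  measurable : Measurable m
  exists_bound : ∃ C R : ℝ, 0 ≤ C ∧ ∀ z, |m z| ≤ C * Real.exp (R * ‖z‖)

theorem exp_neg_inner_le (l z : Space d) : Real.exp (-⟪l, z⟫_ℝ) ≤ Real.exp (‖l‖ * ‖z‖) :=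
  Real.exp_le_exp.2 ((neg_le_abs _).trans (abs_real_inner_le_norm l z))

/-- The decay of `a` absorbs the growth of `m` and of `e^{-l·z}` and leaves a factor `e^{-‖z‖}`,
which makes the lattice sums converge. -/
theorem exists_weight_decay (l : Space d) {m : Space d → ℝ} (hm : IsTempered m) :
    ∃ C, HasExpDecay (fun z => P.weight l z * m z) C := by
  obtain ⟨C, R, hC, h⟩ := hm.exists_bound
  obtain ⟨K, hK, hK'⟩ := P.exists_tail_bound (‖l‖ + R + 1)
  refine ⟨K * C, (P.measurable_weight l).mul hm.measurable, fun z => ?_⟩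
  rw [abs_mul, abs_of_nonneg (P.weight_nonneg l z)]
  calc _ ≤ (K * Real.exp (-((‖l‖ + R + 1) * ‖z‖)) * Real.exp (‖l‖ * ‖z‖)) *
        (C * Real.exp (R * ‖z‖)) := by
        refine mul_le_mul (mul_le_mul (hK' z) (exp_neg_inner_le l z) (Real.exp_pos _).le
          (by positivity)) (h z) (abs_nonneg _) (by positivity)
    _ = K * C * (Real.exp (-((‖l‖ + R + 1) * ‖z‖)) * Real.exp (‖l‖ * ‖z‖) *
        Real.exp (R * ‖z‖)) := by ring
    _ = _ := by
        rw [← Real.exp_add, ← Real.exp_add]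
        congr 2
        ring

theorem isTempered_one : IsTempered (fun _ : Space d => (1 : ℝ)) :=
  ⟨measurable_const, 1, 0, zero_le_one, fun z => by simp⟩

theorem exists_hasExpDecay_weight (l : Space d) : ∃ C, HasExpDecay (P.weight l) C := by
  obtain ⟨C, hC⟩ := P.exists_weight_decay l isTempered_one
  exact ⟨C, by simpa using hC⟩

/-- A constant in the exponential decay of the weight. -/
def weightBound (l : Space d) : ℝ := (P.exists_hasExpDecay_weight l).choose

theorem hasExpDecay_weight (l : Space d) : HasExpDecay (P.weight l) (P.weightBound l) :=
  (P.exists_hasExpDecay_weight l).choose_spec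

theorem integrable_a : Integrable P.a := by
  have h : P.weight 0 = P.a := by
    ext z
    simp [weight]
  exact h ▸ P.integrable_weight 0

theorem volume_a_pos : 0 < volume {z | 0 < P.a z} := by
  rw [pos_iff_ne_zero]
  intro h
  have h1 : P.a =ᵐ[volume] 0 := by
    have h2 : ∀ᵐ z, ¬ 0 < P.a z := measure_eq_zero_iff_ae_notMem.1 h
    filter_upwards [h2] with z hz
    exact le_antisymm (not_lt.1 hz) (P.nonneg_a z)
  have h2 := P.integral_a
  rw [integral_congr_ae h1] at h2
  simp at h2

theorem weight_pos_iff (l z : Space d) : 0 < P.weight l z ↔ 0 < P.a z := by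
  rw [weight, mul_pos_iff_of_pos_right (Real.exp_pos _)]

theorem integral_weight_pos (l : Space d) : 0 < ∫ z, P.weight l z := by
  rw [integral_pos_iff_support_of_nonneg (P.weight_nonneg l) (P.integrable_weight l)]
  convert P.volume_a_pos using 2
  ext z
  rw [Function.mem_support, mem_ofPred_eq, ← P.weight_pos_iff l z]
  exact (P.weight_nonneg l z).lt_iff_ne'.symm

end Environment
end PeriodicJump
end

noncomputable section

namespace PeriodicJump

/-! ### Irreducibility and the reduction to an abstract jump generator -/

section Ergodicity

variable {d : ℕ}

instance isNegInvariant_torus : (volume : Measure (Torus d)).IsNegInvariant := by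
  have : (volume : Measure UnitAddCircle).IsNegInvariant := inferInstance
  infer_instance

/-- The group of the translations that preserve a set up to null sets. -/
def aeStabilizer (E : Set (Torus d)) : AddSubgroup (Torus d) where
  carrier := {τ | ∀ᵐ s : Torus d, s - τ ∈ E ↔ s ∈ E}
  zero_mem' := by simp
  add_mem' := by
    intro τ τ' h h'
    have h1 := (measurePreserving_sub_right (volume : Measure (Torus d))
      τ).quasiMeasurePreserving.ae h'
    filter_upwards [h, h1] with s hs hs'
    rw [← sub_sub, hs', hs]
  neg_mem' := by
    intro τ h
    have h1 := (measurePreserving_add_right (volume : Measure (Torus d))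
      τ).quasiMeasurePreserving.ae h
    filter_upwards [h1] with s hs
    rw [sub_neg_eq_add, ← hs, add_sub_cancel_right]

/-- A translate of `E` has the same finite measure as `E`, so inclusion up to a null set already
implies equality up to a null set. -/
theorem mem_aeStabilizer_of_measure_eq_zero {E : Set (Torus d)} (hE : MeasurableSet E)
    {τ : Torus d} (h : volume (Eᶜ ∩ {s | s - τ ∈ E}) = 0) : τ ∈ aeStabilizer E := by
  have hm := measurePreserving_sub_right (volume : Measure (Torus d)) τ
  set A : Set (Torus d) := {s | s - τ ∈ E}
  have hA : volume A = volume E := hm.measure_preimage hE.nullMeasurableSet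
  have h1 : A ≤ᵐ[volume] E := by
    have h2 := measure_eq_zero_iff_ae_notMem.1 h
    filter_upwards [h2] with s hs hs'
    by_contra hsE
    exact hs ⟨hsE, hs'⟩
  have h3 := ae_eq_of_ae_subset_of_measure_ge h1 hA.ge
    (hE.preimage hm.measurable).nullMeasurableSet (measure_ne_top _ _)
  filter_upwards [h3] with s hs
  exact (eq_iff_iff.1 hs)

theorem proj_nsmul (n : ℕ) (x : Space d) : proj (n • x) = n • proj x := by
  funext i
  simp only [proj, PiLp.smul_apply, Pi.smul_apply]
  exact AddCircle.coe_nsmul 1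

theorem measurable_measure_inter {E F : Set (Torus d)} (hE : MeasurableSet E)
    (hF : MeasurableSet F) : Measurable fun τ : Torus d => volume (F ∩ {s | s - τ ∈ E}) := by
  have h : MeasurableSet {q : Torus d × Torus d | q.2 ∈ F ∧ q.2 - q.1 ∈ E} :=
    (hF.preimage measurable_snd).inter (hE.preimage (by fun_prop : Measurable
      fun q : Torus d × Torus d => q.2 - q.1))
  exact measurable_measure_prodMk_left h

theorem measure_inter_eq_lintegral {E F : Set (Torus d)} (hE : MeasurableSet E)
    (τ : Torus d) :
    volume (F ∩ {s | s - τ ∈ E}) = ∫⁻ s in F, E.indicator 1 (s - τ) := by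
  have hA : MeasurableSet {s : Torus d | s - τ ∈ E} := hE.preimage (by fun_prop)
  rw [inter_comm, ← Measure.restrict_apply hA, ← lintegral_indicator_one hA]
  rfl

/-- By Tonelli the integral over all `τ` of the measure of `Eᶜ ∩ (E + τ)` is the product of the
measures of `Eᶜ` and `E`; here it is zero. -/
theorem null_or_conull_of_aeStabilizer_eq_top {E : Set (Torus d)} (hE : MeasurableSet E)
    (h : aeStabilizer E = ⊤) : volume E = 0 ∨ volume Eᶜ = 0 := by
  have h1 : ∀ τ : Torus d, volume (Eᶜ ∩ {s | s - τ ∈ E}) = 0 := by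
    intro τ
    have h2 : τ ∈ aeStabilizer E := h ▸ AddSubgroup.mem_top τ
    refine measure_eq_zero_iff_ae_notMem.2 ?_
    filter_upwards [h2] with s hs hs'
    exact hs'.1 (hs.1 hs'.2)
  have h2 : ∫⁻ τ : Torus d, volume (Eᶜ ∩ {s | s - τ ∈ E}) = volume Eᶜ * volume E := by
    simp_rw [measure_inter_eq_lintegral hE]
    have hind : Measurable (E.indicator (1 : Torus d → ℝ≥0∞)) := measurable_one.indicator hE
    rw [lintegral_lintegral_swap (by fun_prop)]
    have h3 : ∀ s : Torus d, ∫⁻ τ, E.indicator (1 : Torus d → ℝ≥0∞) (s - τ) = volume E := by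
      intro s
      rw [lintegral_sub_left_eq_self (E.indicator (1 : Torus d → ℝ≥0∞)) s,
        lintegral_indicator_one hE]
    simp_rw [h3, setLIntegral_const]
    exact mul_comm _ _
  simp only [h1, lintegral_zero] at h2
  exact (mul_eq_zero.1 h2.symm).symm

end Ergodicity

namespace Environment

variable {d : ℕ} (P : Environment d)

/-- Almost every `z` with `a z > 0` projects into the stabilizer of `E`. These `z` form a set of
positive measure, so by Steinhaus their differences contain a neighbourhood of zero. Every `τ` is
`n` times the projection of the small vector `rep τ / n`, so the stabilizer is the whole torus. -/
theorem null_or_conull_of_lintegral_eq_zero (l : Space d) {E : Set (Torus d)}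
    (hE : MeasurableSet E)
    (h : ∫⁻ z, ENNReal.ofReal (P.weight l z) * volume (Eᶜ ∩ {s | s - proj z ∈ E}) = 0) :
    volume E = 0 ∨ volume Eᶜ = 0 := by
  have hψ : Measurable fun z : Space d => volume (Eᶜ ∩ {s : Torus d | s - proj z ∈ E}) :=
    (measurable_measure_inter hE hE.compl).comp measurable_proj
  have hw := P.measurable_weight l
  have ha := P.measurable_a
  rw [lintegral_eq_zero_iff (by fun_prop)] at h
  set S : Set (Space d) := {z | 0 < P.a z ∧ volume (Eᶜ ∩ {s : Torus d | s - proj z ∈ E}) = 0}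
  have hS : MeasurableSet S :=
    (measurableSet_lt measurable_const ha).inter (hψ (measurableSet_singleton 0))
  have hSpos : 0 < volume S := by
    have h1 : volume S = volume {z | 0 < P.a z} := by
      refine measure_congr ?_
      filter_upwards [h] with z hz
      refine eq_iff_iff.2 ⟨fun hz' => hz'.1, fun hz' => ⟨hz', ?_⟩⟩
      rcases mul_eq_zero.1 hz with h2 | h2
      · exact absurd (ENNReal.ofReal_eq_zero.1 h2) (not_le.2 ((P.weight_pos_iff l z).2 hz'))
      · exact h2
    rw [h1]
    exact P.volume_a_pos
  have hnhds := Measure.sub_mem_nhds_zero_of_addHaar_pos volume S hS hSpos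
  refine null_or_conull_of_aeStabilizer_eq_top hE ((AddSubgroup.eq_top_iff' _).2 fun τ => ?_)
  have hlim : Tendsto (fun n : ℕ => (n : ℝ)⁻¹ • rep τ) atTop (𝓝 0) := by
    have := (tendsto_inv_atTop_nhds_zero_nat (𝕜 := ℝ)).smul_const (rep τ)
    simpa using this
  obtain ⟨n, hn, hn0⟩ := ((hlim.eventually hnhds).and (eventually_ne_atTop 0)).exists
  obtain ⟨z, hz, z', hz', hzz⟩ := hn
  have h1 : proj ((n : ℝ)⁻¹ • rep τ) ∈ aeStabilizer E := by
    rw [← hzz, proj_sub]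
    exact sub_mem (mem_aeStabilizer_of_measure_eq_zero hE hz.2)
      (mem_aeStabilizer_of_measure_eq_zero hE hz'.2)
  have h2 := nsmul_mem h1 n
  rwa [← proj_nsmul, ← Nat.cast_smul_eq_nsmul ℝ, smul_smul,
    mul_inv_cancel₀ (by exact_mod_cast hn0), one_smul, proj_rep] at h2

/-- Since `Λ ≥ Λmin > 0`, the environment can be dropped, which leaves the pure convolution. -/
theorem kern_irreducible (l : Space d) (E : Set (Torus d)) (hE : MeasurableSet E)
    (h : ∫⁻ s in Eᶜ, ∫⁻ t in E, ENNReal.ofReal (P.kern (P.weight l) s t) = 0) :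
    volume E = 0 ∨ volume Eᶜ = 0 := by
  refine P.null_or_conull_of_lintegral_eq_zero l hE ?_
  have hw := P.measurable_weight l
  have hp := measurable_proj (d := d)
  have hind : Measurable (E.indicator (1 : Torus d → ℝ≥0∞)) := measurable_one.indicator hE
  have h1 : ∀ s : Torus d, ENNReal.ofReal P.Λmin *
      ∫⁻ z, ENNReal.ofReal (P.weight l z) * E.indicator 1 (s - proj z) ≤
      ∫⁻ t in E, ENNReal.ofReal (P.kern (P.weight l) s t) := by
    intro s
    have h2 : ∫⁻ t in E, ENNReal.ofReal (P.kern (P.weight l) s t) =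
        ∫⁻ t, ENNReal.ofReal (P.kern (P.weight l) s t) * E.indicator 1 t := by
      rw [← lintegral_indicator hE]
      refine lintegral_congr fun t => ?_
      by_cases ht : t ∈ E <;> simp [ht]
    rw [h2, P.lintegral_kern (P.hasExpDecay_weight l) (P.weight_nonneg l) hind,
      ← lintegral_const_mul' _ _ ENNReal.ofReal_ne_top]
    refine lintegral_mono fun z => ?_
    rw [← mul_assoc, ← ENNReal.ofReal_mul P.Λmin_pos.le, mul_comm P.Λmin]
    gcongr
    · exact P.weight_nonneg l z
    · exact P.Λmin_le _ _
  have h2 : ∫⁻ s in Eᶜ, ENNReal.ofReal P.Λmin *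
      ∫⁻ z, ENNReal.ofReal (P.weight l z) * E.indicator 1 (s - proj z) = 0 :=
    le_antisymm ((lintegral_mono h1).trans h.le) bot_le
  rw [lintegral_const_mul' _ _ ENNReal.ofReal_ne_top, mul_eq_zero,
    or_iff_right (by simpa using P.Λmin_pos)] at h2
  rw [lintegral_lintegral_swap (by fun_prop)] at h2
  rw [← h2]
  refine lintegral_congr fun z => ?_
  rw [measure_inter_eq_lintegral hE,
    lintegral_const_mul' _ _ ENNReal.ofReal_ne_top]

/-! ### The killing rate -/

theorem G_eq (x : Space d) : P.G x = ∫ t, P.kern P.a (proj x) t := by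
  have h0 : P.a = P.weight 0 := by
    ext z
    simp [weight]
  have h1 := P.integral_kern (P.hasExpDecay_weight 0) (v := fun _ => (1 : ℝ))
    stronglyMeasurable_const (integrable_const _) (proj x)
  rw [← h0] at h1
  simp only [smul_eq_mul, mul_one] at h1
  rw [h1, G, ← integral_sub_left_eq_self _ volume x]
  simp only [sub_sub_cancel, Λ_eq_torusΛ, proj_sub]

theorem G_rep_proj (x : Space d) : P.G (rep (proj x)) = P.G x := by
  rw [P.G_eq, P.G_eq, proj_rep]

theorem abs_G_le (x : Space d) : |P.G x| ≤ P.Λmax := by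
  have h1 : Integrable fun y => P.a (x - y) * P.Λmax :=
    (P.integrable_a.comp_sub_left x).mul_const _
  rw [← Real.norm_eq_abs]
  refine (norm_integral_le_of_norm_le h1 (ae_of_all _ fun y => ?_)).trans ?_
  · rw [Real.norm_of_nonneg (mul_nonneg (P.nonneg_a _) (P.Λ_nonneg _ _))]
    exact mul_le_mul_of_nonneg_left (P.le_Λmax _ _) (P.nonneg_a _)
  · rw [integral_mul_const, integral_sub_left_eq_self P.a volume x, P.integral_a, one_mul]

/-- Carries almost everywhere statements from the torus to `ℝ^d`, which is needed to compare with
the essential infimum of `G` taken over `ℝ^d`. -/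
theorem quasiMeasurePreserving_proj :
    Measure.QuasiMeasurePreserving (proj : Space d → Torus d) volume volume := by
  refine ⟨measurable_proj, Measure.AbsolutelyContinuous.mk fun N hN h0 => ?_⟩
  rw [Measure.map_apply measurable_proj hN, ← lintegral_indicator_one (measurable_proj hN),
    lintegral_unfold (measurable_one.indicator (measurable_proj hN))]
  have h1 : ∀ (t : Torus d) (j : Fin d → ℤ), (proj ⁻¹' N).indicator (1 : Space d → ℝ≥0∞)
      (rep t + latticeVec j) = N.indicator 1 t := by
    intro t j
    exact (indicator_comp_right proj (s := N) (g := (1 : Torus d → ℝ≥0∞))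
      (x := rep t + latticeVec j)).trans (by rw [proj_rep_add])
  simp_rw [h1]
  rw [lintegral_eq_zero_iff (Measurable.tsum fun _ => measurable_one.indicator hN)]
  filter_upwards [measure_eq_zero_iff_ae_notMem.1 h0] with t ht
  simp [ht]

theorem ae_gMin_le : ∀ᵐ s : Torus d, P.gMin ≤ P.G (rep s) := by
  have h1 : ∀ᵐ x, P.gMin ≤ P.G x :=
    ae_essInf_le (isBoundedUnder_of ⟨-P.Λmax, fun x => neg_le_of_abs_le (P.abs_G_le x)⟩)
  exact measurePreserving_rep.quasiMeasurePreserving.ae (ae_restrict_of_ae h1)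

theorem abs_gMin_le : |P.gMin| ≤ P.Λmax := by
  have h1 : ∀ᵐ x : Space d, P.gMin ≤ P.G x :=
    ae_essInf_le (isBoundedUnder_of ⟨-P.Λmax, fun x => neg_le_of_abs_le (P.abs_G_le x)⟩)
  obtain ⟨x, hx⟩ := h1.exists
  refine abs_le.2 ⟨?_, hx.trans ((le_abs_self _).trans (P.abs_G_le x))⟩
  exact le_essInf_of_ae_le _ (ae_of_all _ fun x => neg_le_of_abs_le (P.abs_G_le x))
    (isBoundedUnder_of (r := (· ≤ ·)) ⟨P.Λmax, fun x =>
      le_of_abs_le (P.abs_G_le x)⟩).isCoboundedUnder_ge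

/-- The killing rate on the torus. -/
def rate (s : Torus d) : ℝ := max (P.G (rep s)) P.gMin

theorem measurable_rate : Measurable P.rate :=
  (P.measurable_G.comp measurable_rep).max measurable_const

/-- The truncation in `rate` changes `G` only on a null set; it makes the bound by `gMin` hold at
every point, as `JumpData` demands. -/
theorem rate_ae_eq : P.rate =ᵐ[volume] fun s => P.G (rep s) := by
  filter_upwards [P.ae_gMin_le] with s hs
  exact max_eq_left hs

theorem measure_rate_lt {ε : ℝ} (hε : 0 < ε) :
    volume {s | P.rate s < P.gMin + ε} ≠ 0 := by
  intro h
  have h1 : ∀ᵐ s : Torus d, P.gMin + ε ≤ P.G (rep s) := by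
    filter_upwards [measure_eq_zero_iff_ae_notMem.1 h, P.rate_ae_eq] with s hs hs'
    rw [← hs']
    exact not_lt.1 hs
  have h2 : ∀ᵐ x : Space d, P.gMin + ε ≤ P.G x := by
    filter_upwards [quasiMeasurePreserving_proj.ae h1] with x hx
    rwa [P.G_rep_proj] at hx
  have h3 : P.gMin + ε ≤ P.gMin := le_essInf_of_ae_le _ h2
    (isBoundedUnder_of (r := (· ≤ ·)) ⟨P.Λmax, fun x =>
      le_of_abs_le (P.abs_G_le x)⟩).isCoboundedUnder_ge
  linarith

/-- The skewed generator, as the generator of a jump process on the torus. -/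
def jumpData (l : Space d) : JumpData (volume : Measure (Torus d)) where
  k := P.kern (P.weight l)
  g := P.rate
  M := P.weightBound l * latticeBound d * P.Λmax
  m := P.Λmin * ∫ z, P.weight l z
  g₀ := P.gMin
  Cg := P.Λmax
  bdd := P.isBddKernel_kern (P.hasExpDecay_weight l)
  nonneg := P.kern_nonneg (P.weight_nonneg l)
  m_pos := mul_pos P.Λmin_pos (P.integral_weight_pos l)
  row := P.le_integral_kern (P.hasExpDecay_weight l) (P.weight_nonneg l)
  col := P.le_integral_kern_left (P.hasExpDecay_weight l) (P.weight_nonneg l)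
  irred := P.kern_irreducible l
  measurable_g := P.measurable_rate
  g_le := fun s => by
    rcases max_cases (P.G (rep s)) P.gMin with h | h
    · rw [rate, h.1]; exact P.abs_G_le _
    · rw [rate, h.1]; exact P.abs_gMin_le
  g₀_le := fun s => le_max_right _ _
  g₀_inf := fun ε hε => P.measure_rate_lt hε

theorem jump_rep_eq (l : Space d) (v : L2 d) (s : Torus d) :
    P.jump l v (rep s) = ∫ t, (P.kern (P.weight l) s t : ℂ) * v t := by
  have h := P.integral_kern (P.hasExpDecay_weight l) (Lp.stronglyMeasurable v)
    (integrable_of_L2 v) s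
  simp only [Complex.real_smul] at h
  rw [h, jump]
  simp_rw [weight_eq]
  rw [← integral_sub_left_eq_self _ volume (rep s)]
  simp only [sub_sub_cancel, Λ_eq_torusΛ, proj_sub, proj_rep]

theorem jumpData_op (l : Space d) : (P.jumpData l).op = P.skewedGenerator l := by
  ext v
  filter_upwards [(P.jumpData l).op_apply v, P.skewedGenerator_apply l v, P.rate_ae_eq]
    with s h1 h2 h3
  rw [h1, h2, skewedFun, P.jump_rep_eq, proj_rep, ← h3]
  rfl

theorem H_eq (l : Space d) : P.H l = (P.jumpData l).s := by
  rw [H, spectrumRe, JumpData.s, jumpData_op]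

theorem isGreatest_H (l : Space d) : IsGreatest (P.spectrumRe l) (P.H l) := by
  rw [P.H_eq, spectrumRe, ← jumpData_op]
  exact (P.jumpData l).isGreatest_s

theorem neg_gMin_le_H (l : Space d) : -P.gMin ≤ P.H l := by
  rw [P.H_eq]
  exact (P.jumpData l).neg_g₀_le_s

/-- An eigenvalue lies in the spectrum, so `t ≤ H`; a spectral point of maximal real part either is
`t` or lies strictly to its left. Hence there is at most one principal eigenvalue, and the supremum
in `θ` is harmless. -/
theorem IsPrincipalEigenvalue.eq_H {l : Space d} {t : ℝ} (h : P.IsPrincipalEigenvalue l t) :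
    t = P.H l := by
  obtain ⟨⟨u, hu, hut⟩, ht⟩ := h
  have hu0 : u ≠ 0 := by
    rintro rfl
    obtain ⟨s, hs, hs'⟩ := (hu.and (Lp.coeFn_zero ℂ 2 (volume : Measure (Torus d)))).exists
    rw [hs'] at hs
    simp at hs
  have hmem : (t : ℂ) ∈ spectrum ℂ (P.skewedGenerator l) := by
    rw [spectrum.mem_iff]
    intro hunit
    obtain ⟨w, hw⟩ := hunit
    refine hu0 ?_
    have h1 : (w : L2 d →L[ℂ] L2 d) u = 0 := by
      rw [hw]
      rw [Algebra.algebraMap_eq_smul_one, sub_apply, smul_apply, one_apply_eq_self, hut, sub_self]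
    have h2 : ((w⁻¹ : (L2 d →L[ℂ] L2 d)ˣ) : L2 d →L[ℂ] L2 d) ((w : L2 d →L[ℂ] L2 d) u) = u := by
      rw [← mul_apply_eq_comp, Units.inv_mul, one_apply_eq_self]
    rw [← h2, h1, map_zero]
  refine le_antisymm ((P.isGreatest_H l).2 ⟨_, hmem, Complex.ofReal_re t⟩) ?_
  obtain ⟨z, hz, hzre⟩ := (P.isGreatest_H l).1
  rw [← hzre]
  by_cases hzt : z = t
  · simp [hzt]
  · exact (ht z hz hzt).le

theorem isPrincipalEigenvalue_H {l : Space d} (h : -P.gMin < P.H l) :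
    P.IsPrincipalEigenvalue l (P.H l) := by
  rw [P.H_eq] at h ⊢
  obtain ⟨⟨u, hu, hue⟩, hz⟩ := (P.jumpData l).exists_eigenfunction h
  rw [IsPrincipalEigenvalue, ← jumpData_op]
  refine ⟨⟨bddL2 u hu.memLp, ?_, (P.jumpData l).op_bddL2 hu.memLp
    (ae_of_all _ fun s => (hu.pos s).le) hue⟩, fun z hzs hzne => ?_⟩
  · filter_upwards [bddL2_apply (hu.memLp (μ := (volume : Measure (Torus d))))] with s hs
    rw [hs]
    exact ⟨by simpa using hu.pos s, by simp⟩
  · exact lt_of_le_of_ne ((P.jumpData l).isGreatest_s.2 ⟨z, hzs, rfl⟩)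
      fun h' => hzne (hz z hzs h')

/-- Makes `Γ` a strict superlevel set of `H`; since `H ≥ -gMin` always, `H` equals `-gMin` off `Γ`.
-/
theorem mem_Γ_iff (l : Space d) : l ∈ P.Γ ↔ -P.gMin < P.H l := by
  constructor
  · rintro ⟨t, ht, ht'⟩
    rwa [← IsPrincipalEigenvalue.eq_H P ht]
  · exact fun h => ⟨_, P.isPrincipalEigenvalue_H h, h⟩

theorem θ_eq {l : Space d} (h : l ∈ P.Γ) : P.θ l = P.H l := by
  have h1 : {t : ℝ | P.IsPrincipalEigenvalue l t} = {P.H l} := by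
    ext t
    refine ⟨fun ht => IsPrincipalEigenvalue.eq_H P ht, ?_⟩
    rintro rfl
    exact P.isPrincipalEigenvalue_H ((P.mem_Γ_iff l).1 h)
  rw [θ, h1, csSup_singleton]

end Environment
end PeriodicJump
end

noncomputable section

namespace PeriodicJump

/-! ### The entropy inequality and subgradients of the Hamiltonian -/

section BoundedFunctions

variable {X Y : Type*} [MeasurableSpace X] [MeasurableSpace Y]

/-- Bounded measurable real functions. -/
structure IsBddFun (f : X → ℝ) : Prop where
  measurable : Measurable f
  exists_bound : ∃ C, ∀ x, |f x| ≤ C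

theorem IsBddFun.mul {f g : X → ℝ} (hf : IsBddFun f) (hg : IsBddFun g) :
    IsBddFun fun x => f x * g x := by
  obtain ⟨C, hC⟩ := hf.exists_bound
  obtain ⟨C', hC'⟩ := hg.exists_bound
  refine ⟨hf.measurable.mul hg.measurable, C * C', fun x => ?_⟩
  rw [abs_mul]
  exact mul_le_mul (hC x) (hC' x) (abs_nonneg _) ((abs_nonneg _).trans (hC x))

theorem IsBddFun.sub {f g : X → ℝ} (hf : IsBddFun f) (hg : IsBddFun g) :
    IsBddFun fun x => f x - g x := by
  obtain ⟨C, hC⟩ := hf.exists_bound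
  obtain ⟨C', hC'⟩ := hg.exists_bound
  exact ⟨hf.measurable.sub hg.measurable, C + C', fun x =>
    (abs_sub _ _).trans (add_le_add (hC x) (hC' x))⟩

theorem IsBddFun.comp {f : X → ℝ} (hf : IsBddFun f) {φ : Y → X} (hφ : Measurable φ) :
    IsBddFun fun y => f (φ y) := by
  obtain ⟨C, hC⟩ := hf.exists_bound
  exact ⟨hf.measurable.comp hφ, C, fun y => hC _⟩

theorem IsBddFun.integrable {f : X → ℝ} (hf : IsBddFun f) {μ : Measure X} [IsFiniteMeasure μ] :
    Integrable f μ := by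
  obtain ⟨C, hC⟩ := hf.exists_bound
  exact Integrable.of_bound hf.measurable.aestronglyMeasurable C (ae_of_all _ hC)

theorem JumpData.IsPosBdd.isBddFun {u : X → ℝ} (hu : JumpData.IsPosBdd u) : IsBddFun u := by
  obtain ⟨δ, hδ, C, h⟩ := hu.exists_bounds
  refine ⟨hu.measurable, C, fun x => ?_⟩
  rw [abs_of_pos (hδ.trans_le (h x).1)]
  exact (h x).2

theorem JumpData.IsPosBdd.isBddFun_inv {u : X → ℝ} (hu : JumpData.IsPosBdd u) : IsBddFun fun x => (u x)⁻¹ := by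
  obtain ⟨δ, hδ, C, h⟩ := hu.exists_bounds
  refine ⟨hu.measurable.inv, δ⁻¹, fun x => ?_⟩
  rw [abs_of_pos (inv_pos.2 (hδ.trans_le (h x).1))]
  exact inv_anti₀ hδ (h x).1

theorem JumpData.IsPosBdd.isBddFun_log {u : X → ℝ} (hu : JumpData.IsPosBdd u) :
    IsBddFun fun x => Real.log (u x) := by
  obtain ⟨δ, hδ, C, h⟩ := hu.exists_bounds
  refine ⟨hu.measurable.log, max (-Real.log δ) (Real.log C), fun x => abs_le.2 ⟨?_, ?_⟩⟩
  · rw [neg_le]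
    exact (neg_le_neg (Real.log_le_log hδ (h x).1)).trans (le_max_left _ _)
  · exact (Real.log_le_log (hδ.trans_le (h x).1) (h x).2).trans (le_max_right _ _)

end BoundedFunctions

section Shift

variable {d : ℕ}

@[fun_prop]
theorem measurable_shift : Measurable fun q : Torus d × Space d => q.1 - proj q.2 := by
  have := Environment.measurable_proj (d := d)
  fun_prop

theorem integrable_torus_mul {ω : Space d → ℝ} (hω : Integrable ω) {B : Torus d × Space d → ℝ}
    (hB : IsBddFun B) : Integrable fun q : Torus d × Space d => ω q.2 * B q := by
  obtain ⟨C, hC⟩ := hB.exists_bound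
  exact (hω.comp_snd (volume : Measure (Torus d))).mul_bdd hB.measurable.aestronglyMeasurable
    (ae_of_all _ hC)

/-- The increments of a function on the torus have mean zero. -/
theorem integral_increment {ω : Space d → ℝ} (hω : Integrable ω) {f : Torus d → ℝ}
    (hf : IsBddFun f) :
    ∫ q : Torus d × Space d, ω q.2 * (f (q.1 - proj q.2) - f q.1) = 0 := by
  have hB : IsBddFun fun q : Torus d × Space d => f (q.1 - proj q.2) - f q.1 :=
    (hf.comp measurable_shift).sub (hf.comp measurable_fst)
  rw [Measure.volume_eq_prod, integral_prod_symm _ (integrable_torus_mul hω hB)]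
  refine integral_eq_zero_of_ae (ae_of_all _ fun z => ?_)
  dsimp only
  rw [integral_const_mul, integral_sub (hf.comp (by fun_prop)).integrable hf.integrable,
    integral_sub_right_eq_self f, sub_self, mul_zero]
  rfl

end Shift

namespace Environment

variable {d : ℕ} (P : Environment d) {ω : Space d → ℝ} {C : ℝ}

theorem isBddFun_torusΛ_shift :
    IsBddFun fun q : Torus d × Space d => P.torusΛ q.1 (q.1 - proj q.2) :=
  ⟨P.measurable_torusΛ.comp (measurable_fst.prodMk measurable_shift), P.Λmax,
    fun _ => P.abs_torusΛ_le _ _⟩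

theorem isBddFun_jump {p f : Torus d → ℝ} (hp : IsBddFun p) (hf : IsBddFun f) :
    IsBddFun fun q : Torus d × Space d =>
      p q.1 * (P.torusΛ q.1 (q.1 - proj q.2) * f (q.1 - proj q.2)) :=
  (hp.comp measurable_fst).mul (P.isBddFun_torusΛ_shift.mul (hf.comp measurable_shift))

/-- Translates between integrals over positions and jumps, where exponentials of `z` can be handled
pointwise, and pairings with the kernel, where the eigenfunction equations apply. -/
theorem integral_prod_kern (h : HasExpDecay ω C) {p f : Torus d → ℝ} (hp : IsBddFun p)
    (hf : IsBddFun f) : ∫ q : Torus d × Space d,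
      ω q.2 * (p q.1 * (P.torusΛ q.1 (q.1 - proj q.2) * f (q.1 - proj q.2))) =
      ∫ s, p s * ∫ t, P.kern ω s t * f t := by
  rw [Measure.volume_eq_prod,
    integral_prod _ (integrable_torus_mul h.integrable (P.isBddFun_jump hp hf))]
  refine integral_congr_ae (ae_of_all _ fun s => ?_)
  have h1 := P.integral_kern h hf.measurable.stronglyMeasurable hf.integrable s
  simp only [smul_eq_mul] at h1
  dsimp only
  rw [h1, ← integral_const_mul]
  refine integral_congr_ae (ae_of_all _ fun z => ?_)
  dsimp only
  ring

theorem isTempered_inner (l : Space d) : IsTempered fun z : Space d => ⟪l, z⟫_ℝ := by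
  refine ⟨by fun_prop, ‖l‖, 1, norm_nonneg l, fun z => ?_⟩
  refine (abs_real_inner_le_norm l z).trans (mul_le_mul_of_nonneg_left ?_ (norm_nonneg l))
  rw [one_mul]
  linarith [Real.add_one_le_exp ‖z‖]

theorem isTempered_exp (l : Space d) : IsTempered fun z : Space d => Real.exp (-⟪l, z⟫_ℝ) := by
  refine ⟨by fun_prop, 1, ‖l‖, zero_le_one, fun z => ?_⟩
  rw [abs_of_pos (Real.exp_pos _), one_mul]
  exact exp_neg_inner_le l z

theorem IsTempered.mul {m m' : Space d → ℝ} (h : IsTempered m) (h' : IsTempered m') :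
    IsTempered fun z => m z * m' z := by
  obtain ⟨C, R, hC, hR⟩ := h.exists_bound
  obtain ⟨C', R', hC', hR'⟩ := h'.exists_bound
  refine ⟨h.measurable.mul h'.measurable, C * C', R + R', by positivity, fun z => ?_⟩
  rw [abs_mul, add_mul, Real.exp_add]
  calc _ ≤ (C * Real.exp (R * ‖z‖)) * (C' * Real.exp (R' * ‖z‖)) :=
        mul_le_mul (hR z) (hR' z) (abs_nonneg _) (by positivity)
    _ = _ := by ring

theorem IsTempered.integrable {m : Space d → ℝ} (h : IsTempered m) (l : Space d) :
    Integrable fun z => P.weight l z * m z := by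
  obtain ⟨C, hC⟩ := P.exists_weight_decay l h
  exact hC.integrable

theorem weight_add (l m z : Space d) :
    P.weight (l + m) z = P.weight l z * Real.exp (-⟪m, z⟫_ℝ) := by
  rw [weight, weight, inner_add_left, neg_add, Real.exp_add, mul_assoc]

/-- The excess of the exponential over its tangent. -/
def excess (l m : Space d) : ℝ :=
  ∫ z, P.weight l z * (Real.exp (-⟪m, z⟫_ℝ) - 1 + ⟪m, z⟫_ℝ)

theorem integrable_excess (l m : Space d) :
    Integrable fun z => P.weight l z * (Real.exp (-⟪m, z⟫_ℝ) - 1 + ⟪m, z⟫_ℝ) := by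
  have h := (((isTempered_exp m).integrable P l).sub (P.integrable_weight l)).add
    ((isTempered_inner m).integrable P l)
  refine h.congr (ae_of_all _ fun z => ?_)
  simp only [Pi.add_apply, Pi.sub_apply]
  ring

/-- The convex function `e^x - 1 - x` lies above its tangent at `c`. -/
theorem exp_tangent (c x : ℝ) :
    Real.exp c - 1 - c + (Real.exp c - 1) * (x - c) ≤ Real.exp x - 1 - x := by
  have h := mul_le_mul_of_nonneg_left (Real.add_one_le_exp (x - c)) (Real.exp_pos c).le
  rw [← Real.exp_add, add_sub_cancel] at h
  linarith

/-- The lower bound of the entropy production. -/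
theorem excess_le_integral {l m : Space d} {c : ℝ} (hc : 0 ≤ c) {B : Torus d × Space d → ℝ}
    (hB : IsBddFun B) (hcB : ∀ q, c ≤ B q) {f : Torus d → ℝ} (hf : IsBddFun f) :
    c * P.excess l m ≤ ∫ q : Torus d × Space d, P.weight l q.2 * B q *
      (Real.exp (-⟪m, q.2⟫_ℝ + (f (q.1 - proj q.2) - f q.1)) - 1 -
        (-⟪m, q.2⟫_ℝ + (f (q.1 - proj q.2) - f q.1))) := by
  have hincr : IsBddFun fun q : Torus d × Space d => f (q.1 - proj q.2) - f q.1 :=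
    (hf.comp measurable_shift).sub (hf.comp measurable_fst)
  have hexp : IsBddFun fun q : Torus d × Space d => Real.exp (f (q.1 - proj q.2) - f q.1) := by
    obtain ⟨K, hK⟩ := hincr.exists_bound
    refine ⟨hincr.measurable.exp, Real.exp K, fun q => ?_⟩
    rw [abs_of_pos (Real.exp_pos _)]
    exact Real.exp_le_exp.2 ((le_abs_self _).trans (hK q))
  have i1 := integrable_torus_mul (P.integrable_excess l m)
    (B := fun _ => 1) ⟨measurable_const, 1, fun _ => by simp⟩
  have hiexp : Integrable fun z => P.weight l z * (Real.exp (-⟪m, z⟫_ℝ) - 1) := by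
    refine (((isTempered_exp m).integrable P l).sub (P.integrable_weight l)).congr
      (ae_of_all _ fun z => ?_)
    simp only [Pi.sub_apply]
    ring
  have i2 := integrable_torus_mul hiexp hincr
  have i3 := integrable_torus_mul
    ((isTempered_exp m).integrable P l) (hB.mul hexp)
  have i4 := integrable_torus_mul (P.integrable_weight l)
    (hB.mul hincr)
  have i5 := integrable_torus_mul
    ((isTempered_inner m).integrable P l) hB
  have i6 := integrable_torus_mul (P.integrable_weight l) hB
  have hexc : P.excess l m = ∫ q : Torus d × Space d,
      P.weight l q.2 * (Real.exp (-⟪m, q.2⟫_ℝ) - 1 + ⟪m, q.2⟫_ℝ) * 1 := by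
    rw [Measure.volume_eq_prod, integral_prod _ i1]
    simp [excess]
  -- The bound uses the tangent at `-m·z`. Its linear term is a function of `z` times the increment
  -- of `f`, which averages to zero over the torus, so the estimate does not depend on `f`. The
  -- density `B` is replaced by its lower bound `c`, which is legitimate because `e^x - 1 - x ≥ 0`.
  have h0 := integral_increment hiexp hf
  have hsum : c * P.excess l m = ∫ q : Torus d × Space d,
      (c * (P.weight l q.2 * (Real.exp (-⟪m, q.2⟫_ℝ) - 1 + ⟪m, q.2⟫_ℝ) * 1) +
      c * (P.weight l q.2 * (Real.exp (-⟪m, q.2⟫_ℝ) - 1) * (f (q.1 - proj q.2) - f q.1))) := by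
    rw [integral_add (i1.const_mul c) (i2.const_mul c), integral_const_mul, integral_const_mul,
      h0, ← hexc, mul_zero, add_zero]
  rw [hsum]
  refine integral_mono ((i1.const_mul c).add (i2.const_mul c)) ?_ fun q => ?_
  · refine ((((i3.sub i6).add i5).sub i4)).congr (ae_of_all _ fun q => ?_)
    simp only [Pi.sub_apply, Pi.add_apply, Real.exp_add]
    ring
  · dsimp only
    set x := -⟪m, q.2⟫_ℝ + (f (q.1 - proj q.2) - f q.1) with hx
    have h1 := exp_tangent (-⟪m, q.2⟫_ℝ) x
    have h2 : 0 ≤ Real.exp x - 1 - x := by linarith [Real.add_one_le_exp x]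
    have hw := P.weight_nonneg l q.2
    calc _ = c * P.weight l q.2 * (Real.exp (-⟪m, q.2⟫_ℝ) - 1 - -⟪m, q.2⟫_ℝ +
          (Real.exp (-⟪m, q.2⟫_ℝ) - 1) * (x - -⟪m, q.2⟫_ℝ)) := by rw [hx]; ring
      _ ≤ c * P.weight l q.2 * (Real.exp x - 1 - x) :=
          mul_le_mul_of_nonneg_left h1 (mul_nonneg hc hw)
      _ ≤ P.weight l q.2 * B q * (Real.exp x - 1 - x) := by
          rw [mul_comm c]
          exact mul_le_mul_of_nonneg_right (mul_le_mul_of_nonneg_left (hcB q) hw) h2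

open JumpData in
/-- On `Γ` the Hamiltonian has a global lower bound by an affine function plus an excess. -/
theorem exists_subgradient {l : Space d} (hl : -P.gMin < P.H l) :
    ∃ b : Space d →ₗ[ℝ] ℝ, ∃ c > 0, ∀ m, P.H l + b m + c * P.excess l m ≤ P.H (l + m) := by
  rw [P.H_eq] at hl
  obtain ⟨⟨u, hu, hue⟩, -⟩ := (P.jumpData l).exists_eigenfunction hl
  obtain ⟨p, hp, hpe⟩ := (P.jumpData l).exists_left_eigenfunction hl
  simp only [← P.H_eq] at hue hpe
  change ∀ᵐ s, ∫ t, P.kern (P.weight l) s t * u t = (P.H l + P.rate s) * u s at hue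
  change ∀ᵐ t, ∫ s, P.kern (P.weight l) s t * p s = (P.H l + P.rate t) * p t at hpe
  have hud := hu.exists_bounds
  have hpd := hp.exists_bounds
  obtain ⟨δ, hδ, _, hδu⟩ := hud
  obtain ⟨δ', hδ', _, hδp⟩ := hpd
  have hub := hu.isBddFun
  have hpb := hp.isBddFun
  have hrate : IsBddFun P.rate := ⟨P.measurable_rate, P.Λmax, (P.jumpData l).g_le⟩
  -- Multiplied by the weight, `B` is the flow of jumps of the process transformed by the right
  -- eigenfunction `u`, whose invariant density is proportional to `p u`.
  set B : Torus d × Space d → ℝ := fun q =>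
    p q.1 * (P.torusΛ q.1 (q.1 - proj q.2) * u (q.1 - proj q.2)) with hBdef
  have hB : IsBddFun B := P.isBddFun_jump hpb hub
  set c₀ := δ' * (P.Λmin * δ)
  have hc₀ : 0 < c₀ := mul_pos hδ' (mul_pos P.Λmin_pos hδ)
  have hcB : ∀ q, c₀ ≤ B q := fun q =>
    mul_le_mul (hδp _).1 (mul_le_mul (P.Λmin_le _ _) (hδu _).1 hδ.le (P.torusΛ_nonneg _ _))
      (mul_pos P.Λmin_pos hδ).le (hp.pos _).le
  set π₀ := ∫ s, p s * u s
  have hπ₀ : 0 < π₀ := by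
    have h1 := integral_mono (μ := (volume : Measure (Torus d)))
      (integrable_const (δ' * δ)) (hpb.mul hub).integrable
      fun s => mul_le_mul (hδp s).1 (hδu s).1 hδ.le (hp.pos s).le
    simp only [integral_const, probReal_univ, one_smul] at h1
    exact (mul_pos hδ' hδ).trans_le h1
  have hlin : ∀ m, Integrable fun q : Torus d × Space d => P.weight l q.2 * ⟪m, q.2⟫_ℝ * B q :=
    fun m => integrable_torus_mul ((isTempered_inner m).integrable P l) hB
  let b : Space d →ₗ[ℝ] ℝ :=
    { toFun := fun m => -(∫ q : Torus d × Space d, P.weight l q.2 * ⟪m, q.2⟫_ℝ * B q) / π₀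
      map_add' := fun m m' => by
        rw [← add_div, ← neg_add, ← integral_add (hlin m) (hlin m')]
        congr 3
        ext q
        rw [inner_add_left]
        ring
      map_smul' := fun r m => by
        rw [RingHom.id_apply, smul_eq_mul, ← mul_div_assoc, mul_neg, ← integral_const_mul]
        congr 3
        ext q
        rw [real_inner_smul_left]
        ring }
  -- Since `l + m` need not lie in `Γ`, it may have no positive eigenfunction. For every `η > H (l +
  -- m)` there is still a positive supersolution, and `η` tends to `H (l + m)` at the end.
  refine ⟨b, c₀ / π₀, div_pos hc₀ hπ₀, fun m => le_of_forall_gt_imp_ge_of_dense fun η hη => ?_⟩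
  rw [P.H_eq] at hη
  obtain ⟨w, hw, hwe⟩ := (P.jumpData (l + m)).exists_supersolution hη
  change ∀ᵐ s, ∫ t, P.kern (P.weight (l + m)) s t * w t ≤ (η + P.rate s) * w s at hwe
  have hwb := hw.isBddFun
  have hwi := hw.isBddFun_inv
  set f : Torus d → ℝ := fun s => Real.log (w s) - Real.log (u s)
  have hf : IsBddFun f := hw.isBddFun_log.sub hu.isBddFun_log
  have hdec := P.hasExpDecay_weight l
  have hdec' := P.hasExpDecay_weight (l + m)
  -- Testing the supersolution inequality for `w` against `p u / w` leaves the same killing term as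
  -- in the total mass of the flow, so the two cancel.
  set r : Torus d → ℝ := fun s => p s * u s * (w s)⁻¹
  have hr : IsBddFun r := (hpb.mul hub).mul hwi
  -- the total mass of the flow
  have e1 : ∫ q : Torus d × Space d, P.weight l q.2 * B q =
      P.H l * π₀ + ∫ s, P.rate s * (p s * u s) := by
    rw [P.integral_prod_kern hdec hpb hub, ← integral_const_mul,
      ← integral_add ((hpb.mul hub).integrable.const_mul _) (hrate.mul (hpb.mul hub)).integrable]
    refine integral_congr_ae ?_
    filter_upwards [hue] with s hs
    rw [hs]
    ring
  have e2 : ∫ q : Torus d × Space d, P.weight (l + m) q.2 *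
      (r q.1 * (P.torusΛ q.1 (q.1 - proj q.2) * w (q.1 - proj q.2))) ≤
      η * π₀ + ∫ s, P.rate s * (p s * u s) := by
    rw [P.integral_prod_kern hdec' hr hwb, ← integral_const_mul,
      ← integral_add ((hpb.mul hub).integrable.const_mul _) (hrate.mul (hpb.mul hub)).integrable]
    refine integral_mono_ae ?_ (((hpb.mul hub).integrable.const_mul _).add
      (hrate.mul (hpb.mul hub)).integrable) ?_
    · have hm : Measurable fun s => ∫ t, P.kern (P.weight (l + m)) s t * w t :=
        ((((P.isBddKernel_kern hdec').measurable.mul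
          (hw.measurable.comp measurable_snd)).stronglyMeasurable).integral_prod_right').measurable
      refine (hr.mul ⟨hm, ?_⟩).integrable
      obtain ⟨K, hK⟩ := hwb.exists_bound
      refine ⟨P.weightBound (l + m) * latticeBound d * P.Λmax * K, fun s => ?_⟩
      rw [← Real.norm_eq_abs]
      refine (norm_integral_le_of_norm_le_const (ae_of_all _ fun t => ?_)).trans_eq
        (by rw [probReal_univ, mul_one])
      have h1 := (P.isBddKernel_kern hdec').bound s t
      rw [norm_mul]
      exact mul_le_mul h1 (hK t) (norm_nonneg _) ((abs_nonneg _).trans h1)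
    · filter_upwards [hwe] with s hs
      have h0 : 0 ≤ r s := (mul_pos (mul_pos (hp.pos s) (hu.pos s)) (inv_pos.2 (hw.pos s))).le
      refine (mul_le_mul_of_nonneg_left hs h0).trans_eq ?_
      have := (hw.pos s).ne'
      simp only [r]
      field_simp
  -- Stationarity of the flow: by the right and the left eigenfunction equations both parts of the
  -- increment integrate to `∫ (H + rate) p u f`.
  have e3 : ∫ q : Torus d × Space d, P.weight l q.2 *
      (B q * (f (q.1 - proj q.2) - f q.1)) = 0 := by
    have i1 := integrable_torus_mul (P.integrable_weight l) (P.isBddFun_jump hpb (hub.mul hf))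
    have i2 := integrable_torus_mul (P.integrable_weight l) (P.isBddFun_jump (hpb.mul hf) hub)
    calc _ = (∫ q : Torus d × Space d, P.weight l q.2 * (p q.1 *
          (P.torusΛ q.1 (q.1 - proj q.2) * (u (q.1 - proj q.2) * f (q.1 - proj q.2))))) -
        ∫ q : Torus d × Space d, P.weight l q.2 * (p q.1 * f q.1 *
          (P.torusΛ q.1 (q.1 - proj q.2) * u (q.1 - proj q.2))) := by
          rw [← integral_sub i1 i2]
          refine integral_congr_ae (ae_of_all _ fun q => ?_)
          simp only [hBdef]
          ring
      _ = 0 := by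
          rw [P.integral_prod_kern hdec hpb (hub.mul hf),
            P.integral_prod_kern hdec (hpb.mul hf) hub,
            (P.isBddKernel_kern hdec).integral_mul_integral_real hpb.integrable
              (hub.mul hf).integrable, sub_eq_zero]
          refine integral_congr_ae ?_
          filter_upwards [hue, hpe] with s h1 h2
          rw [h1, h2]
          ring
  have hincr : IsBddFun fun q : Torus d × Space d => f (q.1 - proj q.2) - f q.1 :=
    (hf.comp measurable_shift).sub (hf.comp measurable_fst)
  have hkey := P.excess_le_integral (l := l) (m := m) hc₀.le hB hcB hf
  -- The exponential of `-m·z` plus the increment of `f` turns the flow for `l` into the flow for `l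
  -- + m` built from `r` and `w`; the other terms of `e^x - 1 - x` give the total mass, the linear
  -- functional `b` and the stationary term.
  have e4 : ∫ q : Torus d × Space d, P.weight l q.2 * B q *
      (Real.exp (-⟪m, q.2⟫_ℝ + (f (q.1 - proj q.2) - f q.1)) - 1 -
        (-⟪m, q.2⟫_ℝ + (f (q.1 - proj q.2) - f q.1))) =
      (∫ q : Torus d × Space d, P.weight (l + m) q.2 *
        (r q.1 * (P.torusΛ q.1 (q.1 - proj q.2) * w (q.1 - proj q.2)))) -
      (∫ q : Torus d × Space d, P.weight l q.2 * B q) +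
      (∫ q : Torus d × Space d, P.weight l q.2 * ⟪m, q.2⟫_ℝ * B q) -
      ∫ q : Torus d × Space d, P.weight l q.2 * (B q * (f (q.1 - proj q.2) - f q.1)) := by
    have i1 := integrable_torus_mul (P.integrable_weight (l + m)) (P.isBddFun_jump hr hwb)
    have i2 := integrable_torus_mul (P.integrable_weight l) hB
    have i4 := integrable_torus_mul (P.integrable_weight l) (hB.mul hincr)
    rw [← integral_sub' i1 i2, ← integral_add' (i1.sub i2) (hlin m),
      ← integral_sub' ((i1.sub i2).add (hlin m)) i4]
    refine integral_congr_ae (ae_of_all _ fun q => ?_)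
    have h1 := (hw.pos q.1).ne'
    have h2 := (hu.pos (q.1 - proj q.2)).ne'
    have h3 : Real.exp (f (q.1 - proj q.2) - f q.1) =
        w (q.1 - proj q.2) / u (q.1 - proj q.2) / (w q.1 / u q.1) := by
      simp only [f]
      rw [Real.exp_sub, Real.exp_sub, Real.exp_sub, Real.exp_log (hw.pos _),
        Real.exp_log (hw.pos _), Real.exp_log (hu.pos _), Real.exp_log (hu.pos _)]
    have h4 := (hu.pos q.1).ne'
    simp only [Pi.sub_apply, Pi.add_apply]
    rw [Real.exp_add, h3, weight_add]
    simp only [hBdef, r]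
    field_simp
    ring
  rw [e4, e3] at hkey
  have hbm : b m * π₀ = -∫ q : Torus d × Space d, P.weight l q.2 * ⟪m, q.2⟫_ℝ * B q :=
    div_mul_cancel₀ _ hπ₀.ne'
  have hfin : (P.H l + b m + c₀ / π₀ * P.excess l m) * π₀ ≤ η * π₀ := by
    have : c₀ / π₀ * P.excess l m * π₀ = c₀ * P.excess l m := by field_simp
    rw [add_mul, add_mul, this]
    linarith
  exact le_of_mul_le_mul_right hfin hπ₀

end Environment
end PeriodicJump
end

noncomputable section

namespace PeriodicJump

/-! ### Convexity, strict convexity and positivity of the Hessian -/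

section SecondOrder

/-- A negative second derivative would make `x` a local maximum as well, so `f` would be constant
near `x` and its second derivative zero. -/
theorem deriv_deriv_nonneg_of_isLocalMin {f : ℝ → ℝ} {x : ℝ} (h : IsLocalMin f x)
    (hc : ContinuousAt f x) : 0 ≤ deriv (deriv f) x := by
  by_contra! hneg
  have hmax := isLocalMax_of_deriv_deriv_neg hneg h.deriv_eq_zero hc
  have hconst : f =ᶠ[𝓝 x] fun _ => f x := by
    filter_upwards [h, hmax] with y h1 h2
    exact le_antisymm h2 h1
  have h1 : deriv f =ᶠ[𝓝 x] fun _ => 0 := by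
    filter_upwards [hconst.eventuallyEq_nhds] with y hy
    rw [hy.deriv_eq, deriv_const]
  rw [h1.deriv_eq, deriv_const] at hneg
  exact lt_irrefl _ hneg

variable {E : Type*} [NormedAddCommGroup E] [NormedSpace ℝ E]

/-- A twice differentiable function that lies above a parabola in some direction has a positive
second derivative in that direction. -/
theorem iteratedFDeriv_two_pos_of_le {F : E → ℝ} {x h : E} {β c : ℝ} (hF : ContDiffAt ℝ 2 F x)
    (hc : 0 < c) (hle : ∀ᶠ τ : ℝ in 𝓝 0, F x + β * τ + c * τ ^ 2 ≤ F (x + τ • h)) :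
    0 < iteratedFDeriv ℝ 2 F x ![h, h] := by
  rw [iteratedFDeriv_two_apply]
  simp only [Matrix.cons_val_zero, Matrix.cons_val_one]
  have hline : ∀ τ : ℝ, HasDerivAt (fun τ : ℝ => x + τ • h) h τ := fun τ => by
    simpa using ((hasDerivAt_id τ).smul_const h).const_add x
  have hcont : Tendsto (fun τ : ℝ => x + τ • h) (𝓝 0) (𝓝 x) := by
    have := (hline 0).continuousAt.tendsto
    simpa using this
  have hd : ∀ᶠ τ : ℝ in 𝓝 0, DifferentiableAt ℝ F (x + τ • h) :=
    hcont.eventually ((hF.eventually (by simp)).mono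
      fun y hy => hy.differentiableAt (by simp))
  -- The difference from the parabola has a local minimum at zero, so its second derivative there,
  -- that of `F` minus `2 * c`, is nonnegative.
  set g : ℝ → ℝ := fun τ => F (x + τ • h) - (F x + β * τ + c * τ ^ 2)
  have hg1 : ∀ᶠ τ : ℝ in 𝓝 0, HasDerivAt g (fderiv ℝ F (x + τ • h) h - (β + c * (2 * τ))) τ := by
    filter_upwards [hd] with τ hτ
    have h1 := hτ.hasFDerivAt.comp_hasDerivAt τ (hline τ)
    have h2 : HasDerivAt (fun τ : ℝ => F x + β * τ + c * τ ^ 2) (β + c * (2 * τ)) τ := by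
      have h3 := (((hasDerivAt_id τ).const_mul β).const_add (F x)).add
        (((hasDerivAt_id τ).pow 2).const_mul c)
      refine h3.congr_deriv ?_
      simp
    exact h1.sub h2
  have hmin : IsLocalMin g 0 := by
    filter_upwards [hle] with τ hτ
    have h0 : g 0 = 0 := by simp [g]
    rw [h0]
    exact sub_nonneg.2 hτ
  have h2 : deriv g =ᶠ[𝓝 0] fun τ => fderiv ℝ F (x + τ • h) h - (β + c * (2 * τ)) :=
    hg1.mono fun τ hτ => hτ.deriv
  have hF1 : DifferentiableAt ℝ (fderiv ℝ F) x :=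
    (hF.fderiv_right (m := 1) (by norm_num)).differentiableAt (by simp)
  have hline0 : HasDerivAt (fun τ : ℝ => fderiv ℝ F (x + τ • h)) (fderiv ℝ (fderiv ℝ F) x h) 0 := by
    have h0 : HasFDerivAt (fderiv ℝ F) (fderiv ℝ (fderiv ℝ F) x) (x + (0 : ℝ) • h) := by
      rw [zero_smul, add_zero]
      exact hF1.hasFDerivAt
    exact h0.comp_hasDerivAt (0 : ℝ) (hline 0)
  have h3 : HasDerivAt (fun τ : ℝ => fderiv ℝ F (x + τ • h) h - (β + c * (2 * τ)))
      (fderiv ℝ (fderiv ℝ F) x h h - c * 2) 0 := by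
    have h4 := hline0.clm_apply (hasDerivAt_const (0 : ℝ) h)
    have h5 : HasDerivAt (fun τ : ℝ => β + c * (2 * τ)) (c * 2) 0 := by
      have := (((hasDerivAt_id (0 : ℝ)).const_mul 2).const_mul c).const_add β
      simpa using this
    refine (h4.sub h5).congr_deriv ?_
    simp
  have h6 := deriv_deriv_nonneg_of_isLocalMin hmin (hg1.self_of_nhds).continuousAt
  rw [h2.deriv_eq, h3.deriv] at h6
  linarith

/-- `e^x - 1 - x` is `(e^{x/2} - 1)^2` plus the nonnegative `2 (e^{x/2} - 1 - x/2)`, and `|e^{x/2} -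
1|` is at least `|x|/2 * e^{-|x|/2}`. -/
theorem sq_mul_exp_le_excess (x : ℝ) :
    x ^ 2 / 4 * Real.exp (-|x|) ≤ Real.exp x - 1 - x := by
  have h1 : (Real.exp (x / 2) - 1) ^ 2 ≤ Real.exp x - 1 - x := by
    have h2 : Real.exp x = Real.exp (x / 2) ^ 2 := by
      rw [← Real.exp_nat_mul]
      congr 1
      push_cast
      ring
    rw [h2]
    nlinarith [Real.add_one_le_exp (x / 2)]
  refine le_trans ?_ h1
  have h3 : Real.exp (-|x|) = Real.exp (-|x| / 2) ^ 2 := by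
    rw [← Real.exp_nat_mul]
    congr 1
    push_cast
    ring
  have h4 : |x| / 2 * Real.exp (-|x| / 2) ≤ |Real.exp (x / 2) - 1| := by
    rcases le_total 0 x with hx | hx
    · rw [abs_of_nonneg hx]
      have h5 : Real.exp (-x / 2) ≤ 1 := Real.exp_le_one_iff.2 (by linarith)
      refine le_trans ?_ (le_abs_self _)
      nlinarith [Real.add_one_le_exp (x / 2)]
    · rw [abs_of_nonpos hx, neg_neg]
      refine le_trans ?_ (neg_le_abs _)
      have h5 := mul_le_mul_of_nonneg_right (Real.add_one_le_exp (-x / 2)) (Real.exp_pos (x / 2)).le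
      rw [← Real.exp_add, show -x / 2 + x / 2 = 0 by ring, Real.exp_zero] at h5
      linarith
  calc x ^ 2 / 4 * Real.exp (-|x|) = (|x| / 2 * Real.exp (-|x| / 2)) ^ 2 := by
        rw [h3, mul_pow, div_pow, sq_abs]
        norm_num
    _ ≤ |Real.exp (x / 2) - 1| ^ 2 := pow_le_pow_left₀ (by positivity) h4 2
    _ = _ := sq_abs _

end SecondOrder

namespace Environment

variable {d : ℕ} (P : Environment d)

/-- The entry point of the half-space hypothesis: it applies to the normalized `h` and says that
jumps with `⟪h, z⟫ > 0` have positive mass. -/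
theorem integral_pos_of_halfSpace {F : Space d → ℝ} (hF : Integrable F) (h0 : ∀ z, 0 ≤ F z)
    {h : Space d} (hh : h ≠ 0) (hpos : ∀ z, 0 < P.a z → 0 < ⟪h, z⟫_ℝ → 0 < F z) :
    0 < ∫ z, F z := by
  have hn : 0 < ‖h‖ := norm_pos_iff.2 hh
  have h1 := P.halfSpace_a (‖h‖⁻¹ • h) (by rw [norm_smul, norm_inv, norm_norm, inv_mul_cancel₀ hn.ne'])
  rw [setIntegral_pos_iff_support_of_nonneg_ae (ae_of_all _ P.nonneg_a)
    P.integrable_a.integrableOn] at h1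
  rw [integral_pos_iff_support_of_nonneg h0 hF]
  refine h1.trans_le (measure_mono fun z hz => ?_)
  refine (hpos z (lt_of_le_of_ne (P.nonneg_a z) (Ne.symm hz.1)) ?_).ne'
  have h2 : 0 < ⟪z, ‖h‖⁻¹ • h⟫_ℝ := hz.2
  rw [real_inner_smul_right, real_inner_comm] at h2
  exact (mul_pos_iff_of_pos_left (inv_pos.2 hn)).1 h2

theorem excess_integrand_nonneg (l m z : Space d) :
    0 ≤ P.weight l z * (Real.exp (-⟪m, z⟫_ℝ) - 1 + ⟪m, z⟫_ℝ) :=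
  mul_nonneg (P.weight_nonneg l z) (by linarith [Real.add_one_le_exp (-⟪m, z⟫_ℝ)])

theorem excess_nonneg (l m : Space d) : 0 ≤ P.excess l m :=
  integral_nonneg (P.excess_integrand_nonneg l m)

theorem excess_pos (l : Space d) {m : Space d} (hm : m ≠ 0) : 0 < P.excess l m := by
  refine P.integral_pos_of_halfSpace (P.integrable_excess l m) (P.excess_integrand_nonneg l m) hm
    fun z hz hz' => mul_pos ((P.weight_pos_iff l z).2 hz) ?_
  have := Real.add_one_lt_exp (x := -⟪m, z⟫_ℝ) (by linarith)
  linarith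

/-- For `|τ| ≤ 1` the damping factor `e^{-|τ h·z|}` is at least `e^{-|h·z|}`, so the quadratic lower
bound has a constant independent of `τ`. -/
theorem excess_smul_ge (l : Space d) {h : Space d} (hh : h ≠ 0) :
    ∃ c > 0, ∀ τ : ℝ, |τ| ≤ 1 → c * τ ^ 2 ≤ P.excess l (τ • h) := by
  have hbd : IsTempered fun z : Space d => ⟪h, z⟫_ℝ ^ 2 / 4 * Real.exp (-|⟪h, z⟫_ℝ|) := by
    have h1 := (isTempered_inner h).mul (isTempered_inner h)
    obtain ⟨C, R, hC, hR⟩ := h1.exists_bound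
    refine ⟨by fun_prop, C, R, hC, fun z => le_trans ?_ (hR z)⟩
    rw [abs_mul, abs_of_pos (Real.exp_pos _), ← sq, abs_div, abs_of_pos (by norm_num : (0 : ℝ) < 4)]
    have h2 : Real.exp (-|⟪h, z⟫_ℝ|) ≤ 1 := Real.exp_le_one_iff.2 (by simp)
    have h3 := abs_nonneg (⟪h, z⟫_ℝ ^ 2)
    nlinarith [mul_le_mul_of_nonneg_left h2 h3]
  refine ⟨∫ z, P.weight l z * (⟪h, z⟫_ℝ ^ 2 / 4 * Real.exp (-|⟪h, z⟫_ℝ|)),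
    P.integral_pos_of_halfSpace (hbd.integrable P l)
      (fun z => mul_nonneg (P.weight_nonneg l z) (by positivity)) hh
      fun z hz hz' => mul_pos ((P.weight_pos_iff l z).2 hz) (by positivity), fun τ hτ => ?_⟩
  rw [← integral_mul_const]
  refine integral_mono ((hbd.integrable P l).mul_const _) (P.integrable_excess l _) fun z => ?_
  dsimp only
  rw [mul_assoc]
  refine mul_le_mul_of_nonneg_left ?_ (P.weight_nonneg l z)
  have h1 := sq_mul_exp_le_excess (-⟪τ • h, z⟫_ℝ)
  rw [real_inner_smul_left, abs_neg, abs_mul] at h1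
  rw [real_inner_smul_left]
  have h2 : Real.exp (-|⟪h, z⟫_ℝ|) ≤ Real.exp (-(|τ| * |⟪h, z⟫_ℝ|)) :=
    Real.exp_le_exp.2 (by nlinarith [abs_nonneg ⟪h, z⟫_ℝ])
  calc _ = (-(τ * ⟪h, z⟫_ℝ)) ^ 2 / 4 * Real.exp (-|⟪h, z⟫_ℝ|) := by ring
    _ ≤ (-(τ * ⟪h, z⟫_ℝ)) ^ 2 / 4 * Real.exp (-(|τ| * |⟪h, z⟫_ℝ|)) := by gcongr
    _ ≤ _ := by linarith

/-- If the intermediate point is in `Γ`, the subgradient inequality is taken there for both end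
points; the linear terms cancel and the excesses give strictness. Otherwise `H` takes its global
minimum at the intermediate point. -/
theorem H_combination_le {x y : Space d} {t : ℝ} (ht : 0 ≤ t) (ht' : t ≤ 1) :
    P.H (t • x + (1 - t) • y) ≤ t * P.H x + (1 - t) * P.H y ∧
    (-P.gMin < P.H (t • x + (1 - t) • y) → x ≠ y → 0 < t → t < 1 →
      P.H (t • x + (1 - t) • y) < t * P.H x + (1 - t) * P.H y) := by
  set z := t • x + (1 - t) • y with hz
  have hx := P.neg_gMin_le_H x
  have hy := P.neg_gMin_le_H y
  rcases (P.neg_gMin_le_H z).lt_or_eq with hlt | heq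
  · obtain ⟨b, c, hc, hb⟩ := P.exists_subgradient hlt
    have h1 := hb (x - z)
    have h2 := hb (y - z)
    rw [add_sub_cancel] at h1 h2
    have h3 : t * b (x - z) + (1 - t) * b (y - z) = 0 := by
      rw [← smul_eq_mul, ← smul_eq_mul (1 - t), ← map_smul, ← map_smul, ← map_add]
      have : t • (x - z) + (1 - t) • (y - z) = 0 := by
        rw [hz]
        module
      rw [this, map_zero]
    have h4 := mul_nonneg hc.le (P.excess_nonneg z (x - z))
    have h5 := mul_nonneg hc.le (P.excess_nonneg z (y - z))
    refine ⟨by nlinarith, fun _ hxy ht0 ht1 => ?_⟩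
    have hxz : x - z ≠ 0 := by
      have : x - z = (1 - t) • (x - y) := by rw [hz]; module
      rw [this]
      exact smul_ne_zero (by linarith) (sub_ne_zero.2 hxy)
    have h6 := mul_pos ht0 (mul_pos hc (P.excess_pos z hxz))
    nlinarith
  · rw [← heq]
    exact ⟨by nlinarith, fun h => absurd h (lt_irrefl _)⟩

theorem convexOn_H : ConvexOn ℝ univ P.H := by
  refine ⟨convex_univ, fun x _ y _ a b ha hb hab => ?_⟩
  obtain rfl : b = 1 - a := by linarith
  exact (P.H_combination_le ha (by linarith)).1

/-- `Γ` is not known to be convex. If the segment leaves it, `H` equals `-gMin` at the intermediate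
point, strictly below both end values. -/
theorem H_combination_lt {x y : Space d} (hx : x ∈ P.Γ) (hy : y ∈ P.Γ) (hxy : x ≠ y) {t : ℝ}
    (ht : t ∈ Ioo (0 : ℝ) 1) : P.H (t • x + (1 - t) • y) < t * P.H x + (1 - t) * P.H y := by
  rw [mem_Γ_iff] at hx hy
  rcases (P.neg_gMin_le_H (t • x + (1 - t) • y)).lt_or_eq with hlt | heq
  · exact (P.H_combination_le ht.1.le ht.2.le).2 hlt hxy ht.1 ht.2
  · rw [← heq]
    nlinarith [mul_pos ht.1 (sub_pos.2 hx), mul_pos (sub_pos.2 ht.2) (sub_pos.2 hy)]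

/-- A finite convex function on a finite dimensional space is continuous, so no perturbation theory
of spectra is needed. -/
theorem continuous_H : Continuous P.H :=
  continuousOn_univ.1 (P.convexOn_H.continuousOn isOpen_univ)

theorem Γ_eq : P.Γ = {l | -P.gMin < P.H l} :=
  Set.ext P.mem_Γ_iff

theorem isOpen_Γ : IsOpen P.Γ := by
  rw [Γ_eq]
  exact isOpen_lt continuous_const P.continuous_H

theorem hessian_H_pos {l : Space d} (hl : l ∈ P.Γ) (hC : ContDiffAt ℝ 2 P.H l) {h : Space d}
    (hh : h ≠ 0) : 0 < iteratedFDeriv ℝ 2 P.H l ![h, h] := by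
  obtain ⟨b, c, hc, hb⟩ := P.exists_subgradient ((P.mem_Γ_iff l).1 hl)
  obtain ⟨c', hc', hq⟩ := P.excess_smul_ge l hh
  refine iteratedFDeriv_two_pos_of_le (β := b h) hC (mul_pos hc hc') ?_
  filter_upwards [Metric.ball_mem_nhds (0 : ℝ) one_pos] with τ hτ
  have hτ' : |τ| ≤ 1 := by simpa using (mem_ball_zero_iff.1 hτ).le
  have h1 := hb (τ • h)
  have h2 := mul_le_mul_of_nonneg_left (hq τ hτ') hc.le
  rw [map_smul, smul_eq_mul] at h1
  linarith

end Environment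
end PeriodicJump
end

noncomputable section

/-! ### Twice continuous differentiability on `Γ` -/

namespace PeriodicJump

theorem abs_exp_sub_one_sub_le (x : ℝ) : |Real.exp x - 1 - x| ≤ x ^ 2 * Real.exp |x| := by
  have h := Complex.norm_exp_sub_sum_le_norm_mul_exp (x : ℂ) 2
  simp only [Finset.sum_range_succ, Finset.sum_range_zero, Nat.factorial, pow_zero, pow_one,
    zero_add, Nat.cast_one, div_one, mul_one, Complex.norm_real, Real.norm_eq_abs, sq_abs] at h
  rw [← Complex.ofReal_exp, ← Complex.ofReal_one, ← Complex.ofReal_add, ← Complex.ofReal_sub,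
    Complex.norm_real, Real.norm_eq_abs] at h
  rwa [sub_sub]

namespace Environment

variable {d : ℕ} (P : Environment d)

theorem periodize_add {ω ω' : Space d → ℝ} {C C' : ℝ} (h : HasExpDecay ω C)
    (h' : HasExpDecay ω' C') (s t : Torus d) :
    periodize (fun z => ω z + ω' z) s t = periodize ω s t + periodize ω' s t :=
  (h.summable s t).tsum_add (h'.summable s t)

theorem periodize_const_mul (ω : Space d → ℝ) (c : ℝ) (s t : Torus d) :
    periodize (fun z => c * ω z) s t = c * periodize ω s t :=
  tsum_mul_left

/-- The jump operator with the weight `a(z) e^{-l·z} m(z)`. -/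
def weightOp (m : Space d → ℝ) (l : Space d) : L2 d →L[ℂ] L2 d :=
  kerOp volume (P.kern fun z => P.weight l z * m z)

theorem weightOp_add {m m' : Space d → ℝ} (hm : IsTempered m) (hm' : IsTempered m')
    (l : Space d) : P.weightOp (fun z => m z + m' z) l = P.weightOp m l + P.weightOp m' l := by
  obtain ⟨C, hC⟩ := P.exists_weight_decay l hm
  obtain ⟨C', hC'⟩ := P.exists_weight_decay l hm'
  rw [weightOp, weightOp, weightOp, ← kerOp_add (P.isBddKernel_kern hC) (P.isBddKernel_kern hC')]
  congr 1
  ext s t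
  simp only [kern, mul_add]
  rw [periodize_add hC hC', add_mul]

theorem weightOp_const_mul {m : Space d → ℝ} (hm : IsTempered m) (c : ℝ) (l : Space d) :
    P.weightOp (fun z => c * m z) l = c • P.weightOp m l := by
  obtain ⟨C, hC⟩ := P.exists_weight_decay l hm
  rw [weightOp, weightOp, ← kerOp_const_mul (P.isBddKernel_kern hC)]
  congr 1
  ext s t
  simp only [kern, mul_left_comm _ c]
  rw [periodize_const_mul, mul_assoc]

/-- A shift of `l` is a change of multiplier, so differentiability reduces to the Taylor expansion
of `e^{-h·z}` under the kernel. -/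
theorem weightOp_shift (m : Space d → ℝ) (l h : Space d) :
    P.weightOp m (l + h) = P.weightOp (fun z => m z * Real.exp (-⟪h, z⟫_ℝ)) l := by
  simp only [weightOp, weight_add]
  congr 2
  ext z
  ring

theorem IsTempered.mul_neg_inner {m : Space d → ℝ} (hm : IsTempered m) (h : Space d) :
    IsTempered fun z => m z * -⟪h, z⟫_ℝ := by
  have := hm.mul (isTempered_inner (-h))
  simpa only [inner_neg_left] using this

/-- The derivative of `weightOp`. -/
def weightOpDeriv {m : Space d → ℝ} (hm : IsTempered m) (l : Space d) :
    Space d →L[ℝ] (L2 d →L[ℂ] L2 d) :=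
  LinearMap.toContinuousLinearMap
    { toFun := fun h => P.weightOp (fun z => m z * -⟪h, z⟫_ℝ) l
      map_add' := fun h h' => by
        rw [← P.weightOp_add (hm.mul_neg_inner h) (hm.mul_neg_inner h')]
        congr 1
        ext z
        rw [inner_add_left]
        ring
      map_smul' := fun c h => by
        rw [RingHom.id_apply, ← P.weightOp_const_mul (hm.mul_neg_inner h)]
        congr 1
        ext z
        rw [real_inner_smul_left]
        ring }

theorem weightOpDeriv_apply {m : Space d → ℝ} (hm : IsTempered m) (l h : Space d) :
    P.weightOpDeriv hm l h = P.weightOp (fun z => m z * -⟪h, z⟫_ℝ) l := rfl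

theorem isTempered_remainder (h : Space d) :
    IsTempered fun z : Space d => Real.exp (-⟪h, z⟫_ℝ) - 1 + ⟪h, z⟫_ℝ := by
  refine ⟨by fun_prop, ‖h‖ ^ 2 * 2, 1 + ‖h‖, by positivity, fun z => ?_⟩
  have h1 := abs_exp_sub_one_sub_le (-⟪h, z⟫_ℝ)
  rw [sub_neg_eq_add, neg_sq, abs_neg] at h1
  have h2 := abs_real_inner_le_norm h z
  have h3 : ⟪h, z⟫_ℝ ^ 2 ≤ ‖h‖ ^ 2 * (2 * Real.exp ‖z‖) := by
    calc ⟪h, z⟫_ℝ ^ 2 = |⟪h, z⟫_ℝ| ^ 2 := (sq_abs _).symm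
      _ ≤ (‖h‖ * ‖z‖) ^ 2 := pow_le_pow_left₀ (abs_nonneg _) h2 2
      _ = ‖h‖ ^ 2 * ‖z‖ ^ 2 := mul_pow _ _ _
      _ ≤ _ := by
          gcongr
          have := Real.quadratic_le_exp_of_nonneg (norm_nonneg z)
          linarith [norm_nonneg z]
  calc _ ≤ _ := h1
    _ ≤ (‖h‖ ^ 2 * (2 * Real.exp ‖z‖)) * Real.exp (‖h‖ * ‖z‖) :=
        mul_le_mul h3 (Real.exp_le_exp.2 h2) (Real.exp_pos _).le (by positivity)
    _ = _ := by
        rw [add_mul, one_mul, Real.exp_add]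
        ring

/-- The Taylor remainder is at most `(h·z)^2 e^{|h·z|}`. For `‖h‖ ≤ 1` this is at most `2 ‖h‖^2
e^{2‖z‖}`, and the decay of the weight absorbs the exponential uniformly in `h`. -/
theorem exists_norm_weightOp_remainder_le {m : Space d → ℝ} (hm : IsTempered m) (l : Space d) :
    ∃ K, ∀ h : Space d, ‖h‖ ≤ 1 →
      ‖P.weightOp (fun z => m z * (Real.exp (-⟪h, z⟫_ℝ) - 1 + ⟪h, z⟫_ℝ)) l‖ ≤ K * ‖h‖ ^ 2 := by
  have hM : IsTempered fun z : Space d => Real.exp (2 * ‖z‖) :=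
    ⟨by fun_prop, 1, 2, zero_le_one, fun z => by rw [abs_of_pos (Real.exp_pos _), one_mul]⟩
  obtain ⟨C, hC⟩ := P.exists_weight_decay l (hm.mul hM)
  refine ⟨2 * C * latticeBound d * P.Λmax, fun h hh => ?_⟩
  have hdec : HasExpDecay (fun z => P.weight l z *
      (m z * (Real.exp (-⟪h, z⟫_ℝ) - 1 + ⟪h, z⟫_ℝ))) (‖h‖ ^ 2 * 2 * C) := by
    refine ⟨(P.measurable_weight l).mul (hm.measurable.mul (isTempered_remainder h).measurable),
      fun z => ?_⟩
    have h1 := abs_exp_sub_one_sub_le (-⟪h, z⟫_ℝ)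
    rw [sub_neg_eq_add, neg_sq, abs_neg] at h1
    have h2 := abs_real_inner_le_norm h z
    have h4 : |⟪h, z⟫_ℝ| ≤ ‖z‖ := h2.trans (mul_le_of_le_one_left (norm_nonneg z) hh)
    have h3 : ⟪h, z⟫_ℝ ^ 2 ≤ ‖h‖ ^ 2 * (2 * Real.exp ‖z‖) := by
      calc ⟪h, z⟫_ℝ ^ 2 = |⟪h, z⟫_ℝ| ^ 2 := (sq_abs _).symm
        _ ≤ (‖h‖ * ‖z‖) ^ 2 := pow_le_pow_left₀ (abs_nonneg _) h2 2
        _ = ‖h‖ ^ 2 * ‖z‖ ^ 2 := mul_pow _ _ _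
        _ ≤ _ := by
            gcongr
            have := Real.quadratic_le_exp_of_nonneg (norm_nonneg z)
            linarith [norm_nonneg z]
    have h5 : |Real.exp (-⟪h, z⟫_ℝ) - 1 + ⟪h, z⟫_ℝ| ≤ ‖h‖ ^ 2 * 2 * Real.exp (2 * ‖z‖) := by
      calc _ ≤ _ := h1
        _ ≤ (‖h‖ ^ 2 * (2 * Real.exp ‖z‖)) * Real.exp ‖z‖ :=
            mul_le_mul h3 (Real.exp_le_exp.2 h4) (Real.exp_pos _).le (by positivity)
        _ = _ := by
            rw [two_mul ‖z‖, Real.exp_add]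
            ring
    have h6 := hC.bound z
    rw [abs_mul, abs_mul, abs_of_pos (Real.exp_pos (2 * ‖z‖))] at h6
    rw [abs_mul, abs_mul]
    calc _ ≤ |P.weight l z| * (|m z| * (‖h‖ ^ 2 * 2 * Real.exp (2 * ‖z‖))) := by gcongr
      _ = ‖h‖ ^ 2 * 2 * (|P.weight l z| * (|m z| * Real.exp (2 * ‖z‖))) := by ring
      _ ≤ ‖h‖ ^ 2 * 2 * (C * Real.exp (-‖z‖)) := by gcongr
      _ = _ := by ring
  refine (norm_kerOp_le (P.isBddKernel_kern hdec)).trans_eq ?_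
  ring

theorem hasFDerivAt_weightOp {m : Space d → ℝ} (hm : IsTempered m) (l : Space d) :
    HasFDerivAt (P.weightOp m) (P.weightOpDeriv hm l) l := by
  rw [hasFDerivAt_iff_isLittleO_nhds_zero]
  obtain ⟨K, hK⟩ := P.exists_norm_weightOp_remainder_le hm l
  have h1 : ∀ h, P.weightOp m (l + h) - P.weightOp m l - P.weightOpDeriv hm l h =
      P.weightOp (fun z => m z * (Real.exp (-⟪h, z⟫_ℝ) - 1 + ⟪h, z⟫_ℝ)) l := by
    intro h
    rw [sub_sub, sub_eq_iff_eq_add, weightOpDeriv_apply,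
      ← P.weightOp_add hm (hm.mul_neg_inner h), weightOp_shift, ← P.weightOp_add
        (hm.mul (isTempered_remainder h)) ?_]
    · congr 1
      ext z
      ring
    · have := hm.mul (IsTempered.mk (m := fun z : Space d => 1 + -⟪h, z⟫_ℝ) (by fun_prop)
        ⟨1 + ‖h‖, 1, by positivity, fun z => ?_⟩)
      · simpa only [mul_add, mul_one] using this
      · have h2 := abs_real_inner_le_norm h z
        have h3 := Real.add_one_le_exp ‖z‖
        have h4 : |1 + -⟪h, z⟫_ℝ| ≤ 1 + |⟪h, z⟫_ℝ| := by
          refine (abs_add_le _ _).trans_eq ?_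
          rw [abs_one, abs_neg]
        rw [one_mul, add_mul, one_mul]
        have h5 : ‖h‖ * ‖z‖ ≤ ‖h‖ * Real.exp ‖z‖ := by
          gcongr
          linarith
        linarith [norm_nonneg z]
  simp_rw [h1]
  refine Asymptotics.IsBigO.trans_isLittleO (g := fun h : Space d => ‖h‖ ^ 2) ?_
    (Asymptotics.isLittleO_norm_pow_id one_lt_two)
  refine Asymptotics.IsBigO.of_bound K ?_
  filter_upwards [Metric.ball_mem_nhds (0 : Space d) one_pos] with h hh
  rw [norm_pow, norm_norm]
  exact hK h (mem_ball_zero_iff.1 hh).le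

/-- The directional derivative is again a `weightOp`, with a multiplier that is still tempered;
hence the induction over all multipliers at once. -/
theorem contDiff_weightOp (n : ℕ) {m : Space d → ℝ} (hm : IsTempered m) :
    ContDiff ℝ n (P.weightOp m) := by
  induction n generalizing m with
  | zero =>
    exact contDiff_zero.2 (Differentiable.continuous (𝕜 := ℝ)
      fun l => (P.hasFDerivAt_weightOp hm l).differentiableAt)
  | succ n ih =>
    rw [Nat.cast_add, Nat.cast_one, contDiff_succ_iff_fderiv]
    refine ⟨fun l => (P.hasFDerivAt_weightOp hm l).differentiableAt,
      fun h => absurd h (by simp), ?_⟩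
    have h1 : fderiv ℝ (P.weightOp m) = P.weightOpDeriv hm :=
      funext fun l => (P.hasFDerivAt_weightOp hm l).fderiv
    rw [h1, contDiff_clm_apply_iff]
    exact fun h => ih (hm.mul_neg_inner h)

theorem skewedGenerator_eq (l : Space d) : P.skewedGenerator l =
    P.weightOp (fun _ => 1) l - mulOp volume fun s => (P.rate s : ℂ) := by
  rw [← jumpData_op, JumpData.op, weightOp]
  simp only [mul_one]
  rfl

theorem contDiff_skewedGenerator : ContDiff ℝ 2 P.skewedGenerator := by
  have h := (P.contDiff_weightOp 2 isTempered_one).sub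
    (contDiff_const (c := mulOp volume fun s => (P.rate s : ℂ)))
  have h1 : P.skewedGenerator = fun l => P.weightOp (fun _ => 1) l -
      mulOp volume fun s => (P.rate s : ℂ) := funext P.skewedGenerator_eq
  rw [h1]
  exact h

/-- The bordered resolvent operator. -/
def borderedOp (q : Space d × ℝ) : L2 d →L[ℂ] L2 d := (P.jumpData q.1).bordered q.2

theorem borderedOp_eq (q : Space d × ℝ) : P.borderedOp q = q.2 • (1 : L2 d →L[ℂ] L2 d) -
    P.skewedGenerator q.1 + kerOp volume fun _ _ => (1 : ℝ) := by
  rw [borderedOp, JumpData.bordered, jumpData_op]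
  rfl

theorem contDiff_borderedOp : ContDiff ℝ 2 P.borderedOp := by
  have h1 : P.borderedOp = fun q : Space d × ℝ => q.2 • (1 : L2 d →L[ℂ] L2 d) -
      P.skewedGenerator q.1 + kerOp volume fun _ _ => (1 : ℝ) := funext P.borderedOp_eq
  rw [h1]
  have := P.contDiff_skewedGenerator
  fun_prop

/-- The scalar equation of which the Hamiltonian is the solution. -/
def dispersion (q : Space d × ℝ) : ℝ :=
  (⟪oneL2 (volume : Measure (Torus d)), Ring.inverse (P.borderedOp q) (oneL2 volume)⟫_ℂ).re

/-- The functional `T ↦ Re ⟪1, T 1⟫`. -/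
def meanFunctional (d : ℕ) : (L2 d →L[ℂ] L2 d) →L[ℝ] ℝ :=
  Complex.reCLM ∘L ((innerSL ℂ (oneL2 (volume : Measure (Torus d)))).restrictScalars ℝ) ∘L
    ((ContinuousLinearMap.apply ℂ (L2 d) (oneL2 volume)).restrictScalars ℝ)

theorem meanFunctional_apply (T : L2 d →L[ℂ] L2 d) : meanFunctional d T =
    (⟪oneL2 (volume : Measure (Torus d)), T (oneL2 volume)⟫_ℂ).re := rfl

theorem contDiffAt_dispersion {q : Space d × ℝ} (h : IsUnit (P.borderedOp q)) :
    ContDiffAt ℝ 2 P.dispersion q := by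
  obtain ⟨U, hU⟩ := h
  have h1 : ContDiffAt ℝ 2 (Ring.inverse : (L2 d →L[ℂ] L2 d) → _) (P.borderedOp q) := by
    rw [← hU]
    exact (contDiffAt_ringInverse ℂ U).restrict_scalars ℝ
  have h2 := h1.comp q P.contDiff_borderedOp.contDiffAt
  exact (meanFunctional d).contDiff.contDiffAt.comp q h2

theorem isUnit_borderedOp {l : Space d} (hl : l ∈ P.Γ) : IsUnit (P.borderedOp (l, P.H l)) := by
  rw [mem_Γ_iff, H_eq] at hl
  rw [borderedOp, H_eq]
  exact (P.jumpData l).isUnit_bordered hl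

theorem dispersion_H {l : Space d} (hl : l ∈ P.Γ) : P.dispersion (l, P.H l) = 1 := by
  rw [mem_Γ_iff, H_eq] at hl
  rw [dispersion, borderedOp, H_eq]
  exact (P.jumpData l).re_inner_inverse_bordered hl

/-- The derivative of the inverse of the bordered operator in `z` is minus its square, and the mean
of that square applied to one is positive. -/
theorem exists_hasDerivAt_dispersion {l : Space d} (hl : l ∈ P.Γ) :
    ∃ c < 0, HasDerivAt (fun z : ℝ => P.dispersion (l, z)) c (P.H l) := by
  obtain ⟨U, hU⟩ := P.isUnit_borderedOp hl
  have h0 := (P.jumpData l).re_inner_inverse_sq_bordered_pos (by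
    rwa [mem_Γ_iff, H_eq] at hl)
  rw [← H_eq] at h0
  change 0 < (⟪_, Ring.inverse (P.borderedOp (l, P.H l))
    (Ring.inverse (P.borderedOp (l, P.H l)) _)⟫_ℂ).re at h0
  have h1 : HasDerivAt (fun z : ℝ => P.borderedOp (l, z)) (1 : L2 d →L[ℂ] L2 d) (P.H l) := by
    have h2 : (fun z : ℝ => P.borderedOp (l, z)) = fun z : ℝ => z • (1 : L2 d →L[ℂ] L2 d) +
        (-P.skewedGenerator l + kerOp volume fun _ _ => (1 : ℝ)) := by
      ext1 z
      rw [borderedOp_eq]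
      abel
    rw [h2]
    have h3 := ((hasDerivAt_id (P.H l)).smul_const (1 : L2 d →L[ℂ] L2 d)).add_const
      (-P.skewedGenerator l + kerOp volume fun _ _ => (1 : ℝ))
    simpa using h3
  have h2 := (hasFDerivAt_ringInverse (𝕜 := ℂ) U).restrictScalars ℝ
  rw [hU] at h2
  have h3 := (meanFunctional d).hasFDerivAt.comp_hasDerivAt (P.H l)
    (h2.comp_hasDerivAt (P.H l) h1)
  refine ⟨_, ?_, h3⟩
  rw [← hU, Ring.inverse_unit] at h0
  simp only [meanFunctional_apply, ContinuousLinearMap.coe_restrictScalars', neg_apply,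
    ContinuousLinearMap.mulLeftRight_apply, mul_one, mul_apply_eq_comp, inner_neg_right,
    Complex.neg_re]
  linarith

/-- The implicit function theorem for `dispersion = 1`. Continuity of `H` puts `(m, H m)` into the
neighbourhood where the solution is unique, so the implicit function coincides with `H` near `l`. -/
theorem contDiffAt_H {l : Space d} (hl : l ∈ P.Γ) : ContDiffAt ℝ 2 P.H l := by
  have hf := P.contDiffAt_dispersion (P.isUnit_borderedOp hl)
  obtain ⟨c, hc, hd⟩ := P.exists_hasDerivAt_dispersion hl
  have hinv : (fderiv ℝ P.dispersion (l, P.H l) ∘L .inr ℝ (Space d) ℝ).IsInvertible := by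
    refine ⟨ContinuousLinearEquiv.unitsEquivAut ℝ (Units.mk0 c hc.ne), ?_⟩
    ext
    have h1 : HasDerivAt (fun z : ℝ => ((l, z) : Space d × ℝ)) (0, 1) (P.H l) :=
      (hasDerivAt_const _ _).prodMk (hasDerivAt_id _)
    have h2 := ((hf.differentiableAt (by simp)).hasFDerivAt.comp_hasDerivAt (P.H l) h1).unique hd
    simpa using h2.symm
  have h1 := hf.eventually_apply_eq_iff_implicitFunction (by simp) hinv
  have h2 : Tendsto (fun m => (m, P.H m)) (𝓝 l) (𝓝 (l, P.H l)) :=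
    (continuous_id.prodMk P.continuous_H).tendsto l
  refine (hf.contDiffAt_implicitFunction (by simp) hinv).congr_of_eventuallyEq ?_
  filter_upwards [h2.eventually h1, P.isOpen_Γ.mem_nhds hl] with m hm hm'
  exact (hm.1 (by rw [P.dispersion_H hm', P.dispersion_H hl])).symm

end Environment
end PeriodicJump
end

noncomputable section

namespace PeriodicJump

/-! ### Growth at infinity -/

namespace Environment

variable {d : ℕ} (P : Environment d)

/-- The truncated positive part makes the integral continuous in `α` by dominated convergence. It is
positive by the half-space condition, so compactness of the sphere gives a uniform bound. -/
theorem exists_halfSpace_bound : ∃ c > 0, ∀ α : Space d, ‖α‖ = 1 →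
    c ≤ ∫ z, P.a z * min (max ⟪α, z⟫_ℝ 0) 1 := by
  have hb : ∀ α z : Space d, |min (max ⟪α, z⟫_ℝ 0) 1| ≤ 1 := fun α z => by
    rw [abs_of_nonneg (by positivity)]
    exact min_le_right _ _
  have hb' : ∀ α z : Space d, ‖P.a z * min (max ⟪α, z⟫_ℝ 0) 1‖ ≤ P.a z := fun α z => by
    rw [norm_mul, Real.norm_of_nonneg (P.nonneg_a z)]
    exact mul_le_of_le_one_right (P.nonneg_a z) (hb α z)
  have hm : ∀ α : Space d, Measurable fun z => P.a z * min (max ⟪α, z⟫_ℝ 0) 1 := fun α => by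
    have := P.measurable_a
    fun_prop
  have hcont : Continuous fun α : Space d => ∫ z, P.a z * min (max ⟪α, z⟫_ℝ 0) 1 :=
    continuous_of_dominated (fun α => (hm α).aestronglyMeasurable)
      (fun α => ae_of_all _ (hb' α)) P.integrable_a (ae_of_all _ fun z => by fun_prop)
  obtain ⟨c, hc, h⟩ := (isCompact_sphere (0 : Space d) 1).exists_forall_le' hcont.continuousOn
    (a := 0) fun α hα => P.integral_pos_of_halfSpace
      (P.integrable_a.mono' (hm α).aestronglyMeasurable (ae_of_all _ (hb' α)))
      (fun z => mul_nonneg (P.nonneg_a z) (by positivity))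
      (h := α) (by rintro rfl; simp at hα)
      fun z hz hz' => mul_pos hz (lt_min (lt_max_of_lt_left hz') one_pos)
  exact ⟨c, hc, fun α hα => h α (by simpa using hα)⟩

theorem exists_exp_le_integral_weight : ∃ c > 0, ∃ δ > 0, ∀ l : Space d, l ≠ 0 →
    c * Real.exp (δ * ‖l‖) ≤ ∫ z, P.weight l z := by
  obtain ⟨c, hc, h⟩ := P.exists_halfSpace_bound
  refine ⟨c / 2, half_pos hc, c / 2, half_pos hc, fun l hl => ?_⟩
  have hn : 0 < ‖l‖ := norm_pos_iff.2 hl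
  set α : Space d := -(‖l‖⁻¹ • l)
  have hα : ‖α‖ = 1 := by
    rw [norm_neg, norm_smul, norm_inv, norm_norm, inv_mul_cancel₀ hn.ne']
  have hin : ∀ z, -⟪l, z⟫_ℝ = ‖l‖ * ⟪α, z⟫_ℝ := fun z => by
    rw [inner_neg_left, real_inner_smul_left]
    field_simp
  -- With `t = ⟪α, z⟫`, the truncation is at most `c / 2 + e^{‖l‖ (t - c / 2)}`: the first term
  -- covers `t ≤ c / 2`, the second `t ≥ c / 2`. Since `a` has mass one, half of `c` remains for the
  -- exponential term.
  have h1 : c ≤ ∫ z, (c / 2 * P.a z + Real.exp (-(c / 2 * ‖l‖)) * P.weight l z) := by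
    refine (h α hα).trans (integral_mono_of_nonneg
      (ae_of_all _ fun z => mul_nonneg (P.nonneg_a z) (by positivity))
      ((P.integrable_a.const_mul _).add ((P.integrable_weight l).const_mul _))
      (ae_of_all _ fun z => ?_))
    dsimp only
    rw [weight, mul_left_comm _ (P.a z), mul_comm (c / 2), ← mul_add, ← Real.exp_add, hin]
    refine mul_le_mul_of_nonneg_left ?_ (P.nonneg_a z)
    rcases le_total ⟪α, z⟫_ℝ (c / 2) with hle | hle
    · refine (min_le_left _ _).trans ((max_le hle (half_pos hc).le).trans ?_)
      exact le_add_of_nonneg_right (Real.exp_pos _).le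
    · refine (min_le_right _ _).trans (le_add_of_nonneg_of_le (half_pos hc).le ?_)
      refine Real.one_le_exp ?_
      have := mul_le_mul_of_nonneg_left hle hn.le
      linarith
  rw [integral_add (P.integrable_a.const_mul _) ((P.integrable_weight l).const_mul _),
    integral_const_mul, integral_const_mul, P.integral_a] at h1
  have h2 : c / 2 ≤ Real.exp (-(c / 2 * ‖l‖)) * ∫ z, P.weight l z := by linarith
  rw [Real.exp_neg, inv_mul_eq_div, le_div_iff₀ (Real.exp_pos _)] at h2
  exact h2

/-- The constant one is a subsolution at this level: the row masses are at least `Λmin` times the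
mass of the weight, and the killing rate is at most `Λmax`. -/
theorem le_H (l : Space d) : P.Λmin * (∫ z, P.weight l z) - P.Λmax ≤ P.H l := by
  rw [H_eq]
  refine (P.jumpData l).le_s_of_nonneg_sub (v := oneL2 volume) oneL2_nonneg oneL2_ne_zero ?_
  rw [JumpData.sub_smul_nonneg_iff _ oneL2_nonneg]
  have h1 := oneL2_apply (μ := (volume : Measure (Torus d)))
  filter_upwards [h1] with s hs
  have h2 : ∫ t, (P.jumpData l).k s t * (oneL2 (volume : Measure (Torus d)) t).re =
      ∫ t, (P.jumpData l).k s t := by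
    refine integral_congr_ae ?_
    filter_upwards [h1] with t ht
    rw [ht, Complex.one_re, mul_one]
  rw [h2, hs, Complex.one_re, mul_one]
  have h3 := (P.jumpData l).row s
  have h4 := le_of_abs_le ((P.jumpData l).g_le s)
  change (P.jumpData l).g s ≤ P.Λmax at h4
  change P.Λmin * ∫ z, P.weight l z ≤ _ at h3
  linarith

theorem exists_exp_le_H : ∃ c > 0, ∃ δ > 0, ∃ C : ℝ, ∀ l : Space d, l ≠ 0 →
    c * Real.exp (δ * ‖l‖) - C ≤ P.H l := by
  obtain ⟨c, hc, δ, hδ, h⟩ := P.exists_exp_le_integral_weight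
  refine ⟨P.Λmin * c, mul_pos P.Λmin_pos hc, δ, hδ, P.Λmax, fun l hl => ?_⟩
  have h1 := mul_le_mul_of_nonneg_left (h l hl) P.Λmin_pos.le
  have h2 := P.le_H l
  linarith

theorem tendsto_H_div_norm :
    Tendsto (fun l => P.H l / ‖l‖) (Bornology.cobounded (Space d)) atTop := by
  obtain ⟨c, hc, δ, hδ, C, h⟩ := P.exists_exp_le_H
  have h1 : Tendsto (fun l : Space d => c * δ ^ 2 / 2 * ‖l‖ - |C|)
      (Bornology.cobounded (Space d)) atTop :=
    tendsto_atTop_add_const_right _ _ (tendsto_norm_cobounded_atTop.const_mul_atTop (by positivity))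
  refine tendsto_atTop_mono' _ ?_ h1
  filter_upwards [tendsto_norm_cobounded_atTop.eventually_ge_atTop (1 : ℝ)] with l hl
  have hn : 0 < ‖l‖ := one_pos.trans_le hl
  have h2 := h l (norm_pos_iff.1 hn)
  have h3 := Real.quadratic_le_exp_of_nonneg (mul_nonneg hδ.le hn.le)
  have h4 : (δ * ‖l‖) ^ 2 / 2 ≤ Real.exp (δ * ‖l‖) := by
    have := mul_nonneg hδ.le hn.le
    linarith
  have h5 := mul_le_mul_of_nonneg_left h4 hc.le
  have h6 : C ≤ |C| * ‖l‖ := (le_abs_self C).trans (le_mul_of_one_le_right (abs_nonneg C) hl)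
  rw [le_div_iff₀ hn]
  calc _ = c * ((δ * ‖l‖) ^ 2 / 2) - |C| * ‖l‖ := by ring
    _ ≤ _ := by linarith

theorem exists_exp_le_θ : ∃ R₀ > (0 : ℝ), ∃ ca > (0 : ℝ), ∃ ce > (0 : ℝ), ∃ Cs : ℝ, ∀ l,
    R₀ ≤ ‖l‖ → l ∈ P.Γ ∧ ca * Real.exp (ce * ‖l‖) - Cs ≤ P.θ l := by
  obtain ⟨c, hc, δ, hδ, C, h⟩ := P.exists_exp_le_H
  -- Beyond this radius the linear bound `e^x ≥ 1 + x` already lifts the exponential lower bound of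
  -- `H` above `-gMin`.
  refine ⟨(|C| + |P.gMin| + 1) / (c * δ), by positivity, c, hc, δ, hδ, C, fun l hl => ?_⟩
  have hn : 0 < ‖l‖ := lt_of_lt_of_le (by positivity) hl
  have h1 := h l (norm_pos_iff.1 hn)
  have hΓ : l ∈ P.Γ := by
    rw [mem_Γ_iff]
    rw [div_le_iff₀ (mul_pos hc hδ)] at hl
    have h2 := mul_le_mul_of_nonneg_left (Real.add_one_le_exp (δ * ‖l‖)) hc.le
    have h3 := le_abs_self C
    have h4 := neg_abs_le P.gMin
    linarith
  exact ⟨hΓ, by rwa [P.θ_eq hΓ]⟩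

end Environment
end PeriodicJump
end

theorem mainTheorem6 {d : ℕ} (P : PeriodicJump.Environment d) :
    -- the Hamiltonian is the largest real part of a point of the spectrum (it is attained)
    (∀ l, IsGreatest (P.spectrumRe l) (P.H l)) ∧
    -- it is the principal eigenvalue on `Γ`, and `-g_min` elsewhere
    (∀ l ∈ P.Γ, P.IsPrincipalEigenvalue l (P.θ l) ∧ -P.gMin < P.θ l ∧ P.H l = P.θ l) ∧
    (∀ l ∉ P.Γ, P.H l = -P.gMin) ∧
    -- convexity
    ConvexOn ℝ univ P.H ∧
    -- strict convexity on `Γ`: positive definite Hessian, and strict convexity inequality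
    (IsOpen P.Γ ∧ ContDiffOn ℝ 2 P.H P.Γ ∧
      ∀ l ∈ P.Γ, ∀ h : PeriodicJump.Space d, h ≠ 0 → 0 < iteratedFDeriv ℝ 2 P.H l ![h, h]) ∧
    (∀ l ∈ P.Γ, ∀ m ∈ P.Γ, l ≠ m → ∀ t ∈ Ioo (0 : ℝ) 1,
      P.H (t • l + (1 - t) • m) < t * P.H l + (1 - t) * P.H m) ∧
    -- superlinear growth
    Tendsto (fun l => P.H l / ‖l‖) (Bornology.cobounded (PeriodicJump.Space d)) atTop ∧
    -- exponential lower growth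
    (∃ R₀ > (0 : ℝ), ∃ ca > (0 : ℝ), ∃ ce > (0 : ℝ), ∃ Cs : ℝ, ∀ l, R₀ ≤ ‖l‖ →
      l ∈ P.Γ ∧ ca * Real.exp (ce * ‖l‖) - Cs ≤ P.θ l) := by
  refine ⟨P.isGreatest_H, fun l hl => ?_, fun l hl => ?_, P.convexOn_H,
    ⟨P.isOpen_Γ, fun l hl => (P.contDiffAt_H hl).contDiffWithinAt,
      fun l hl h hh => P.hessian_H_pos hl (P.contDiffAt_H hl) hh⟩,
    fun l hl m hm hlm t ht => P.H_combination_lt hl hm hlm ht,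
    P.tendsto_H_div_norm, P.exists_exp_le_θ⟩
  · have h := (P.mem_Γ_iff l).1 hl
    rw [P.θ_eq hl]
    exact ⟨P.isPrincipalEigenvalue_H h, h, rfl⟩
  · exact le_antisymm (not_lt.1 fun h => hl ((P.mem_Γ_iff l).2 h)) (P.neg_gMin_le_H l)
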